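/- Let $\frac12<H<1$, $T>0$, and let $B=(B^{(1)},\dots,B^{(d)})$ be a $d$-dimensional fractional Brownian motion on a probability space $(\Omega,\mathcal F,\mathbb P)$, that is, a centred Gaussian process with almost surely continuous paths and $\mathbb E[B^{(i)}_sB^{(j)}_t]=\delta_{ij}R(s,t)$, $s,t\ge 0$, where $R(s,t)=\frac12\{s^{2H}+t^{2H}-|t-s|^{2H}\}$. Write $v(s)=R(s,s)$, $B_{s,t}=B_t-B_s$, $a\otimes b=(a^ib^j)_{i,j}$, and $\langle\cdot,\cdot\rangle$ for the Euclidean inner product on $\mathbb R^d$ and the Frobenius inner product on $\mathbb R^{d\times d}$. For $s,t\in(0,T]$, $s\ne t$, put $\Theta_{s,t}=v(s)v(t)-R(s,t)^2$ and $$\lambda_{11}=\tfrac{1}{\Theta_{s,t}}\{\tfrac12v'(s)v(t)-R(s,t)\partial_sR(s,t)\},\qquad \lambda_{12}=\tfrac{1}{\Theta_{s,t}}\{\partial_sR(s,t)v(s)-\tfrac12R(s,t)v'(s)\},$$ $$\lambda_{21}=\tfrac{1}{\Theta_{s,t}}\{\partial_tR(s,t)v(t)-\tfrac12R(s,t)v'(t)\},\qquad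 \lambda_{22}=\tfrac{1}{\Theta_{s,t}}\{\tfrac12v'(t)v(s)-R(s,t)\partial_tR(s,t)\},$$ and let $\mathcal W(s,t)=(\mathcal W^{ij}(s,t))_{i,j}$ be the random matrix $$\mathcal W^{ij}(s,t)=\lambda_{11}\lambda_{21}\big(B^{(i)}_sB^{(j)}_s-\mathbb E[B^{(i)}_sB^{(j)}_s]\big)+\lambda_{11}\lambda_{22}\big(B^{(i)}_sB^{(j)}_t-\mathbb E[B^{(i)}_sB^{(j)}_t]\big)$$ $$\qquad+\lambda_{12}\lambda_{21}\big(B^{(i)}_tB^{(j)}_s-\mathbb E[B^{(i)}_tB^{(j)}_s]\big)+\lambda_{12}\lambda_{22}\big(B^{(i)}_tB^{(j)}_t-\mathbb E[B^{(i)}_tB^{(j)}_t]\big).$$ Let $\langle f,h\rangle_{\mathcal H}=\int_{[0,T]^2}\langle f_s,h_t\rangle\,\frac{\partial^2R}{\partial t\,\partial s}(s,t)\,ds\,dt$, and let $$\Lambda(s,t)=\lim_{(\epsilon,\delta)\downarrow0}\frac1{\epsilon\delta}\,\mathbb E\big[B_{s,s+\epsilon}\otimes B_{t,t+\delta}\,\big|\,B_s,B_t\big]$$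 be the limit in $L^q(\Omega\times[0,T]^2;\mathbb R^{d\times d})$, with respect to $d\mathbb P\times ds\,dt$, for every $1\le q<\min\{\frac1{2H-1},\frac1{2-2H}\}$. Let $g:[0,T]\times\mathbb R^d\to\mathbb R^d$ be Borel and $Y_t=g(t,B_t)$. Assume that $(s,t)\mapsto Y_s\otimes Y_t$ belongs to $L^p(\Omega\times[0,T]^2;\mathbb R^{d\times d})$ for some $\max\{\frac1{2-2H},\frac1{2H-1}\}<p\le\infty$. Then the limit defining $\Lambda$ exists, the forward integral $$\int_0^TY_t\,d^-B_t=\lim_{\epsilon\downarrow0}\frac1\epsilon\int_0^T\langle Y_s,B_{s,s+\epsilon}\rangle\,ds$$ exists in $L^2(\mathbb P)$, all the integrals below converge absolutely, and $$\mathbb E\Big|\int_0^TY_t\,d^-B_t\Big|^2=\mathbb E\|Y\|_{\mathcal H}^2+\mathbb E\int_{[0,T]^2}\langle Y_s\otimes Y_t,\mathcal W(s,t)\rangle\,ds\,dt=\mathbb E\int_{[0,T]^2}\langle Y_s\otimes Y_t,\Lambda(s,t)\rangle\,ds\,dt .$$ -/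

import Mathlib

open MeasureTheory ProbabilityTheory Filter Topology
open scoped ENNReal NNReal

namespace ForwardFBM

noncomputable section

/-! ### Deterministic objects -/

/-- The covariance function of fractional Brownian motion with Hurst index `H`. -/
def R (H s t : ℝ) : ℝ := (s ^ (2 * H) + t ^ (2 * H) - |t - s| ^ (2 * H)) / 2

/-- The variance function `v(s) = R(s,s)`. -/
def v (H s : ℝ) : ℝ := R H s s

/-- `v'(s)`. -/
def dv (H s : ℝ) : ℝ := deriv (fun r => v H r) s

/-- The derivative of `R(s,t)` with respect to the time `s`. -/
def dRs (H s t : ℝ) : ℝ := deriv (fun r => R H r t) s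

/-- The derivative of `R(s,t)` with respect to the time `t`. -/
def dRt (H s t : ℝ) : ℝ := deriv (fun r => R H s r) t

/-- The mixed second derivative `∂²R/∂t∂s (s,t)`. -/
def ddR (H s t : ℝ) : ℝ := deriv (fun r => dRs H s r) t

/-- The determinant of the covariance matrix of `(B⁽¹⁾_s, B⁽¹⁾_t)`. -/
def Theta (H s t : ℝ) : ℝ := Matrix.det !![v H s, R H s t; R H s t, v H t]

/-- The coefficient `λ₁₁(s,t)`. -/
def lam11 (H s t : ℝ) : ℝ :=
  1 / Theta H s t * (1 / 2 * dv H s * v H t - R H s t * dRs H s t)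

/-- The coefficient `λ₁₂(s,t)`. -/
def lam12 (H s t : ℝ) : ℝ :=
  1 / Theta H s t * (dRs H s t * v H s - R H s t * (1 / 2 * dv H s))

/-- The coefficient `λ₂₁(s,t)`. -/
def lam21 (H s t : ℝ) : ℝ :=
  1 / Theta H s t * (dRt H s t * v H t - R H s t * (1 / 2 * dv H t))

/-- The coefficient `λ₂₂(s,t)`. -/
def lam22 (H s t : ℝ) : ℝ :=
  1 / Theta H s t * (1 / 2 * dv H t * v H s - R H s t * dRt H s t)

/-- Euclidean space `ℝ^d`. -/
abbrev Vec (d : ℕ) : Type := EuclideanSpace ℝ (Fin d)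

/-- The space `ℝ^{d×d}` of `d × d` matrices with the Frobenius norm and the Frobenius inner
product `⟨A, B⟩ = ∑_{i,j} A^{ij} B^{ij}`. -/
abbrev Mat (d : ℕ) : Type := EuclideanSpace ℝ (Fin d × Fin d)

/-- The tensor product `a ⊗ b = (a^i b^j)_{i,j}`. -/
def tensor {d : ℕ} (a b : Vec d) : Mat d := WithLp.toLp 2 fun ij => a ij.1 * b ij.2

/-- Lebesgue measure on `[0,T]`. -/
def leb (T : ℝ) : Measure ℝ := volume.restrict (Set.Icc 0 T)

/-- Lebesgue measure on the square `[0,T]²`. -/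
def leb2 (T : ℝ) : Measure (ℝ × ℝ) := (leb T).prod (leb T)

/-- The inner product `⟨f,g⟩_𝓗 = ∫_{[0,T]²} ⟨f_s, g_t⟩ ∂²R/∂t∂s (s,t) ds dt`. -/
def rkhsInner {d : ℕ} (H T : ℝ) (f g : ℝ → Vec d) : ℝ :=
  ∫ z, inner ℝ (f z.1) (g z.2) * ddR H z.1 z.2 ∂(leb2 T)

/-! ### Probabilistic objects -/

variable {Ω : Type*} [MeasurableSpace Ω]

/-- `B` (of which only the times `t ≥ 0` matter) is a `d`-dimensional fractional Brownian motion
with Hurst index `H`: a centred Gaussian process with almost surely continuous paths, whose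
components are independent copies of the scalar process with covariance `R`. -/
structure IsFBM {d : ℕ} (H : ℝ) (B : ℝ → Ω → Vec d) (P : Measure Ω) : Prop where
  measurable : ∀ t, 0 ≤ t → Measurable (B t)
  gaussian : IsGaussianProcess (fun t : ℝ≥0 => B t) P
  mean_zero : ∀ t, 0 ≤ t → ∀ i, ∫ ω, B t ω i ∂P = 0
  covariance : ∀ s t, 0 ≤ s → 0 ≤ t → ∀ i j,
    cov[fun ω => B s ω i, fun ω => B t ω j; P] = if i = j then R H s t else 0
  continuous : ∀ᵐ ω ∂P, ContinuousOn (fun t => B t ω) (Set.Ici 0)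

/-- The measure `dℙ × ds dt` on `Ω × [0,T]²`. -/
def prodMeasure (P : Measure Ω) (T : ℝ) : Measure (Ω × ℝ × ℝ) := P.prod (leb2 T)

/-- `𝔼 ∫_{[0,T]²} F(s,t) ds dt`. -/
def expInt (P : Measure Ω) (T : ℝ) (F : Ω → ℝ → ℝ → ℝ) : ℝ :=
  ∫ ω, ∫ z, F ω z.1 z.2 ∂(leb2 T) ∂P

/-- The random matrix `𝒲(s,t)`. -/
def W {d : ℕ} (P : Measure Ω) (H : ℝ) (B : ℝ → Ω → Vec d) (s t : ℝ) (ω : Ω) : Mat d :=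
  WithLp.toLp 2 fun ij =>
    lam11 H s t * lam21 H s t *
      (B s ω ij.1 * B s ω ij.2 - cov[fun ω => B s ω ij.1, fun ω => B s ω ij.2; P]) +
    lam11 H s t * lam22 H s t *
      (B s ω ij.1 * B t ω ij.2 - cov[fun ω => B s ω ij.1, fun ω => B t ω ij.2; P]) +
    lam12 H s t * lam21 H s t *
      (B t ω ij.1 * B s ω ij.2 - cov[fun ω => B t ω ij.1, fun ω => B s ω ij.2; P]) +
    lam12 H s t * lam22 H s t *
      (B t ω ij.1 * B t ω ij.2 - cov[fun ω => B t ω ij.1, fun ω => B t ω ij.2; P])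

/-- The sigma-algebra generated by the pair `(B_s, B_t)`. -/
abbrev sigmaPair {d : ℕ} (B : ℝ → Ω → Vec d) (s t : ℝ) : MeasurableSpace Ω :=
  MeasurableSpace.comap (fun ω => (B s ω, B t ω)) inferInstance

/-- `Λ⁻(ε,δ;s,t) = (εδ)⁻¹ 𝔼[B_{s,s+ε} ⊗ B_{t,t+δ} | B_s, B_t]`, entry by entry. -/
def LambdaApprox {d : ℕ} (P : Measure Ω) (B : ℝ → Ω → Vec d) (ε δ s t : ℝ) (ω : Ω) : Mat d :=
  WithLp.toLp 2 fun ij =>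
    1 / (ε * δ) *
      (P[fun ω' => (B (s + ε) ω' - B s ω') ij.1 * (B (t + δ) ω' - B t ω') ij.2
        | sigmaPair B s t]) ω

/-- `Λ` is the limit of `Λ⁻(ε,δ;·)` as `ε ↓ 0` and `δ ↓ 0` simultaneously, in
`L^q(Ω × [0,T]²; ℝ^{d×d})` for every `1 ≤ q < min {1/(2H-1), 1/(2-2H)}`.
The conditional expectation is only determined up to a null set for each `(s,t)`; the distance
`∫_{[0,T]²} 𝔼 |Λ⁻ - Λ|^q ds dt` is written as an iterated integral with the expectation
inside, where it does not depend on the versions chosen. -/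
structure IsLambda {d : ℕ} (P : Measure Ω) (H T : ℝ) (B : ℝ → Ω → Vec d)
    (L : ℝ → ℝ → Ω → Mat d) : Prop where
  memLp : ∀ q : ℝ, 1 ≤ q → q < min (1 / (2 * H - 1)) (1 / (2 - 2 * H)) →
    MemLp (fun x : Ω × ℝ × ℝ => L x.2.1 x.2.2 x.1) (ENNReal.ofReal q) (prodMeasure P T)
  tendsto : ∀ q : ℝ, 1 ≤ q → q < min (1 / (2 * H - 1)) (1 / (2 - 2 * H)) →
    Tendsto
      (fun e : ℝ × ℝ => ∫⁻ z, ∫⁻ ω,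
        ‖LambdaApprox P B e.1 e.2 z.1 z.2 ω - L z.1 z.2 ω‖ₑ ^ q ∂P ∂(leb2 T))
      (𝓝[>] (0 : ℝ) ×ˢ 𝓝[>] (0 : ℝ)) (𝓝 0)

/-- The forward approximation `I⁻(ε,Y,dB) = ε⁻¹ ∫_0^T ⟨Y_s, B_{s,s+ε}⟩ ds`. -/
def fwdApprox {d : ℕ} (T : ℝ) (Y B : ℝ → Ω → Vec d) (ε : ℝ) (ω : Ω) : ℝ :=
  1 / ε * ∫ s, inner ℝ (Y s ω) (B (s + ε) ω - B s ω) ∂(leb T)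

/-- `J` is the forward integral `∫_0^T Y d⁻B`: the approximations `I⁻(ε,Y,dB)` are well defined
(the time integral converges absolutely, almost surely) elements of `L²(ℙ)`, and they converge
to `J` in `L²(ℙ)` as `ε ↓ 0`. -/
structure IsForwardIntegral {d : ℕ} (P : Measure Ω) (T : ℝ) (Y B : ℝ → Ω → Vec d)
    (J : Ω → ℝ) : Prop where
  integrable_approx : ∀ ε, 0 < ε →
    ∀ᵐ ω ∂P, Integrable (fun s => inner ℝ (Y s ω) (B (s + ε) ω - B s ω)) (leb T)
  memLp_approx : ∀ ε, 0 < ε → MemLp (fwdApprox T Y B ε) 2 P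
  memLp : MemLp J 2 P
  tendsto : Tendsto (fun ε => eLpNorm (fun ω => fwdApprox T Y B ε ω - J ω) 2 P)
    (𝓝[>] (0 : ℝ)) (𝓝 0)

end

end ForwardFBM

/-! Write I(ε) for the forward approximation. By Fubini, E[I(ε) I(δ)] is the integral over Ω ×
[0,T]² of Y_s ⊗ Y_t paired with (εδ)⁻¹ B_{s,s+ε} ⊗ B_{t,t+δ}. Since Y_s ⊗ Y_t is a function of (B_s,
B_t), the second factor may be replaced by its conditional expectation Λ⁻(ε,δ;s,t)
(`IsFBM.integral_inner_incrProd`). If Λ⁻ → Λ in L^q, with q conjugate to an integrability exponent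
of Y ⊗ Y, then E[I(ε) I(δ)] converges to a single number as ε and δ tend to 0 independently. In a
Hilbert space this forces I(ε) to converge, and the number is the squared norm of the limit
(`exists_tendsto_of_tendsto_inner`).

The conditional expectation is computed by Gaussian regression. The residuals of both increments are
jointly independent of (B_s, B_t), so Λ⁻ is a product of two regressions plus a deterministic
multiple of the identity that corrects the mean (`condExp_mul_of_indep_residual`,
`IsFBM.lambdaApprox_ae_eq`). The regression coefficients, divided by ε or δ, tend to the λ's, and
the covariance of the increments over εδ tends to ∂²R/∂t∂s. Hence Λ = ∂²R/∂t∂s · I + 𝒲 (`limMat`).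

Passing from pointwise to L^q convergence needs a bound uniform in ε and δ: the L²(P) norms of Λ⁻ -
Λ and of Λ are at most a constant times `singBound`, that is s^(2H-2) + t^(2H-2) + |t-s|^(2H-2),
whose q-th power is integrable because q(2-2H) < 1. Two facts produce it. Second differences of
|x|^(2H) control the covariances of the increments (`abs_secondDiff_le_rpow`, `abs_secondDiff_le`),
and local nondeterminism bounds the determinant Θ from below (`Theta_add_ge`), so that the
regression has controlled variance (`sig2_coef_le`). Gaussianity turns variances into L⁴ norms, and
the Cauchy–Schwarz inequality bounds the products in L². -/

namespace ForwardFBM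

/-! ### Second differences of `|x| ^ (2H)` -/

section SecondDifference

variable {H : ℝ}

/-- The signed power `|x| ^ (2H - 2) * x`, a multiple of the derivative of `|x| ^ (2H)`. -/
noncomputable def sgnPow (H x : ℝ) : ℝ := |x| ^ (2 * H - 2) * x

lemma sgnPow_neg (x : ℝ) : sgnPow H (-x) = -sgnPow H x := by
  simp [sgnPow]

lemma sgnPow_of_pos {x : ℝ} (hx : 0 < x) : sgnPow H x = x ^ (2 * H - 1) := by
  rw [sgnPow, abs_of_pos hx, ← Real.rpow_add_one hx.ne']
  ring_nf

lemma hasDerivAt_abs_rpow_two_mul (hH : 1 / 2 < H) (x : ℝ) :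
    HasDerivAt (fun y : ℝ => |y| ^ (2 * H)) (2 * H * sgnPow H x) x := by
  have := hasDerivAt_abs_rpow x (p := 2 * H) (by linarith)
  rwa [mul_assoc] at this

lemma hasDerivAt_sgnPow {x : ℝ} (hx : x ≠ 0) :
    HasDerivAt (sgnPow H) ((2 * H - 1) * |x| ^ (2 * H - 2)) x := by
  have pos : ∀ y : ℝ, 0 < y →
      HasDerivAt (sgnPow H) ((2 * H - 1) * |y| ^ (2 * H - 2)) y := by
    intro y hy
    have h := Real.hasDerivAt_rpow_const (x := y) (p := 2 * H - 1) (Or.inl hy.ne')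
    rw [abs_of_pos hy]
    have e : 2 * H - 1 - 1 = 2 * H - 2 := by ring
    rw [e] at h
    refine h.congr_of_eventuallyEq ?_
    filter_upwards [lt_mem_nhds hy] with z hz using sgnPow_of_pos hz
  rcases lt_or_gt_of_ne hx with h | h
  · have h1 := (pos (-x) (by linarith)).comp x (hasDerivAt_neg x)
    rw [abs_neg] at h1
    have h2 := h1.neg
    simp only [mul_neg, mul_one, neg_neg] at h2
    refine h2.congr_of_eventuallyEq (Eventually.of_forall fun y => ?_)
    simp [sgnPow_neg]
  · exact pos x h

/-- As b - 1 ≤ 0, y^b = y · y^(b-1) ≥ y · a^(b-1). The power on the right is thus taken at the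
larger point. -/
lemma rpow_sub_rpow_le {b a y : ℝ} (hb' : b ≤ 1) (hy : 0 < y) (hya : y ≤ a) :
    a ^ b - y ^ b ≤ (a - y) * a ^ (b - 1) := by
  have ha : 0 < a := hy.trans_le hya
  have h1 : a ^ b = a * a ^ (b - 1) := by
    rw [mul_comm, ← Real.rpow_add_one ha.ne']; ring_nf
  have h2 : y ^ b = y * y ^ (b - 1) := by
    rw [mul_comm, ← Real.rpow_add_one hy.ne']; ring_nf
  have h3 : a ^ (b - 1) ≤ y ^ (b - 1) :=
    Real.rpow_le_rpow_of_nonpos hy hya (by linarith)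
  rw [h1, h2]
  nlinarith

/-- For points of equal sign `rpow_sub_rpow_le` applies. For opposite signs each of the two values
is at most |x|^(2H-1) and |x| ≤ |x - y|, whence the factor 2. -/
lemma abs_sgnPow_sub_le_of_abs_le (hH : 1 / 2 < H) (hH' : H < 1) {x y : ℝ} (hyx : |y| ≤ |x|) :
    |sgnPow H x - sgnPow H y| ≤ 2 * |x - y| * |x| ^ (2 * H - 2) := by
  have pos : ∀ x y : ℝ, 0 < x → |y| ≤ |x| →
      |sgnPow H x - sgnPow H y| ≤ 2 * |x - y| * |x| ^ (2 * H - 2) := by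
    intro x y hx hyx
    rw [abs_of_pos hx] at hyx
    rcases lt_or_ge 0 y with hy | hy
    · rw [abs_of_pos hy] at hyx
      rw [sgnPow_of_pos hx, sgnPow_of_pos hy, abs_of_pos hx,
        abs_of_nonneg (sub_nonneg.2 (Real.rpow_le_rpow hy.le hyx (by linarith))),
        abs_of_nonneg (sub_nonneg.2 hyx)]
      have h := rpow_sub_rpow_le (b := 2 * H - 1) (by linarith) hy hyx
      have e : 2 * H - 1 - 1 = 2 * H - 2 := by ring
      rw [e] at h
      have : 0 ≤ (x - y) * x ^ (2 * H - 2) := mul_nonneg (by linarith) (by positivity)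
      linarith
    · rw [abs_of_nonpos hy] at hyx
      have hy1 : |sgnPow H y| ≤ x ^ (2 * H - 1) := by
        rcases hy.eq_or_lt with h0 | h0
        · rw [h0]; simp only [sgnPow, mul_zero, abs_zero]; positivity
        · have : sgnPow H y = -sgnPow H (-y) := by rw [sgnPow_neg, neg_neg]
          rw [this, abs_neg, sgnPow_of_pos (by linarith : 0 < -y), abs_of_nonneg (by
            apply Real.rpow_nonneg; linarith)]
          exact Real.rpow_le_rpow (by linarith) hyx (by linarith)
      have e : x ^ (2 * H - 1) = x * x ^ (2 * H - 2) := by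
        rw [mul_comm x, ← Real.rpow_add_one hx.ne']; ring_nf
      have hx1 : |sgnPow H x| = x ^ (2 * H - 1) := by
        rw [sgnPow_of_pos hx, abs_of_nonneg (by positivity)]
      calc |sgnPow H x - sgnPow H y| ≤ |sgnPow H x| + |sgnPow H y| := abs_sub _ _
        _ ≤ 2 * (x * x ^ (2 * H - 2)) := by rw [hx1, ← e]; linarith
        _ ≤ 2 * |x - y| * |x| ^ (2 * H - 2) := by
          rw [abs_of_pos hx, abs_of_nonneg (by linarith : 0 ≤ x - y)]
          have : 0 ≤ (-y) * x ^ (2 * H - 2) := mul_nonneg (by linarith) (by positivity)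
          linarith
  rcases lt_trichotomy x 0 with h | h | h
  · have h1 := pos (-x) (-y) (by linarith) (by simpa using hyx)
    rw [sgnPow_neg, sgnPow_neg, abs_neg, ← abs_neg] at h1
    rw [← abs_neg (x - y)]
    convert h1 using 3 <;> ring_nf
  · subst h
    have : y = 0 := by simpa using hyx
    simp [this]
  · exact pos x y h hyx

/-- The exponent 2H-2 is negative, so a bound at the point of larger modulus implies the bound at
the other one. Only one of the two points has to stay away from 0. -/
lemma abs_sgnPow_sub_le (hH : 1 / 2 < H) (hH' : H < 1) {x : ℝ} (hx : x ≠ 0) (y : ℝ) :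
    |sgnPow H x - sgnPow H y| ≤ 2 * |x - y| * |x| ^ (2 * H - 2) := by
  rcases le_total |y| |x| with h | h
  · exact abs_sgnPow_sub_le_of_abs_le hH hH' h
  · have h1 := abs_sgnPow_sub_le_of_abs_le hH hH' h
    rw [abs_sub_comm, abs_sub_comm y x] at h1
    refine h1.trans (mul_le_mul_of_nonneg_left ?_ (by positivity))
    exact Real.rpow_le_rpow_of_nonpos (abs_pos.2 hx) h (by linarith)

lemma half_rpow_le (hH : 1 / 2 < H) {x : ℝ} (hx : 0 < x) :
    (x / 2) ^ (2 * H - 2) ≤ 2 * x ^ (2 * H - 2) := by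
  rw [Real.div_rpow hx.le (by norm_num), div_le_iff₀ (by positivity)]
  have : (1 : ℝ) / 2 ≤ 2 ^ (2 * H - 2) := by
    have := Real.rpow_le_rpow_of_exponent_le (x := 2) (y := -1) (z := 2 * H - 2)
      (by norm_num) (by linarith)
    rwa [Real.rpow_neg_one, ← one_div] at this
  have h5 : 0 < x ^ (2 * H - 2) := by positivity
  nlinarith

/-- If |y| ≤ |x| then |x| ≥ |x - y| / 2, which replaces the singular factor |x|^(2H-2) by 2|x -
y|^(2H-2). The resulting Hölder bound no longer sees the distance to 0. -/
lemma abs_sgnPow_sub_le_rpow (hH : 1 / 2 < H) (hH' : H < 1) (x y : ℝ) :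
    |sgnPow H x - sgnPow H y| ≤ 4 * |x - y| ^ (2 * H - 1) := by
  have key : ∀ x y : ℝ, |y| ≤ |x| →
      |sgnPow H x - sgnPow H y| ≤ 4 * |x - y| ^ (2 * H - 1) := by
    intro x y h
    refine (abs_sgnPow_sub_le_of_abs_le hH hH' h).trans ?_
    rcases eq_or_ne x y with rfl | hxy
    · simp only [sub_self, abs_zero, mul_zero, zero_mul]
      positivity
    have hd : 0 < |x - y| := abs_pos.2 (sub_ne_zero.2 hxy)
    have h2 : |x - y| / 2 ≤ |x| := by
      have := abs_sub x y
      linarith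
    have h3 : |x| ^ (2 * H - 2) ≤ (|x - y| / 2) ^ (2 * H - 2) :=
      Real.rpow_le_rpow_of_nonpos (by positivity) h2 (by linarith)
    have h4 := half_rpow_le hH hd
    have h6 : |x - y| ^ (2 * H - 1) = |x - y| * |x - y| ^ (2 * H - 2) := by
      rw [mul_comm |x - y|, ← Real.rpow_add_one hd.ne']
      ring_nf
    rw [h6]
    have := mul_le_mul_of_nonneg_left (h3.trans h4) hd.le
    linarith
  rcases le_total |y| |x| with h | h
  · exact key x y h
  · rw [abs_sub_comm, abs_sub_comm x y]
    exact key y x h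

/-- The second difference `f (x + a + b) - f (x + a) - f (x + b) + f x` of `f = |·| ^ (2H)`. -/
noncomputable def secondDiff (H x a b : ℝ) : ℝ :=
  |x + a + b| ^ (2 * H) - |x + a| ^ (2 * H) - |x + b| ^ (2 * H) + |x| ^ (2 * H)

lemma secondDiff_comm (x a b : ℝ) : secondDiff H x a b = secondDiff H x b a := by
  simp only [secondDiff, add_right_comm x a b]
  ring

/-- Mean value inequality in the step a; the derivative is 2H times a difference of `sgnPow`. The
ball of radius |a| treats both signs of a at once. -/
lemma abs_secondDiff_le_of_forall (hH : 1 / 2 < H) {x a b C : ℝ}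
    (hC : ∀ y, |y| ≤ |a| → |sgnPow H (x + y) - sgnPow H (x + y + b)| ≤ C) :
    |secondDiff H x a b| ≤ 2 * H * C * |a| := by
  have hd : ∀ y ∈ Metric.closedBall (0 : ℝ) |a|,
      HasDerivWithinAt (fun y => |x + y + b| ^ (2 * H) - |x + y| ^ (2 * H))
        (2 * H * sgnPow H (x + y + b) - 2 * H * sgnPow H (x + y))
        (Metric.closedBall (0 : ℝ) |a|) y := by
    intro y _
    have h1 := HasDerivAt.comp_add_const y b
      (HasDerivAt.comp_const_add x (y + b) (hasDerivAt_abs_rpow_two_mul hH _))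
    have h2 := HasDerivAt.comp_const_add x y (hasDerivAt_abs_rpow_two_mul hH _)
    simp only [← add_assoc] at h1
    exact (h1.sub h2).hasDerivWithinAt
  have hb : ∀ y ∈ Metric.closedBall (0 : ℝ) |a|,
      ‖2 * H * sgnPow H (x + y + b) - 2 * H * sgnPow H (x + y)‖ ≤ 2 * H * C := by
    intro y hy
    rw [← mul_sub, norm_mul, Real.norm_eq_abs, Real.norm_eq_abs, abs_of_pos (by linarith),
      abs_sub_comm]
    exact mul_le_mul_of_nonneg_left (hC y (by simpa using hy)) (by linarith)
  have := (convex_closedBall (0 : ℝ) |a|).norm_image_sub_le_of_norm_hasDerivWithin_le hd hb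
    (x := 0) (y := a) (by simp) (by simp)
  simp only [add_zero, sub_zero, Real.norm_eq_abs] at this
  refine le_trans (le_of_eq ?_) this
  rw [secondDiff]
  ring_nf

lemma abs_secondDiff_le_rpow (hH : 1 / 2 < H) (hH' : H < 1) (x a b : ℝ) :
    |secondDiff H x a b| ≤ 8 * H * (|a| * |b| ^ (2 * H - 1)) := by
  refine (abs_secondDiff_le_of_forall hH (C := 4 * |b| ^ (2 * H - 1)) fun y _ => ?_).trans
    (le_of_eq (by ring))
  refine (abs_sgnPow_sub_le_rpow hH hH' _ _).trans (le_of_eq ?_)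
  congr 2
  rw [← abs_neg]
  congr 1
  ring

/-- For |y| ≤ |a| the point x + y keeps distance |x| / 2 from 0, and `abs_sgnPow_sub_le` asks
nothing of x + y + b. So b may be large. -/
lemma abs_secondDiff_le_of_le (hH : 1 / 2 < H) (hH' : H < 1) {x a : ℝ} (b : ℝ) (hx : x ≠ 0)
    (ha : |a| ≤ |x| / 2) :
    |secondDiff H x a b| ≤ 8 * H * (|a| * |b| * (|x| / 2) ^ (2 * H - 2)) := by
  have hx' : 0 < |x| := abs_pos.2 hx
  have h := abs_secondDiff_le_of_forall hH (x := x) (a := a) (b := b)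
    (C := 2 * |b| * (|x| / 2) ^ (2 * H - 2)) fun y hy => by
      have h1 : |x| / 2 ≤ |x + y| := by
        have := abs_sub_abs_le_abs_sub x (-y)
        rw [abs_neg, sub_neg_eq_add] at this
        linarith
      have h2 : x + y ≠ 0 := abs_pos.1 (by linarith)
      refine (abs_sgnPow_sub_le hH hH' h2 _).trans ?_
      have e : |x + y - (x + y + b)| = |b| := by
        rw [← abs_neg]; congr 1; ring
      rw [e]
      exact mul_le_mul_of_nonneg_left
        (Real.rpow_le_rpow_of_nonpos (by positivity) h1 (by linarith)) (by positivity)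
  refine h.trans ?_
  have : 0 ≤ H * (|a| * |b| * (|x| / 2) ^ (2 * H - 2)) :=
    mul_nonneg (by linarith) (by positivity)
  linarith

/-- If one of the steps is at most |x| / 2, symmetry reduces to the previous bound. If both are
larger, the Hölder bound suffices, because |b|^(2H-2) ≤ (|x| / 2)^(2H-2). There is no smallness
condition on the steps, so the estimate can serve as a domination. -/
lemma abs_secondDiff_le (hH : 1 / 2 < H) (hH' : H < 1) {x : ℝ} (a b : ℝ) (hx : x ≠ 0) :
    |secondDiff H x a b| ≤ 16 * (|a| * |b| * |x| ^ (2 * H - 2)) := by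
  have hx' : 0 < |x| := abs_pos.2 hx
  have main : |secondDiff H x a b| ≤ 8 * H * (|a| * |b| * (|x| / 2) ^ (2 * H - 2)) := by
    rcases le_or_gt |a| (|x| / 2) with ha | ha
    · exact abs_secondDiff_le_of_le hH hH' b hx ha
    rcases le_or_gt |b| (|x| / 2) with hb | hb
    · rw [secondDiff_comm, mul_comm |a|]
      exact abs_secondDiff_le_of_le hH hH' a hx hb
    · refine (abs_secondDiff_le_rpow hH hH' x a b).trans ?_
      have hb0 : 0 < |b| := by linarith
      have e : |b| ^ (2 * H - 1) = |b| * |b| ^ (2 * H - 2) := by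
        rw [mul_comm |b|, ← Real.rpow_add_one hb0.ne']
        ring_nf
      rw [e, mul_assoc |a|]
      have : |b| ^ (2 * H - 2) ≤ (|x| / 2) ^ (2 * H - 2) :=
        Real.rpow_le_rpow_of_nonpos (by positivity) hb.le (by linarith)
      gcongr
  refine main.trans ?_
  have h1 := mul_le_mul_of_nonneg_left (half_rpow_le hH hx') (by positivity : 0 ≤ |a| * |b|)
  have h2 := mul_le_mul_of_nonneg_left h1 (by linarith : 0 ≤ 8 * H)
  have h3 : 0 ≤ |a| * |b| * |x| ^ (2 * H - 2) := by positivity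
  nlinarith

/-- Away from 0 the function `sgnPow` is strictly differentiable, so its increments are linear up to
a uniformly small relative error; the mean value inequality is then applied after subtracting the
linear term. Since the error is η|a||b| with a and b unrelated, dividing by ab gives a joint limit.
-/
lemma exists_abs_secondDiff_sub_le (hH : 1 / 2 < H) {x : ℝ} (hx : x ≠ 0) {η : ℝ} (hη : 0 < η) :
    ∃ ρ > 0, ∀ a b : ℝ, |a| < ρ → |b| < ρ →
      |secondDiff H x a b - 2 * H * (2 * H - 1) * |x| ^ (2 * H - 2) * (a * b)| ≤
        η * (|a| * |b|) := by
  set L := (2 * H - 1) * |x| ^ (2 * H - 2) with hL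
  have hs : HasStrictDerivAt (sgnPow H) L x := by
    refine hasStrictDerivAt_of_hasDerivAt_of_continuousAt (f' := fun y =>
      (2 * H - 1) * |y| ^ (2 * H - 2)) ?_ ?_
    · filter_upwards [isOpen_ne.mem_nhds hx] with y hy using hasDerivAt_sgnPow hy
    · exact ContinuousAt.mul continuousAt_const
        (ContinuousAt.rpow_const continuous_abs.continuousAt (Or.inl (abs_ne_zero.2 hx)))
  have ho := hs.hasStrictFDerivAt.isLittleO.def (c := η / (2 * H)) (by positivity)
  rw [nhds_prod_eq, Metric.nhds_basis_ball.prod_self.eventually_iff] at ho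
  obtain ⟨ρ, hρ, h⟩ := ho
  -- The argument x + y + b moves by up to |a| + |b|, hence half the radius.
  refine ⟨ρ / 2, by positivity, fun a b ha hb => ?_⟩
  have hd : ∀ y ∈ Metric.closedBall (0 : ℝ) |a|,
      HasDerivWithinAt
        (fun y => |x + y + b| ^ (2 * H) - |x + y| ^ (2 * H) - 2 * H * L * b * y)
        (2 * H * sgnPow H (x + y + b) - 2 * H * sgnPow H (x + y) - 2 * H * L * b)
        (Metric.closedBall (0 : ℝ) |a|) y := by
    intro y _
    have h1 := HasDerivAt.comp_add_const y b
      (HasDerivAt.comp_const_add x (y + b) (hasDerivAt_abs_rpow_two_mul hH _))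
    have h2 := HasDerivAt.comp_const_add x y (hasDerivAt_abs_rpow_two_mul hH _)
    simp only [← add_assoc] at h1
    have h3 := (hasDerivAt_id y).const_mul (2 * H * L * b)
    rw [mul_one] at h3
    exact ((h1.sub h2).sub h3).hasDerivWithinAt
  have hbd : ∀ y ∈ Metric.closedBall (0 : ℝ) |a|,
      ‖2 * H * sgnPow H (x + y + b) - 2 * H * sgnPow H (x + y) - 2 * H * L * b‖ ≤
        η * |b| := by
    intro y hy
    have hy' : |y| ≤ |a| := by simpa using hy
    have := h (x := (x + y + b, x + y)) ⟨by
      rw [Metric.mem_ball, Real.dist_eq]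
      have := abs_add_le y b
      rw [show x + y + b - x = y + b by ring]
      linarith, by
      rw [Metric.mem_ball, Real.dist_eq]
      rw [show x + y - x = y by ring]
      linarith⟩
    simp only [Real.norm_eq_abs, ContinuousLinearMap.toSpanSingleton_apply, smul_eq_mul,
      add_sub_cancel_left] at this
    have e : 2 * H * sgnPow H (x + y + b) - 2 * H * sgnPow H (x + y) - 2 * H * L * b =
        2 * H * (sgnPow H (x + y + b) - sgnPow H (x + y) - b * L) := by ring
    rw [e, norm_mul, Real.norm_eq_abs, Real.norm_eq_abs, abs_of_pos (by linarith)]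
    calc 2 * H * |sgnPow H (x + y + b) - sgnPow H (x + y) - b * L|
        ≤ 2 * H * (η / (2 * H) * |b|) := mul_le_mul_of_nonneg_left this (by linarith)
      _ = η * |b| := by field_simp
  have := (convex_closedBall (0 : ℝ) |a|).norm_image_sub_le_of_norm_hasDerivWithin_le hd hbd
    (x := 0) (y := a) (by simp) (by simp)
  simp only [add_zero, sub_zero, Real.norm_eq_abs, mul_zero] at this
  refine le_trans (le_of_eq ?_) (this.trans (le_of_eq (by ring)))
  rw [secondDiff, hL]
  ring_nf

end SecondDifference
/-! ### The covariance function and the regression coefficients -/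

section Covariance

variable {H : ℝ}

lemma R_comm (s t : ℝ) : R H s t = R H t s := by
  simp only [R, abs_sub_comm t s]
  ring

lemma v_eq (hH : 1 / 2 < H) (s : ℝ) : v H s = s ^ (2 * H) := by
  simp only [v, R, sub_self, abs_zero, Real.zero_rpow (by linarith : 2 * H ≠ 0)]
  ring

lemma Theta_eq (s t : ℝ) : Theta H s t = v H s * v H t - R H s t ^ 2 := by
  simp [Theta, Matrix.det_fin_two, sq]

lemma Theta_comm (s t : ℝ) : Theta H s t = Theta H t s := by
  rw [Theta_eq, Theta_eq, R_comm]
  ring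

lemma dRt_eq (s t : ℝ) : dRt H s t = dRs H t s := by
  simp only [dRt, dRs]
  congr 1
  funext r
  exact R_comm _ _

lemma lam22_eq (s t : ℝ) : lam22 H s t = lam11 H t s := by
  simp only [lam22, lam11, Theta_comm s t, dRt_eq, R_comm s t]

lemma lam21_eq (s t : ℝ) : lam21 H s t = lam12 H t s := by
  simp only [lam21, lam12, Theta_comm s t, dRt_eq, R_comm s t]

/-! ### Derivatives of the covariance function -/

lemma hasDerivAt_R_left (hH : 1 / 2 < H) {s : ℝ} (hs : 0 < s) (t : ℝ) :
    HasDerivAt (fun r => R H r t) (H * (s ^ (2 * H - 1) - sgnPow H (s - t))) s := by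
  have h1 := Real.hasDerivAt_rpow_const (x := s) (p := 2 * H) (Or.inl hs.ne')
  have h2 := HasDerivAt.comp_sub_const s t (hasDerivAt_abs_rpow_two_mul hH (s - t))
  have h3 := ((h1.add_const (t ^ (2 * H))).sub h2).div_const 2
  have e : (fun r => R H r t) =
      fun r => (((fun x => x ^ (2 * H) + t ^ (2 * H)) - fun x => |x - t| ^ (2 * H)) r) / 2 := by
    funext r
    simp only [R, Pi.sub_apply, abs_sub_comm r t]
  rw [e]
  refine h3.congr_deriv ?_
  ring

lemma dRs_eq (hH : 1 / 2 < H) {s : ℝ} (hs : 0 < s) (t : ℝ) :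
    dRs H s t = H * (s ^ (2 * H - 1) - sgnPow H (s - t)) :=
  (hasDerivAt_R_left hH hs t).deriv

/-- Both sides are H s^(2H-1), as `sgnPow` vanishes at 0. Consequently the λ's are values of
`regCoef`: they regress the formal derivative of β at one time on (β_s, β_t). -/
lemma half_dv_eq (hH : 1 / 2 < H) {s : ℝ} (hs : 0 < s) : 1 / 2 * dv H s = dRs H s s := by
  have h1 := Real.hasDerivAt_rpow_const (x := s) (p := 2 * H) (Or.inl hs.ne')
  have h2 : (fun r => v H r) = fun r => r ^ (2 * H) := funext fun r => v_eq hH r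
  rw [dRs_eq hH hs, dv, h2, h1.deriv]
  simp only [sgnPow, sub_self, mul_zero, sub_zero]
  ring

lemma ddR_eq (hH : 1 / 2 < H) {s t : ℝ} (hs : 0 < s) (hst : s ≠ t) :
    ddR H s t = H * (2 * H - 1) * |t - s| ^ (2 * H - 2) := by
  have h : (fun r => dRs H s r) = fun r => H * (s ^ (2 * H - 1) - sgnPow H (s - r)) :=
    funext fun r => dRs_eq hH hs r
  have h1 := HasDerivAt.comp_const_sub s t
    (hasDerivAt_sgnPow (H := H) (sub_ne_zero.2 hst))
  have h2 := ((h1.const_sub (s ^ (2 * H - 1))).const_mul H).deriv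
  rw [ddR, h, h2, abs_sub_comm]
  ring

/-- `s ^ (2H-2) + t ^ (2H-2) + |t - s| ^ (2H-2)`. -/
noncomputable def singBound (H s t : ℝ) : ℝ :=
  s ^ (2 * H - 2) + t ^ (2 * H - 2) + |t - s| ^ (2 * H - 2)

lemma singBound_comm (s t : ℝ) : singBound H s t = singBound H t s := by
  simp only [singBound, abs_sub_comm t s]
  ring

/-- The variance of `a β_s + b β_t` for a scalar fractional Brownian motion `β`. -/
noncomputable def sig2 (H s t a b : ℝ) : ℝ :=
  a ^ 2 * v H s + 2 * (a * b) * R H s t + b ^ 2 * v H t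

lemma sig2_swap (s t a b : ℝ) : sig2 H s t a b = sig2 H t s b a := by
  simp only [sig2, R_comm s t]
  ring

/-- The coefficient of `β_s` in the regression on `(β_s, β_t)` of a variable having covariances
`c₁` and `c₂` with `β_s` and `β_t`. -/
noncomputable def regCoef (H s t c₁ c₂ : ℝ) : ℝ :=
  (c₁ * v H t - c₂ * R H s t) / Theta H s t

/-- Covariance of the increment `β_{s+ε} - β_s` with `β_r`. -/
noncomputable def incCov (H s ε r : ℝ) : ℝ := R H (s + ε) r - R H s r

/-- One of the two normal equations of the regression; the other is obtained by exchanging (s, c₁)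
with (t, c₂). -/
lemma regCoef_normal₁ {s t : ℝ} (hΘ : Theta H s t ≠ 0) (c₁ c₂ : ℝ) :
    regCoef H s t c₁ c₂ * v H s + regCoef H t s c₂ c₁ * R H s t = c₁ := by
  rw [regCoef, regCoef, Theta_comm t s, R_comm t s]
  field_simp
  rw [Theta_eq]
  ring

/-- The variance of a regression is cᵀ Σ⁻¹ c, with Σ the covariance matrix of (β_s, β_t). -/
lemma sig2_regCoef {s t : ℝ} (hΘ : Theta H s t ≠ 0) (c₁ c₂ : ℝ) :
    sig2 H s t (regCoef H s t c₁ c₂) (regCoef H t s c₂ c₁) =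
      (c₁ ^ 2 * v H t - 2 * (c₁ * c₂) * R H s t + c₂ ^ 2 * v H s) / Theta H s t := by
  rw [sig2, regCoef, regCoef, Theta_comm t s, R_comm t s]
  field_simp
  rw [Theta_eq]
  ring

/-! ### Local nondeterminism and the variance of a regression -/

lemma add_rpow_two_mul_le (hH : 1 / 2 < H) (hH' : H < 1) {s u : ℝ} (hs : 0 < s) (hu : 0 < u) :
    (s + u) ^ (2 * H) ≤ s ^ (2 * H) + u ^ (2 * H) + 2 ^ H * (s ^ H * u ^ H) := by
  have e1 : (s + u) ^ (2 * H) = ((s ^ 2 + u ^ 2) + 2 * (s * u)) ^ H := by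
    rw [Real.rpow_mul (by positivity), Real.rpow_two]
    congr 1
    ring
  have e2 : ∀ x : ℝ, 0 < x → (x ^ 2) ^ H = x ^ (2 * H) := fun x hx => by
    rw [Real.rpow_mul hx.le, Real.rpow_two]
  have e3 : (2 * (s * u)) ^ H = 2 ^ H * (s ^ H * u ^ H) := by
    rw [Real.mul_rpow (by norm_num) (by positivity), Real.mul_rpow hs.le hu.le]
  rw [e1, ← e2 s hs, ← e2 u hu, ← e3]
  -- Subadditivity of x ↦ x^H, used twice: it splits off the cross term 2su and then separates s²
  -- from u².
  refine (Real.rpow_add_le_add_rpow (by positivity) (by positivity) (by linarith) hH'.le).trans ?_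
  gcongr
  exact Real.rpow_add_le_add_rpow (by positivity) (by positivity) (by linarith) hH'.le

/-- Local nondeterminism: covariance of `β_s` and `β_{s+u} - β_s`. -/
lemma sq_cov_le (hH : 1 / 2 < H) (hH' : H < 1) {s u : ℝ} (hs : 0 < s) (hu : 0 < u) :
    (((s + u) ^ (2 * H) - s ^ (2 * H) - u ^ (2 * H)) / 2) ^ 2 ≤
      2 ^ (2 * H - 2) * (s ^ (2 * H) * u ^ (2 * H)) := by
  have h1 := add_rpow_two_mul_le hH hH' hs hu
  have h2 : s ^ (2 * H) + u ^ (2 * H) ≤ (s + u) ^ (2 * H) :=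
    Real.add_rpow_le_rpow_add hs.le hu.le (by linarith)
  have e : ∀ x : ℝ, 0 < x → x ^ (2 * H) = x ^ H * x ^ H := fun x hx => by
    rw [← Real.rpow_add hx, two_mul]
  have e2 : (2 : ℝ) ^ (2 * H - 2) = 2 ^ H * 2 ^ H / 4 := by
    rw [Real.rpow_sub (by norm_num), e 2 (by norm_num)]
    norm_num
  -- By superadditivity the difference is nonnegative, so the upper bound may be squared. The
  -- constant is (2^H / 2)² = 2^(2H-2), which is less than 1.
  have h3 : ((s + u) ^ (2 * H) - s ^ (2 * H) - u ^ (2 * H)) ^ 2 ≤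
      (2 ^ H * (s ^ H * u ^ H)) ^ 2 := by
    apply pow_le_pow_left₀ <;> linarith
  rw [e2, e s hs, e u hu]
  rw [e s hs, e u hu] at h3
  nlinarith

lemma R_eq_add (hH : 1 / 2 < H) {s u : ℝ} (hu : 0 < u) :
    R H s (s + u) = v H s + ((s + u) ^ (2 * H) - s ^ (2 * H) - u ^ (2 * H)) / 2 := by
  rw [v_eq hH, R, add_sub_cancel_left, abs_of_pos hu]
  ring

lemma two_rpow_lt_one (hH' : H < 1) : (2 : ℝ) ^ (2 * H - 2) < 1 :=
  Real.rpow_lt_one_of_one_lt_of_neg (by norm_num) (by linarith)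

/-- A Gram determinant does not change when β_{s+u} is replaced by β_{s+u} - β_s. So Θ equals s^(2H)
u^(2H) minus the squared covariance estimated in `sq_cov_le`. -/
lemma Theta_add_ge (hH : 1 / 2 < H) (hH' : H < 1) {s u : ℝ} (hs : 0 < s) (hu : 0 < u) :
    (1 - 2 ^ (2 * H - 2)) * (s ^ (2 * H) * u ^ (2 * H)) ≤ Theta H s (s + u) := by
  have h := sq_cov_le hH hH' hs hu
  rw [Theta_eq, R_eq_add hH hu, v_eq hH, v_eq hH]
  nlinarith

lemma Theta_pos (hH : 1 / 2 < H) (hH' : H < 1) {s t : ℝ} (hs : 0 < s) (ht : 0 < t)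
    (hst : s ≠ t) : 0 < Theta H s t := by
  have key : ∀ s t : ℝ, 0 < s → s < t → 0 < Theta H s t := by
    intro s t hs hst
    have h := Theta_add_ge hH hH' hs (sub_pos.2 hst)
    rw [add_sub_cancel] at h
    refine lt_of_lt_of_le ?_ h
    have h1 := two_rpow_lt_one hH'
    have h2 := sub_pos.2 hst
    have h3 : 0 < 1 - (2 : ℝ) ^ (2 * H - 2) := by linarith
    positivity
  rcases lt_or_gt_of_ne hst with h | h
  · exact key s t hs h
  · rw [Theta_comm]
    exact key t s ht h

/-- The variance of a regression on `(β_s, β_{s+u})` is controlled by the covariances with `β_s`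
and `β_{s+u} - β_s`. -/
lemma sig2_regCoef_le (hH : 1 / 2 < H) (hH' : H < 1) {s u : ℝ} (hs : 0 < s) (hu : 0 < u)
    (c₁ c : ℝ) :
    sig2 H s (s + u) (regCoef H s (s + u) c₁ (c₁ + c)) (regCoef H (s + u) s (c₁ + c) c₁) ≤
      2 / (1 - 2 ^ (2 * H - 2)) * (c₁ ^ 2 / s ^ (2 * H) + c ^ 2 / u ^ (2 * H)) := by
  have hΘ : 0 < Theta H s (s + u) := Theta_pos hH hH' hs (by linarith) (by linarith)
  have hΘ' := Theta_add_ge hH hH' hs hu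
  have hk : 0 < 1 - (2 : ℝ) ^ (2 * H - 2) := by linarith [two_rpow_lt_one hH']
  have hc := sq_cov_le hH hH' hs hu
  rw [sig2_regCoef hΘ.ne']
  have hvt : v H (s + u) = s ^ (2 * H) + 2 *
      (((s + u) ^ (2 * H) - s ^ (2 * H) - u ^ (2 * H)) / 2) + u ^ (2 * H) := by
    rw [v_eq hH]; ring
  rw [R_eq_add hH hu, hvt, v_eq hH s]
  set ρ := ((s + u) ^ (2 * H) - s ^ (2 * H) - u ^ (2 * H)) / 2
  have hE : 0 < s ^ (2 * H) := by positivity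
  have hU : 0 < u ^ (2 * H) := by positivity
  set E := s ^ (2 * H)
  set U := u ^ (2 * H)
  have hρ : ρ ^ 2 ≤ E * U := by nlinarith [mul_pos hE hU]
  -- The cross term is absorbed by the inequality of means, using ρ² ≤ E U.
  have h1 : |2 * (c₁ * c * ρ)| ≤ c₁ ^ 2 * U + c ^ 2 * E := by
    apply abs_le_of_sq_le_sq _ (by positivity)
    have : (c₁ * c) ^ 2 * ρ ^ 2 ≤ (c₁ * c) ^ 2 * (E * U) :=
      mul_le_mul_of_nonneg_left hρ (sq_nonneg _)
    nlinarith [sq_nonneg (c₁ ^ 2 * U - c ^ 2 * E)]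
  -- In the basis (β_s, β_{s+u} - β_s) the numerator is c₁² U - 2 c₁ c ρ + c² E.
  have h2 : c₁ ^ 2 * (E + 2 * ρ + U) - 2 * (c₁ * (c₁ + c)) * (E + ρ) + (c₁ + c) ^ 2 * E ≤
      2 * (c₁ ^ 2 * U + c ^ 2 * E) := by
    have := neg_abs_le (2 * (c₁ * c * ρ))
    nlinarith
  rw [div_le_iff₀ hΘ]
  refine h2.trans ?_
  have h3 : 0 ≤ 2 / (1 - 2 ^ (2 * H - 2)) * (c₁ ^ 2 / E + c ^ 2 / U) := by positivity
  refine le_trans (le_of_eq ?_) (mul_le_mul_of_nonneg_left hΘ' h3)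
  generalize 1 - (2 : ℝ) ^ (2 * H - 2) = k at hk
  field_simp

/-- This identity and the next three write the covariances of an increment with the earlier of β_s,
β_t and with the difference of the two as second differences. One step is ±ε and the other is the
base time or the lag, so `abs_secondDiff_le_rpow` bounds them by a multiple of ε times that time to
the power 2H-1. -/
lemma incCov_self (hH : 1 / 2 < H) {s ε : ℝ} (hs : 0 < s) (hε : 0 < ε) :
    incCov H s ε s = 1 / 2 * secondDiff H 0 ε s := by
  have h0 : (0 : ℝ) ^ (2 * H) = 0 := Real.zero_rpow (by linarith)
  have e : s - (s + ε) = -ε := by ring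
  rw [incCov, R, R, secondDiff, e, abs_neg, zero_add, zero_add, abs_of_pos hs, abs_of_pos hε,
    abs_of_pos (by linarith : 0 < ε + s), sub_self, abs_zero, h0, add_comm s ε]
  ring

lemma incCov_early {r u ε : ℝ} (hr : 0 < r) (hu : 0 < u) (hε : 0 < ε) :
    incCov H (r + u) ε r = 1 / 2 * secondDiff H u ε r := by
  have e1 : r - (r + u + ε) = -(u + ε) := by ring
  have e2 : r - (r + u) = -u := by ring
  have e3 : u + ε + r = r + u + ε := by ring
  rw [incCov, R, R, secondDiff, e1, e2, e3, abs_neg, abs_neg, abs_of_pos hu,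
    abs_of_pos (by linarith : 0 < u + ε), abs_of_pos (by linarith : 0 < r + u + ε),
    abs_of_pos (by linarith : 0 < u + r), add_comm u r]
  ring

lemma incCov_late_sub (hH : 1 / 2 < H) {s u ε : ℝ} (hε : 0 < ε) :
    incCov H s ε (s + u) - incCov H s ε s = -(1 / 2 * secondDiff H 0 (-ε) u) := by
  have h0 : (0 : ℝ) ^ (2 * H) = 0 := Real.zero_rpow (by linarith)
  have e1 : s + u - (s + ε) = -ε + u := by ring
  have e2 : s - (s + ε) = -ε := by ring
  have e3 : s + u - s = u := by ring
  simp only [incCov, R, secondDiff, e1, e2, e3, zero_add, abs_neg, abs_of_pos hε, sub_self,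
    abs_zero, h0]
  ring

lemma incCov_self_sub (hH : 1 / 2 < H) {r u ε : ℝ} (hu : 0 < u) (hε : 0 < ε) :
    incCov H (r + u) ε (r + u) - incCov H (r + u) ε r = -(1 / 2 * secondDiff H u ε 0) +
      1 / 2 * secondDiff H 0 ε u := by
  have h0 : (0 : ℝ) ^ (2 * H) = 0 := Real.zero_rpow (by linarith)
  have e1 : r + u - (r + u + ε) = -ε := by ring
  have e2 : r - (r + u + ε) = -(u + ε) := by ring
  have e3 : r - (r + u) = -u := by ring
  simp only [incCov, R, secondDiff, e1, e2, e3, zero_add, abs_neg, abs_of_pos hε, sub_self,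
    abs_zero, h0, add_zero, abs_of_pos hu, abs_of_pos (by linarith : 0 < ε + u), add_comm u ε]
  ring

lemma secondDiff_zero_right (x a : ℝ) : secondDiff H x a 0 = 0 := by
  simp [secondDiff]

/-- Regression coefficient of `(β_{s+ε} - β_s) / ε` on `β_s`, for the regression on
`(β_s, β_t)`. -/
noncomputable def coefSelf (H s t ε : ℝ) : ℝ :=
  regCoef H s t (incCov H s ε s / ε) (incCov H s ε t / ε)

/-- Regression coefficient of `(β_{s+ε} - β_s) / ε` on `β_t`, for the regression on
`(β_s, β_t)`. -/
noncomputable def coefOther (H s t ε : ℝ) : ℝ :=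
  regCoef H t s (incCov H s ε t / ε) (incCov H s ε s / ε)

/-- Origin of the singular exponent: a squared covariance over a variance scales as (x^(2H-1))² /
x^(2H) = x^(2H-2). -/
lemma sq_div_rpow_le {c ε x : ℝ} (hH' : H < 1) (hε : 0 < ε) (hx : 0 < x)
    (hc : |c| ≤ 4 * H * (|ε| * |x| ^ (2 * H - 1))) :
    (c / ε) ^ 2 / x ^ (2 * H) ≤ 16 * x ^ (2 * H - 2) := by
  rw [abs_of_pos hε, abs_of_pos hx] at hc
  have h1 : |c / ε| ≤ 4 * x ^ (2 * H - 1) := by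
    rw [abs_div, abs_of_pos hε, div_le_iff₀ hε]
    have : 0 ≤ ε * x ^ (2 * H - 1) := by positivity
    nlinarith
  have h2 : (c / ε) ^ 2 ≤ (4 * x ^ (2 * H - 1)) ^ 2 := sq_le_sq' (by
    linarith [neg_abs_le (c / ε)]) ((le_abs_self _).trans h1)
  rw [div_le_iff₀ (by positivity)]
  refine h2.trans (le_of_eq ?_)
  rw [mul_pow, mul_assoc, ← Real.rpow_add hx, ← Real.rpow_mul_natCast hx.le]
  norm_num
  ring_nf

/-- The regression of `(β_{s+ε} - β_s) / ε` on `(β_s, β_t)` has variance bounded uniformly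
in `ε`. -/
lemma sig2_coef_le (hH : 1 / 2 < H) (hH' : H < 1) {s t ε : ℝ} (hs : 0 < s) (ht : 0 < t)
    (hst : s ≠ t) (hε : 0 < ε) :
    sig2 H s t (coefSelf H s t ε) (coefOther H s t ε) ≤
      32 / (1 - 2 ^ (2 * H - 2)) * singBound H s t := by
  have hk : 0 < 1 - (2 : ℝ) ^ (2 * H - 2) := by linarith [two_rpow_lt_one hH']
  have key : ∀ m u c₁ c : ℝ, 0 < m → 0 < u → |c₁| ≤ 4 * H * (|ε| * |m| ^ (2 * H - 1)) →
      |c| ≤ 4 * H * (|ε| * |u| ^ (2 * H - 1)) →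
      2 / (1 - 2 ^ (2 * H - 2)) * ((c₁ / ε) ^ 2 / m ^ (2 * H) + (c / ε) ^ 2 / u ^ (2 * H)) ≤
        32 / (1 - 2 ^ (2 * H - 2)) * singBound H m (m + u) := by
    intro m u c₁ c hm hu h1 h2
    have h3 := sq_div_rpow_le hH' hε hm h1
    have h4 := sq_div_rpow_le hH' hε hu h2
    have h5 : 0 ≤ (m + u) ^ (2 * H - 2) := by positivity
    have h6 : (c₁ / ε) ^ 2 / m ^ (2 * H) + (c / ε) ^ 2 / u ^ (2 * H) ≤
        16 * singBound H m (m + u) := by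
      rw [singBound, add_sub_cancel_left, abs_of_pos hu]
      linarith
    refine (mul_le_mul_of_nonneg_left h6 (by positivity)).trans (le_of_eq ?_)
    ring
  have half : ∀ x y z : ℝ, |1 / 2 * secondDiff H x y z| ≤
      4 * H * (|y| * |z| ^ (2 * H - 1)) := by
    intro x y z
    rw [abs_mul, abs_of_pos (by norm_num : (0 : ℝ) < 1 / 2)]
    linarith [abs_secondDiff_le_rpow hH hH' x y z]
  -- The earlier of the two times becomes the base point m and the lag becomes u, whether the
  -- increment starts at the earlier or at the later time.
  rcases lt_or_gt_of_ne hst with h | h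
  · obtain ⟨u, hu, rfl⟩ : ∃ u, 0 < u ∧ t = s + u := ⟨t - s, sub_pos.2 h, by ring⟩
    have h1 := sig2_regCoef_le hH hH' hs hu (incCov H s ε s / ε)
      ((incCov H s ε (s + u) - incCov H s ε s) / ε)
    rw [← add_div, add_sub_cancel] at h1
    refine h1.trans (key s u _ _ hs hu ?_ ?_)
    · rw [incCov_self hH hs hε]
      exact half _ _ _
    · rw [incCov_late_sub hH hε, abs_neg, ← abs_neg ε]
      exact half _ _ _
  · obtain ⟨u, hu, rfl⟩ : ∃ u, 0 < u ∧ s = t + u := ⟨s - t, sub_pos.2 h, by ring⟩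
    have h1 := sig2_regCoef_le hH hH' ht hu (incCov H (t + u) ε t / ε)
      ((incCov H (t + u) ε (t + u) - incCov H (t + u) ε t) / ε)
    rw [← add_div, add_sub_cancel] at h1
    rw [sig2_swap, singBound_comm]
    refine h1.trans (key t u _ _ ht hu ?_ ?_)
    · rw [incCov_early ht hu hε]
      exact half _ _ _
    · rw [incCov_self_sub hH hu hε, secondDiff_zero_right, mul_zero, neg_zero, zero_add]
      exact half _ _ _

/-! ### Limits of the regression coefficients -/

lemma tendsto_incCov_div (hH : 1 / 2 < H) {s : ℝ} (hs : 0 < s) (r : ℝ) :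
    Tendsto (fun ε => incCov H s ε r / ε) (𝓝[>] 0) (𝓝 (dRs H s r)) := by
  have h := (hasDerivAt_R_left hH hs r).tendsto_slope_zero_right
  rw [← dRs_eq hH hs] at h
  refine h.congr fun ε => ?_
  rw [incCov, smul_eq_mul, div_eq_inv_mul]

lemma tendsto_coefSelf (hH : 1 / 2 < H) {s : ℝ} (hs : 0 < s) (t : ℝ) :
    Tendsto (fun ε => coefSelf H s t ε) (𝓝[>] 0) (𝓝 (lam11 H s t)) := by
  have h : lam11 H s t = regCoef H s t (dRs H s s) (dRs H s t) := by
    rw [lam11, half_dv_eq hH hs, regCoef]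
    ring
  rw [h]
  exact (((tendsto_incCov_div hH hs s).mul_const _).sub
    ((tendsto_incCov_div hH hs t).mul_const _)).div_const _

lemma tendsto_coefOther (hH : 1 / 2 < H) {s : ℝ} (hs : 0 < s) (t : ℝ) :
    Tendsto (fun ε => coefOther H s t ε) (𝓝[>] 0) (𝓝 (lam12 H s t)) := by
  have h : lam12 H s t = regCoef H t s (dRs H s t) (dRs H s s) := by
    rw [lam12, half_dv_eq hH hs, regCoef, R_comm t s, Theta_comm t s]
    ring
  rw [h]
  exact (((tendsto_incCov_div hH hs t).mul_const _).sub
    ((tendsto_incCov_div hH hs s).mul_const _)).div_const _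

/-- Covariance of the increments `β_{s+ε} - β_s` and `β_{t+δ} - β_t`. -/
noncomputable def incInc (H s t ε δ : ℝ) : ℝ := incCov H s ε (t + δ) - incCov H s ε t

lemma incInc_eq (s t ε δ : ℝ) :
    incInc H s t ε δ = -(1 / 2 * secondDiff H (t - s) δ (-ε)) := by
  have e1 : t - s + δ + -ε = t + δ - (s + ε) := by ring
  have e2 : t - s + -ε = t - (s + ε) := by ring
  have e3 : t - s + δ = t + δ - s := by ring
  rw [incInc, incCov, incCov, R, R, R, R, secondDiff, e1, e2, e3]
  ring

lemma abs_incInc_div_le (hH : 1 / 2 < H) (hH' : H < 1) {s t ε δ : ℝ} (hst : s ≠ t)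
    (hε : 0 < ε) (hδ : 0 < δ) :
    |incInc H s t ε δ / (ε * δ)| ≤ 8 * |t - s| ^ (2 * H - 2) := by
  have h := abs_secondDiff_le hH hH' δ (-ε) (sub_ne_zero.2 hst.symm)
  rw [abs_neg, abs_of_pos hε, abs_of_pos hδ] at h
  rw [abs_div, abs_of_pos (mul_pos hε hδ), div_le_iff₀ (mul_pos hε hδ), incInc_eq, abs_neg,
    abs_mul, abs_of_pos (by norm_num : (0 : ℝ) < 1 / 2)]
  linarith

lemma tendsto_incInc_div (hH : 1 / 2 < H) {s t : ℝ} (hs : 0 < s) (hst : s ≠ t) :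
    Tendsto (fun e : ℝ × ℝ => incInc H s t e.1 e.2 / (e.1 * e.2)) (𝓝[>] 0 ×ˢ 𝓝[>] 0)
      (𝓝 (ddR H s t)) := by
  rw [Metric.tendsto_nhds]
  intro η hη
  obtain ⟨ρ, hρ, h⟩ := exists_abs_secondDiff_sub_le hH (sub_ne_zero.2 hst.symm) hη
  have hm : ∀ᶠ ε in 𝓝[>] (0 : ℝ), 0 < ε ∧ ε < ρ := Ioo_mem_nhdsGT hρ
  filter_upwards [hm.prod_mk hm] with e he
  obtain ⟨⟨h1, h2⟩, h3, h4⟩ := he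
  have h5 := h e.2 (-e.1) (by rwa [abs_of_pos h3]) (by rwa [abs_neg, abs_of_pos h1])
  rw [abs_neg, abs_of_pos h1, abs_of_pos h3] at h5
  have h6 : 0 < e.1 * e.2 := mul_pos h1 h3
  have e6 : incInc H s t e.1 e.2 / (e.1 * e.2) - ddR H s t = -(1 / 2) *
      (secondDiff H (t - s) e.2 (-e.1) -
        2 * H * (2 * H - 1) * |t - s| ^ (2 * H - 2) * (e.2 * -e.1)) / (e.1 * e.2) := by
    rw [incInc_eq, ddR_eq hH hs hst]
    field_simp
    ring
  rw [Real.dist_eq, e6, abs_div, abs_of_pos h6, div_lt_iff₀ h6, abs_mul, abs_neg,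
    abs_of_pos (by norm_num : (0 : ℝ) < 1 / 2)]
  nlinarith

end Covariance
/-! ### Integrability of the singular bound -/

section Singular

variable {H T : ℝ}

instance isFiniteMeasure_leb : IsFiniteMeasure (leb T) := by
  unfold leb
  infer_instance

instance isFiniteMeasure_leb2 : IsFiniteMeasure (leb2 T) := by
  unfold leb2
  infer_instance

lemma ae_leb_pos : ∀ᵐ s ∂(leb T), 0 < s ∧ s ≤ T := by
  have h1 : ∀ᵐ s : ℝ ∂(leb T), s ≠ 0 := by
    unfold leb
    exact ae_restrict_of_ae (Measure.ae_ne volume 0)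
  have h2 : ∀ᵐ s : ℝ ∂(leb T), s ∈ Set.Icc 0 T := ae_restrict_mem measurableSet_Icc
  filter_upwards [h1, h2] with s h1 h2
  exact ⟨lt_of_le_of_ne h2.1 h1.symm, h2.2⟩

instance nullSingletonClass_leb : NullSingletonClass (leb T) := by
  unfold leb
  infer_instance

lemma ae_leb2 : ∀ᵐ z ∂(leb2 T), (0 < z.1 ∧ z.1 ≤ T) ∧ (0 < z.2 ∧ z.2 ≤ T) ∧ z.1 ≠ z.2 := by
  have h1 : ∀ᵐ z ∂(leb2 T), 0 < z.1 ∧ z.1 ≤ T := Measure.quasiMeasurePreserving_fst.ae ae_leb_pos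
  have h2 : ∀ᵐ z ∂(leb2 T), 0 < z.2 ∧ z.2 ≤ T := Measure.quasiMeasurePreserving_snd.ae ae_leb_pos
  have h3 : ∀ᵐ z ∂(leb2 T), z.1 ≠ z.2 := by
    have hm : MeasurableSet {z : ℝ × ℝ | z.1 ≠ z.2} :=
      (measurableSet_eq_fun measurable_fst measurable_snd).compl
    refine (Measure.ae_prod_iff_ae_ae hm).2 (Eventually.of_forall fun x => ?_)
    filter_upwards [Measure.ae_ne (leb T) x] with y hy using hy.symm
  filter_upwards [h1, h2, h3] with z h1 h2 h3 using ⟨h1, h2, h3⟩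

lemma integrableOn_rpow_Ioc {γ : ℝ} (hγ : -1 < γ) (hT : 0 ≤ T) :
    IntegrableOn (fun x : ℝ => x ^ γ) (Set.Ioc 0 T) :=
  (intervalIntegrable_iff_integrableOn_Ioc_of_le hT).1 (intervalIntegral.intervalIntegrable_rpow' hγ)

/-- On the half z.2 < z.1 the function is the integrand of a convolution of two integrable
functions, the indicator of [0,T] and x^γ on (0,T]. The other half follows by swapping the
coordinates. -/
lemma integrable_abs_sub_rpow {γ : ℝ} (hγ : -1 < γ) (hT : 0 ≤ T) :
    Integrable (fun z : ℝ × ℝ => |z.2 - z.1| ^ γ) (leb2 T) := by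
  set ψ : ℝ → ℝ := (Set.Ioc 0 T).indicator fun x => x ^ γ with hψ
  have hψi : Integrable ψ := (integrable_indicator_iff measurableSet_Ioc).2
    (integrableOn_rpow_Ioc hγ hT)
  have hone : Integrable ((Set.Icc (0 : ℝ) T).indicator fun _ => (1 : ℝ)) :=
    (integrable_indicator_iff measurableSet_Icc).2 (by simp)
  have hc : Integrable (fun z : ℝ × ℝ => ψ (z.1 - z.2)) (leb2 T) := by
    have h := hone.convolution_integrand (ContinuousLinearMap.mul ℝ ℝ) hψi
    simp only [ContinuousLinearMap.mul_apply'] at h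
    have h2 : leb2 T = (volume.prod volume).restrict (Set.Icc 0 T ×ˢ Set.Icc 0 T) := by
      rw [leb2, leb, Measure.prod_restrict]
    rw [h2]
    refine (h.restrict (s := Set.Icc 0 T ×ˢ Set.Icc 0 T)).congr ?_
    filter_upwards [ae_restrict_mem (measurableSet_Icc.prod measurableSet_Icc)] with z hz
    rw [Set.indicator_of_mem hz.2, one_mul]
  have hc' : Integrable (fun z : ℝ × ℝ => ψ (z.2 - z.1)) (leb2 T) := hc.swap
  refine (hc.add hc').congr ?_
  filter_upwards [ae_leb2] with z hz
  obtain ⟨⟨h1, h2⟩, ⟨h3, h4⟩, h5⟩ := hz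
  simp only [Pi.add_apply, hψ]
  rcases lt_or_gt_of_ne h5 with h | h
  · rw [Set.indicator_of_notMem (by simp [h.le]), Set.indicator_of_mem (a := z.2 - z.1) (s := Set.Ioc 0 T) ⟨by linarith, by linarith⟩,
      zero_add, abs_of_pos (by linarith)]
  · rw [Set.indicator_of_mem (a := z.1 - z.2) (s := Set.Ioc 0 T) ⟨by linarith, by linarith⟩,
      Set.indicator_of_notMem (by simp [h.le]), add_zero, abs_sub_comm, abs_of_pos (by linarith)]

lemma memLp_of_integrable_rpow {α : Type*} [MeasurableSpace α] {μ : Measure α} {f : α → ℝ} {q : ℝ}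
    (hq : 0 < q) (hf : AEStronglyMeasurable f μ) (h : Integrable (fun x => |f x| ^ q) μ) :
    MemLp f (ENNReal.ofReal q) μ := by
  refine (integrable_norm_rpow_iff hf (by simpa using hq) ENNReal.ofReal_ne_top).1 ?_
  rwa [ENNReal.toReal_ofReal hq.le]

lemma memLp_rpow_leb {q : ℝ} (hq : 0 < q) (hqH : q * (2 - 2 * H) < 1) (hT : 0 ≤ T) :
    MemLp (fun s : ℝ => s ^ (2 * H - 2)) (ENNReal.ofReal q) (leb T) := by
  refine memLp_of_integrable_rpow hq (by fun_prop) ?_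
  have h : Integrable (fun x : ℝ => x ^ (q * (2 * H - 2))) (leb T) := by
    rw [leb]
    exact (integrableOn_Icc_iff_integrableOn_Ioc (by simp)).2
      (integrableOn_rpow_Ioc (by linarith) hT)
  refine h.congr ?_
  filter_upwards [ae_leb_pos] with s hs
  rw [abs_of_nonneg (Real.rpow_nonneg hs.1.le _), ← Real.rpow_mul hs.1.le, mul_comm q]

lemma memLp_singBound {q : ℝ} (hq : 0 < q) (hqH : q * (2 - 2 * H) < 1) (hT : 0 ≤ T) :
    MemLp (fun z : ℝ × ℝ => singBound H z.1 z.2) (ENNReal.ofReal q) (leb2 T) := by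
  have h1 := (memLp_rpow_leb hq hqH hT).comp_fst (leb T)
  have h2 := (memLp_rpow_leb hq hqH hT).comp_snd (leb T)
  have h3 : MemLp (fun z : ℝ × ℝ => |z.2 - z.1| ^ (2 * H - 2)) (ENNReal.ofReal q) (leb2 T) := by
    refine memLp_of_integrable_rpow hq (by
      have : Measurable fun z : ℝ × ℝ => |z.2 - z.1| ^ (2 * H - 2) := by measurability
      exact this.aestronglyMeasurable) ?_
    refine (integrable_abs_sub_rpow (γ := q * (2 * H - 2)) (by linarith) hT).congr
      (Eventually.of_forall fun z => ?_)
    simp only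
    rw [abs_of_nonneg (a := |z.2 - z.1| ^ (2 * H - 2)) (by positivity),
      ← Real.rpow_mul (abs_nonneg _), mul_comm q]
  exact (h1.add h2).add h3

end Singular

/-! ### A jointly measurable modification -/

section Measurability

variable {Ω : Type*} [MeasurableSpace Ω] {P : Measure Ω} {d : ℕ} {H T : ℝ} {B : ℝ → Ω → Vec d}

/-- A process with continuous paths is jointly measurable. To have continuity for every ω and every
real time, paths are set to 0 on a null set and frozen at their value at time 0 for negative times.
-/
lemma IsFBM.exists_measurable_modification (hB : IsFBM H B P) :
    ∃ B' : Ω × ℝ → Vec d, Measurable B' ∧ ∀ᵐ ω ∂P, ∀ t, 0 ≤ t → B t ω = B' (ω, t) := by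
  obtain ⟨N, hN, hNm, hN0⟩ := exists_measurable_superset_of_null (ae_iff.1 hB.continuous)
  set u : ℝ → Ω → Vec d := fun t ω => (Nᶜ).indicator (B (max t 0)) ω with hu
  have hm : Measurable (Function.uncurry fun t ω => u t ω) := by
    refine measurable_uncurry_of_continuous_of_measurable (fun ω => ?_) fun t => ?_
    · by_cases h : ω ∈ N
      · simp only [hu, Set.indicator_of_notMem (Set.notMem_compl_iff.2 h)]
        exact continuous_const
      · simp only [hu, Set.indicator_of_mem (Set.mem_compl h)]
        have hc : ContinuousOn (fun t => B t ω) (Set.Ici 0) := by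
          by_contra hc
          exact h (hN hc)
        exact hc.comp_continuous (by fun_prop) fun t =>
          Set.mem_Ici.2 (le_max_right t 0)
    · exact (hB.measurable _ (le_max_right _ _)).indicator hNm.compl
  refine ⟨fun x => u x.2 x.1, hm.comp measurable_swap, ?_⟩
  have : ∀ᵐ ω ∂P, ω ∉ N := measure_eq_zero_iff_ae_notMem.1 hN0
  filter_upwards [this] with ω hω t ht
  simp only [hu, Set.indicator_of_mem (Set.mem_compl hω), max_eq_left ht]

end Measurability
/-! ### Conditional expectation of a product given regression -/

section Regression

variable {Ω E : Type*} {m : MeasurableSpace Ω} [mΩ : MeasurableSpace Ω] [MeasurableSpace E]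
  {P : Measure Ω} [IsProbabilityMeasure P]

/-- If the residuals of `X` and `X'` are centred and independent of `G`, the conditional expectation
of `X * X'` given `G` is the product of the regressions plus a constant. -/
lemma condExp_mul_of_indep_residual {G : Ω → E} {L L' : E → ℝ} {X X' : Ω → ℝ}
    (hm : m = MeasurableSpace.comap G inferInstance) (hG : Measurable G) (hL : Measurable L) (hL' : Measurable L')
    (hX : Measurable X) (hX' : Measurable X')
    (hX2 : MemLp X 2 P) (hX2' : MemLp X' 2 P)
    (hL2 : MemLp (fun ω => L (G ω)) 2 P) (hL2' : MemLp (fun ω => L' (G ω)) 2 P)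
    (hind : IndepFun G (fun ω => (X ω - L (G ω), X' ω - L' (G ω))) P)
    (h0 : ∫ ω, (X ω - L (G ω)) ∂P = 0) (h0' : ∫ ω, (X' ω - L' (G ω)) ∂P = 0) :
    P[fun ω => X ω * X' ω | m] =ᵐ[P]
      fun ω => L (G ω) * L' (G ω) +
        (∫ ω, X ω * X' ω ∂P - ∫ ω, L (G ω) * L' (G ω) ∂P) := by
  have hmle : m ≤ mΩ := hm ▸ hG.comap_le
  set A : Ω → ℝ := fun ω => L (G ω) with hA
  set A' : Ω → ℝ := fun ω => L' (G ω) with hA'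
  set Z : Ω → ℝ := fun ω => X ω - A ω with hZ
  set Z' : Ω → ℝ := fun ω => X' ω - A' ω with hZ'
  have hGm : Measurable[m] G := hm ▸ comap_measurable G
  have hAm : StronglyMeasurable[m] A := (hL.comp hGm).stronglyMeasurable
  have hAm' : StronglyMeasurable[m] A' := (hL'.comp hGm).stronglyMeasurable
  have hZ2 : MemLp Z 2 P := hX2.sub hL2
  have hZ2' : MemLp Z' 2 P := hX2'.sub hL2'
  have hZi : Integrable Z P := hZ2.integrable (by norm_num)
  have hZi' : Integrable Z' P := hZ2'.integrable (by norm_num)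
  -- Independence makes the conditional expectation of any function of the residuals constant; the
  -- coordinates and their product are the cases needed.
  have ind : ∀ φ : ℝ × ℝ → ℝ, Measurable φ →
      P[fun ω => φ (Z ω, Z' ω) | m] =ᵐ[P] fun _ => ∫ ω, φ (Z ω, Z' ω) ∂P := by
    intro φ hφ
    have hpm : Measurable fun ω => (Z ω, Z' ω) :=
      (hX.sub (hL.comp hG)).prodMk (hX'.sub (hL'.comp hG))
    refine condExp_indep_eq hpm.comap_le hmle (f := fun ω => φ (Z ω, Z' ω)) ?_ ?_
    · exact (hφ.comp (comap_measurable _)).stronglyMeasurable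
    · rw [hm]
      exact hind.symm
  have e1 : P[A * A' | m] = A * A' :=
    condExp_of_stronglyMeasurable hmle (hAm.mul hAm') (hL2.integrable_mul hL2')
  have e2 : P[A * Z' | m] =ᵐ[P] 0 := by
    refine (condExp_mul_of_stronglyMeasurable_left hAm (hL2.integrable_mul hZ2') hZi').trans ?_
    filter_upwards [ind Prod.snd measurable_snd] with ω hω
    rw [Pi.mul_apply, hω, h0', mul_zero]
    rfl
  have e3 : P[A' * Z | m] =ᵐ[P] 0 := by
    refine (condExp_mul_of_stronglyMeasurable_left hAm' (hL2'.integrable_mul hZ2) hZi).trans ?_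
    filter_upwards [ind Prod.fst measurable_fst] with ω hω
    rw [Pi.mul_apply, hω, h0, mul_zero]
    rfl
  have e4 : P[Z * Z' | m] =ᵐ[P] fun _ => ∫ ω, Z ω * Z' ω ∂P :=
    ind (fun p => p.1 * p.2) (by fun_prop)
  have hsplit : (fun ω => X ω * X' ω) = A * A' + A * Z' + A' * Z + Z * Z' := by
    funext ω
    simp only [hZ, hZ', Pi.add_apply, Pi.mul_apply]
    ring
  have i1 := hL2.integrable_mul hL2'
  have i2 := hL2.integrable_mul hZ2'
  have i3 := hL2'.integrable_mul hZ2
  have i4 := hZ2.integrable_mul hZ2'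
  have main : P[fun ω => X ω * X' ω | m] =ᵐ[P] fun ω => A ω * A' ω + ∫ ω, Z ω * Z' ω ∂P := by
    rw [hsplit]
    filter_upwards [condExp_add ((i1.add i2).add i3) i4 m, condExp_add (i1.add i2) i3 m,
      condExp_add i1 i2 m, e2, e3, e4] with ω h1 h2 h3 h4 h5 h6
    rw [h1, Pi.add_apply, h2, Pi.add_apply, h3, Pi.add_apply, h4, h5, h6, e1]
    simp
  -- The constant is found by taking expectations in `main`, without computing the covariance of the
  -- residuals.
  have hc : ∫ ω, Z ω * Z' ω ∂P = ∫ ω, X ω * X' ω ∂P - ∫ ω, A ω * A' ω ∂P := by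
    have h1 := integral_condExp hmle (μ := P) (f := fun ω => X ω * X' ω)
    have i1' : Integrable (fun ω => A ω * A' ω) P := i1
    rw [integral_congr_ae main, integral_add i1' (integrable_const _), integral_const] at h1
    simp only [probReal_univ, one_smul] at h1
    linarith
  rw [← hc]
  exact main

end Regression

/-! ### Gaussian computations for fractional Brownian motion -/

section Gaussian

variable {Ω : Type*} [MeasurableSpace Ω] {P : Measure Ω} {d : ℕ} {H : ℝ}
  {B : ℝ → Ω → Vec d}

lemma IsFBM.measurable_coord (hB : IsFBM H B P) {s : ℝ} (hs : 0 ≤ s) (i : Fin d) :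
    Measurable fun ω => B s ω i := by
  have := hB.measurable s hs
  fun_prop

lemma IsFBM.memLp_coord (hB : IsFBM H B P) {s : ℝ} (hs : 0 ≤ s) (i : Fin d) {p : ℝ≥0∞}
    (hp : p ≠ ∞) : MemLp (fun ω => B s ω i) p P := by
  have h := (hB.gaussian.hasGaussianLaw_eval ⟨s, hs⟩).map_fun (EuclideanSpace.proj i)
  exact h.memLp hp

lemma IsFBM.integral_coord_mul [IsProbabilityMeasure P] (hB : IsFBM H B P) {s t : ℝ} (hs : 0 ≤ s) (ht : 0 ≤ t)
    (i j : Fin d) : ∫ ω, B s ω i * B t ω j ∂P = if i = j then R H s t else 0 := by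
  have h := covariance_eq_sub (hB.memLp_coord hs i (p := 2) (by norm_num))
    (hB.memLp_coord ht j (by norm_num))
  rw [hB.covariance s t hs ht, hB.mean_zero s hs, zero_mul, sub_zero] at h
  exact h.symm

/-- Covariance of `a β_s + b β_t` and `c β_s + e β_t` for a scalar fractional Brownian motion. -/
noncomputable def crossCov (H s t a b c e : ℝ) : ℝ :=
  a * c * v H s + (a * e + b * c) * R H s t + b * e * v H t

lemma IsFBM.memLp_comb (hB : IsFBM H B P) {s t : ℝ} (hs : 0 ≤ s) (ht : 0 ≤ t) (a b : ℝ)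
    (i : Fin d) {p : ℝ≥0∞} (hp : p ≠ ∞) :
    MemLp (fun ω => a * B s ω i + b * B t ω i) p P :=
  ((hB.memLp_coord hs i hp).const_mul a).add ((hB.memLp_coord ht i hp).const_mul b)

lemma IsFBM.integral_comb_mul_comb [IsProbabilityMeasure P] (hB : IsFBM H B P) {s t : ℝ} (hs : 0 ≤ s) (ht : 0 ≤ t)
    (a b c e : ℝ) (i j : Fin d) :
    ∫ ω, (a * B s ω i + b * B t ω i) * (c * B s ω j + e * B t ω j) ∂P =
      if i = j then crossCov H s t a b c e else 0 := by
  have int : ∀ {s t : ℝ}, 0 ≤ s → 0 ≤ t → ∀ k : ℝ,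
      Integrable (fun ω => k * (B s ω i * B t ω j)) P := fun hs ht k =>
    ((hB.memLp_coord hs i (p := 2) (by norm_num)).integrable_mul
      (hB.memLp_coord ht j (p := 2) (by norm_num))).const_mul k
  have e1 : (fun ω => (a * B s ω i + b * B t ω i) * (c * B s ω j + e * B t ω j)) = fun ω =>
      a * c * (B s ω i * B s ω j) + a * e * (B s ω i * B t ω j) +
        b * c * (B t ω i * B s ω j) + b * e * (B t ω i * B t ω j) := by
    funext ω
    ring
  have i2 : Integrable (fun ω => a * c * (B s ω i * B s ω j) + a * e * (B s ω i * B t ω j)) P :=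
    (int hs hs _).add (int hs ht _)
  have i3 : Integrable (fun ω => a * c * (B s ω i * B s ω j) + a * e * (B s ω i * B t ω j) +
      b * c * (B t ω i * B s ω j)) P := i2.add (int ht hs _)
  rw [e1, integral_add i3 (int ht ht _), integral_add i2 (int ht hs _),
    integral_add (int hs hs _) (int hs ht _)]
  simp only [integral_const_mul, hB.integral_coord_mul hs hs, hB.integral_coord_mul hs ht,
    hB.integral_coord_mul ht hs, hB.integral_coord_mul ht ht]
  split_ifs
  · rw [crossCov, R_comm t s, v, v]
    ring
  · ring

/-- The `L^p` norm of a standard Gaussian variable. -/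
noncomputable def gaussNorm (p : ℝ≥0∞) : ℝ≥0∞ := eLpNorm id p (gaussianReal 0 1)

lemma gaussNorm_ne_top {p : ℝ≥0∞} (hp : p ≠ ∞) : gaussNorm p ≠ ∞ := by
  lift p to ℝ≥0 using hp
  exact (memLp_id_gaussianReal p).eLpNorm_ne_top

/-- A centred Gaussian variable has the law of its standard deviation times a standard one, also
when the variance is 0. Every L^p norm is thereby controlled by the variance alone. -/
lemma eLpNorm_of_hasGaussianLaw {X : Ω → ℝ} (hX : HasGaussianLaw X P) (h0 : ∫ ω, X ω ∂P = 0)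
    (p : ℝ≥0∞) :
    eLpNorm X p P = ENNReal.ofReal (Real.sqrt (∫ ω, X ω ^ 2 ∂P)) * gaussNorm p := by
  have h1 := hX.map_eq_gaussianReal
  have hv : Var[X; P] = ∫ ω, X ω ^ 2 ∂P := variance_of_integral_eq_zero hX.aemeasurable h0
  have h2 := gaussianReal_map_const_mul (μ := 0) (v := 1) (Real.sqrt (∫ ω, X ω ^ 2 ∂P))
  have hnn : 0 ≤ ∫ ω, X ω ^ 2 ∂P := integral_nonneg fun ω => sq_nonneg _
  have h3 : P.map X = (gaussianReal 0 1).map (Real.sqrt (∫ ω, X ω ^ 2 ∂P) * ·) := by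
    rw [h1, h2, h0, hv]
    congr 1
    · simp
    · ext
      simp [Real.sq_sqrt hnn, hnn]
  have h4 : eLpNorm X p P = eLpNorm id p (P.map X) := by
    rw [eLpNorm_map_measure (by fun_prop) hX.aemeasurable]
    rfl
  rw [h4, h3, eLpNorm_map_measure (by fun_prop) (by fun_prop)]
  have h5 := eLpNorm_const_smul (Real.sqrt (∫ ω, X ω ^ 2 ∂P)) (id : ℝ → ℝ) p (gaussianReal 0 1)
  rw [Real.enorm_eq_ofReal (Real.sqrt_nonneg _)] at h5
  exact h5

lemma crossCov_self (s t a b : ℝ) : crossCov H s t a b a b = sig2 H s t a b := by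
  rw [crossCov, sig2]
  ring

lemma IsFBM.eLpNorm_comb [IsProbabilityMeasure P] (hB : IsFBM H B P) {s t : ℝ} (hs : 0 ≤ s) (ht : 0 ≤ t) (a b : ℝ)
    (i : Fin d) (p : ℝ≥0∞) :
    eLpNorm (fun ω => a * B s ω i + b * B t ω i) p P =
      ENNReal.ofReal (Real.sqrt (sig2 H s t a b)) * gaussNorm p := by
  have hg := (hB.gaussian.hasGaussianLaw_prodMk (s := ⟨s, hs⟩) (t := ⟨t, ht⟩)).map_fun
    (a • (EuclideanSpace.proj i).comp (ContinuousLinearMap.fst ℝ (Vec d) (Vec d)) +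
      b • (EuclideanSpace.proj i).comp (ContinuousLinearMap.snd ℝ (Vec d) (Vec d)))
  have h0 : ∫ ω, (a * B s ω i + b * B t ω i) ∂P = 0 := by
    rw [integral_add (((hB.memLp_coord hs i (p := 1) (by norm_num)).integrable le_rfl).const_mul a)
      (((hB.memLp_coord ht i (p := 1) (by norm_num)).integrable le_rfl).const_mul b),
      integral_const_mul, integral_const_mul, hB.mean_zero s hs, hB.mean_zero t ht]
    ring
  have h2 := hB.integral_comb_mul_comb hs ht a b a b i i
  rw [if_pos rfl, crossCov_self] at h2
  rw [← h2]
  simp only [← sq]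
  exact eLpNorm_of_hasGaussianLaw hg h0 p

end Gaussian
/-! ### The conditional expectation of the product of two increments -/

section Increments

variable {Ω : Type*} [MeasurableSpace Ω] {P : Measure Ω} {d : ℕ} {H : ℝ} {B : ℝ → Ω → Vec d}

/-- The increment `B_{s+ε}^i - B_s^i`. -/
noncomputable def incr (B : ℝ → Ω → Vec d) (s ε : ℝ) (i : Fin d) (ω : Ω) : ℝ :=
  B (s + ε) ω i - B s ω i

lemma IsFBM.measurable_incr (hB : IsFBM H B P) {s ε : ℝ} (hs : 0 ≤ s) (hε : 0 ≤ ε) (i : Fin d) :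
    Measurable (incr B s ε i) :=
  (hB.measurable_coord (add_nonneg hs hε) i).sub (hB.measurable_coord hs i)

lemma IsFBM.memLp_incr (hB : IsFBM H B P) {s ε : ℝ} (hs : 0 ≤ s) (hε : 0 ≤ ε) (i : Fin d)
    {p : ℝ≥0∞} (hp : p ≠ ∞) : MemLp (incr B s ε i) p P :=
  (hB.memLp_coord (add_nonneg hs hε) i hp).sub (hB.memLp_coord hs i hp)

variable [IsProbabilityMeasure P]

lemma IsFBM.integral_comb (hB : IsFBM H B P) {s t : ℝ} (hs : 0 ≤ s) (ht : 0 ≤ t) (a b : ℝ)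
    (i : Fin d) : ∫ ω, (a * B s ω i + b * B t ω i) ∂P = 0 := by
  rw [integral_add (((hB.memLp_coord hs i (p := 1) (by norm_num)).integrable le_rfl).const_mul a)
    (((hB.memLp_coord ht i (p := 1) (by norm_num)).integrable le_rfl).const_mul b),
    integral_const_mul, integral_const_mul, hB.mean_zero s hs, hB.mean_zero t ht]
  ring

lemma IsFBM.integral_incr (hB : IsFBM H B P) {s ε : ℝ} (hs : 0 ≤ s) (hε : 0 ≤ ε) (i : Fin d) :
    ∫ ω, incr B s ε i ω ∂P = 0 := by
  have := hB.integral_comb (add_nonneg hs hε) hs 1 (-1) i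
  rw [← this]
  congr 1 with ω
  rw [incr]
  ring

lemma IsFBM.covariance_coord_incr (hB : IsFBM H B P) {r s ε : ℝ} (hr : 0 ≤ r) (hs : 0 ≤ s)
    (hε : 0 ≤ ε) (k i : Fin d) :
    cov[fun ω => B r ω k, incr B s ε i; P] = if k = i then incCov H s ε r else 0 := by
  have h := covariance_fun_sub_right (hB.memLp_coord hr k (p := 2) (by norm_num))
    (hB.memLp_coord (add_nonneg hs hε) i (by norm_num)) (hB.memLp_coord hs i (by norm_num))
  rw [hB.covariance _ _ hr (add_nonneg hs hε), hB.covariance _ _ hr hs] at h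
  refine h.trans ?_
  split_ifs
  · rw [incCov, R_comm r, R_comm r]
  · ring

lemma IsFBM.covariance_coord_comb (hB : IsFBM H B P) {r s t : ℝ} (hr : 0 ≤ r) (hs : 0 ≤ s)
    (ht : 0 ≤ t) (a b : ℝ) (k i : Fin d) :
    cov[fun ω => B r ω k, fun ω => a * B s ω i + b * B t ω i; P] =
      if k = i then a * R H r s + b * R H r t else 0 := by
  have h := covariance_add_right (hB.memLp_coord hr k (p := 2) (by norm_num))
    ((hB.memLp_coord hs i (p := 2) (by norm_num)).const_mul a)
    ((hB.memLp_coord ht i (p := 2) (by norm_num)).const_mul b)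
  rw [covariance_const_mul_right, covariance_const_mul_right, hB.covariance _ _ hr hs,
    hB.covariance _ _ hr ht] at h
  refine h.trans ?_
  split_ifs <;> ring

lemma IsFBM.integral_incr_mul_incr (hB : IsFBM H B P) {s t ε δ : ℝ} (hs : 0 ≤ s) (ht : 0 ≤ t)
    (hε : 0 ≤ ε) (hδ : 0 ≤ δ) (i j : Fin d) :
    ∫ ω, incr B s ε i ω * incr B t δ j ω ∂P = if i = j then incInc H s t ε δ else 0 := by
  have h := covariance_eq_sub (hB.memLp_incr hs hε i (p := 2) (by norm_num))
    (hB.memLp_incr ht hδ j (by norm_num))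
  rw [hB.integral_incr hs hε, zero_mul, sub_zero] at h
  have h2 : cov[incr B s ε i, incr B t δ j; P] = cov[fun ω => B (s + ε) ω i, incr B t δ j; P] -
      cov[fun ω => B s ω i, incr B t δ j; P] :=
    covariance_fun_sub_left (hB.memLp_coord (add_nonneg hs hε) i (p := 2) (by norm_num))
      (hB.memLp_coord hs i (by norm_num)) (hB.memLp_incr ht hδ j (by norm_num))
  rw [hB.covariance_coord_incr (add_nonneg hs hε) ht hδ, hB.covariance_coord_incr hs ht hδ] at h2
  refine h.symm.trans (h2.trans ?_)
  split_ifs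
  · simp only [incCov, incInc, R_comm (t + δ), R_comm t]
    ring
  · ring

/-- Residual of the regression of `B_{r+ε}^i - B_r^i` on `(B_s, B_t)`. -/
noncomputable def resid (H : ℝ) (B : ℝ → Ω → Vec d) (s t r ε : ℝ) (i : Fin d) (ω : Ω) : ℝ :=
  incr B r ε i ω - (regCoef H s t (incCov H r ε s) (incCov H r ε t) * B s ω i +
    regCoef H t s (incCov H r ε t) (incCov H r ε s) * B t ω i)

lemma IsFBM.covariance_coord_resid (hB : IsFBM H B P) {s t r ε : ℝ} (hs : 0 ≤ s) (ht : 0 ≤ t)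
    (hr : 0 ≤ r) (hε : 0 ≤ ε) (hΘ : Theta H s t ≠ 0) (k i : Fin d) (b : Bool) :
    cov[fun ω => B (cond b s t) ω k, resid H B s t r ε i; P] = 0 := by
  have hb : 0 ≤ cond b s t := by cases b <;> assumption
  have h : cov[fun ω => B (cond b s t) ω k, resid H B s t r ε i; P] = _ :=
    covariance_fun_sub_right (hB.memLp_coord hb k (p := 2) (by norm_num))
      (hB.memLp_incr hr hε i (by norm_num))
      (hB.memLp_comb hs ht _ _ i (by norm_num))
  rw [hB.covariance_coord_incr hb hr hε, hB.covariance_coord_comb hb hs ht] at h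
  rw [h]
  split_ifs
  · have h1 := regCoef_normal₁ hΘ (incCov H r ε s) (incCov H r ε t)
    have h2 := regCoef_normal₁ (Theta_comm s t ▸ hΘ) (incCov H r ε t) (incCov H r ε s)
    cases b
    · simp only [cond_false]
      rw [v] at h2
      linarith
    · simp only [cond_true]
      rw [v] at h1
      linarith
  · ring

/-- The pair (B_s, B_t) and both residuals are linear images of one Gaussian vector, and by the
normal equations each residual is uncorrelated with every coordinate of the pair. For jointly
Gaussian families this is independence, of the two residuals together. -/
lemma IsFBM.indepFun_resid (hB : IsFBM H B P) {s t ε δ : ℝ} (hs : 0 ≤ s) (ht : 0 ≤ t)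
    (hε : 0 ≤ ε) (hδ : 0 ≤ δ) (hΘ : Theta H s t ≠ 0) (i j : Fin d) :
    IndepFun (fun ω => (B s ω, B t ω))
      (fun ω => (resid H B s t s ε i ω, resid H B s t t δ j ω)) P := by
  let X : Bool × Fin d → Ω → ℝ := fun k ω => B (cond k.1 s t) ω k.2
  let Z : Bool → Ω → ℝ := fun b ω => cond b (resid H B s t s ε i ω) (resid H B s t t δ j ω)
  have hlaw : HasGaussianLaw (fun ω => (fun k => X k ω, fun b => Z b ω)) P := by
    -- Times are indexed by `Fin 4` instead of forming a finite set, as they may coincide (for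
    -- instance s + ε = t).
    let q : Fin 4 → ℝ≥0 := ![⟨s, hs⟩, ⟨t, ht⟩, ⟨s + ε, add_nonneg hs hε⟩, ⟨t + δ, add_nonneg ht hδ⟩]
    have h1 := (hB.gaussian.comp_right q).hasGaussianLaw Finset.univ
    let pr : Fin 4 → Fin d → ((↥(Finset.univ : Finset (Fin 4)) → Vec d) →L[ℝ] ℝ) := fun n k =>
      (EuclideanSpace.proj k).comp (ContinuousLinearMap.proj ⟨n, Finset.mem_univ n⟩)
    let rs : (r : ℝ) → (ε : ℝ) → Fin d → Fin 4 → Fin 4 →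
        ((↥(Finset.univ : Finset (Fin 4)) → Vec d) →L[ℝ] ℝ) := fun r ε i n n' =>
      pr n' i - pr n i - (regCoef H s t (incCov H r ε s) (incCov H r ε t) • pr 0 i +
        regCoef H t s (incCov H r ε t) (incCov H r ε s) • pr 1 i)
    let L : (↥(Finset.univ : Finset (Fin 4)) → Vec d) →L[ℝ] (Bool × Fin d → ℝ) × (Bool → ℝ) :=
      (ContinuousLinearMap.pi fun k => pr (cond k.1 0 1) k.2).prod
        (ContinuousLinearMap.pi fun b => cond b (rs s ε i 0 2) (rs t δ j 1 3))
    refine (h1.map_fun L).congr (Eventually.of_forall fun ω => ?_)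
    refine Prod.ext ?_ ?_
    · funext k
      obtain ⟨b, k⟩ := k
      cases b <;> rfl
    · funext b
      cases b <;> rfl
  have hcov : ∀ k b, cov[X k, Z b; P] = 0 := by
    intro k b
    cases b
    · exact hB.covariance_coord_resid hs ht ht hδ hΘ k.2 j k.1
    · exact hB.covariance_coord_resid hs ht hs hε hΘ k.2 i k.1
  have hind := hlaw.indepFun_of_covariance_eval hcov
  refine hind.comp (φ := fun f => ((WithLp.toLp 2 fun k => f (true, k) : Vec d),
    (WithLp.toLp 2 fun k => f (false, k) : Vec d))) (ψ := fun f => (f true, f false)) ?_ ?_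
  · fun_prop
  · fun_prop

/-- The random matrix `A^i A'^j + δ_{ij} (K - 𝔼 A^i A'^j)`, where `A = a B_s + b B_t` and
`A' = c B_s + e B_t`. -/
noncomputable def regMat (H : ℝ) (B : ℝ → Ω → Vec d) (s t K a b c e : ℝ) (ω : Ω) : Mat d :=
  WithLp.toLp 2 fun ij =>
    (a * B s ω ij.1 + b * B t ω ij.1) * (c * B s ω ij.2 + e * B t ω ij.2) +
      if ij.1 = ij.2 then K - crossCov H s t a b c e else 0

/-- The kernel representing `Λ⁻(ε,δ;s,t)`. -/
noncomputable def kerMat (H : ℝ) (B : ℝ → Ω → Vec d) (ε δ s t : ℝ) (ω : Ω) : Mat d :=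
  regMat H B s t (incInc H s t ε δ / (ε * δ)) (coefSelf H s t ε) (coefOther H s t ε)
    (coefOther H t s δ) (coefSelf H t s δ) ω

lemma regCoef_div (s t c₁ c₂ ε : ℝ) :
    regCoef H s t (c₁ / ε) (c₂ / ε) = regCoef H s t c₁ c₂ / ε := by
  rw [regCoef, regCoef]
  ring

lemma IsFBM.condExp_incr_mul_incr (hB : IsFBM H B P) {s t ε δ : ℝ} (hs : 0 ≤ s) (ht : 0 ≤ t)
    (hε : 0 < ε) (hδ : 0 < δ) (hΘ : Theta H s t ≠ 0) (i j : Fin d) :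
    P[fun ω => incr B s ε i ω * incr B t δ j ω | sigmaPair B s t] =ᵐ[P]
      fun ω => ε * δ * kerMat H B ε δ s t ω (i, j) := by
  set a := regCoef H s t (incCov H s ε s) (incCov H s ε t) with ha
  set b := regCoef H t s (incCov H s ε t) (incCov H s ε s) with hb
  set c := regCoef H s t (incCov H t δ s) (incCov H t δ t) with hc
  set e := regCoef H t s (incCov H t δ t) (incCov H t δ s) with he
  have hG : Measurable fun ω => (B s ω, B t ω) := (hB.measurable s hs).prodMk (hB.measurable t ht)
  have h0 : ∀ r η : ℝ, 0 ≤ r → 0 ≤ η → ∀ k, ∀ x y : ℝ,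
      ∫ ω, (incr B r η k ω - (x * B s ω k + y * B t ω k)) ∂P = 0 := by
    intro r η hr hη k x y
    rw [integral_sub ((hB.memLp_incr hr hη k (p := 1) (by norm_num)).integrable le_rfl)
      ((hB.memLp_comb hs ht x y k (p := 1) (by norm_num)).integrable le_rfl),
      hB.integral_incr hr hη, hB.integral_comb hs ht, sub_zero]
  have h := condExp_mul_of_indep_residual (P := P) (m := sigmaPair B s t)
    (G := fun ω => (B s ω, B t ω))
    (L := fun x => a * x.1 i + b * x.2 i) (L' := fun x => c * x.1 j + e * x.2 j)
    (X := incr B s ε i) (X' := incr B t δ j) rfl hG (by fun_prop) (by fun_prop)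
    (hB.measurable_incr hs hε.le i) (hB.measurable_incr ht hδ.le j)
    (hB.memLp_incr hs hε.le i (by norm_num)) (hB.memLp_incr ht hδ.le j (by norm_num))
    (hB.memLp_comb hs ht a b i (by norm_num)) (hB.memLp_comb hs ht c e j (by norm_num))
    (hB.indepFun_resid hs ht hε.le hδ.le hΘ i j) (h0 s ε hs hε.le i a b) (h0 t δ ht hδ.le j c e)
  refine h.trans (Eventually.of_forall fun ω => ?_)
  simp only [hB.integral_incr_mul_incr hs ht hε.le hδ.le,
    hB.integral_comb_mul_comb hs ht]
  have ea : coefSelf H s t ε = a / ε := regCoef_div _ _ _ _ _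
  have eb : coefOther H s t ε = b / ε := regCoef_div _ _ _ _ _
  have ec : coefOther H t s δ = c / δ := regCoef_div _ _ _ _ _
  have ee : coefSelf H t s δ = e / δ := regCoef_div _ _ _ _ _
  simp only [kerMat, regMat, ea, eb, ec, ee]
  split_ifs
  · rw [crossCov, crossCov]
    field_simp
  · field_simp
    ring

lemma IsFBM.lambdaApprox_ae_eq (hB : IsFBM H B P) {s t ε δ : ℝ} (hs : 0 ≤ s) (ht : 0 ≤ t)
    (hε : 0 < ε) (hδ : 0 < δ) (hΘ : Theta H s t ≠ 0) :
    LambdaApprox P B ε δ s t =ᵐ[P] kerMat H B ε δ s t := by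
  have h : ∀ᵐ ω ∂P, ∀ ij : Fin d × Fin d,
      (P[fun ω => incr B s ε ij.1 ω * incr B t δ ij.2 ω | sigmaPair B s t]) ω =
        ε * δ * kerMat H B ε δ s t ω ij :=
    ae_all_iff.2 fun ij => hB.condExp_incr_mul_incr hs ht hε hδ hΘ ij.1 ij.2
  filter_upwards [h] with ω hω
  ext ij
  have h1 := hω ij
  have h2 : LambdaApprox P B ε δ s t ω ij = 1 / (ε * δ) *
      (P[fun ω => incr B s ε ij.1 ω * incr B t δ ij.2 ω | sigmaPair B s t]) ω := rfl
  rw [h2, h1]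
  field_simp

end Increments
/-! ### `L²` estimates for the regression matrices -/

section Estimates

variable {Ω : Type*} [MeasurableSpace Ω] {P : Measure Ω} {d : ℕ} {H : ℝ} {B : ℝ → Ω → Vec d}

omit [MeasurableSpace Ω] in
lemma regMat_zero (s t : ℝ) (ω : Ω) : regMat H B s t 0 0 0 0 0 ω = 0 := by
  ext ij
  simp [regMat, crossCov]

lemma norm_le_sum_abs {ι : Type*} [Fintype ι] (x : EuclideanSpace ℝ ι) : ‖x‖ ≤ ∑ i, |x i| := by
  classical
  have h : x = ∑ i, x i • EuclideanSpace.basisFun ι ℝ i := by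
    simpa using ((EuclideanSpace.basisFun ι ℝ).sum_repr x).symm
  calc ‖x‖ = ‖∑ i, x i • EuclideanSpace.basisFun ι ℝ i‖ := by rw [← h]
    _ ≤ ∑ i, ‖x i • EuclideanSpace.basisFun ι ℝ i‖ := norm_sum_le _ _
    _ = ∑ i, |x i| := by simp [norm_smul]

lemma eLpNorm_le_sum_coord {ι : Type*} [Fintype ι] {f : Ω → EuclideanSpace ℝ ι}
    (hf : ∀ i, AEStronglyMeasurable (fun ω => f ω i) P) {p : ℝ≥0∞} (hp : 1 ≤ p) :
    eLpNorm f p P ≤ ∑ i, eLpNorm (fun ω => f ω i) p P := by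
  have h1 : eLpNorm f p P ≤ eLpNorm (fun ω => ∑ i, |f ω i|) p P :=
    eLpNorm_mono_real fun ω => norm_le_sum_abs (f ω)
  have h2 := eLpNorm_sum_le (s := Finset.univ) (f := fun i ω => |f ω i|) (μ := P) (p := p)
    (fun i _ => (hf i).norm) hp
  refine h1.trans (le_trans (le_of_eq ?_) (h2.trans (le_of_eq ?_)))
  · congr 1
    funext ω
    simp
  · exact Finset.sum_congr rfl fun i _ => eLpNorm_norm (fun ω => f ω i)

instance holderTriple_four : ENNReal.HolderTriple 4 4 2 where
  inv_add_inv_eq_inv := by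
    have h4 : (4 : ℝ≥0∞) = 2 * 2 := by norm_num
    rw [h4, ENNReal.mul_inv (by simp) (by simp), ← mul_add, ENNReal.inv_two_add_inv_two, mul_one]

lemma eLpNorm_two_mul_le {f g : Ω → ℝ} (hf : AEStronglyMeasurable f P)
    (hg : AEStronglyMeasurable g P) :
    eLpNorm (fun ω => f ω * g ω) 2 P ≤ eLpNorm f 4 P * eLpNorm g 4 P := by
  have h := eLpNorm_smul_le_mul_eLpNorm (p := 4) (q := 4) (r := 2) hg hf
  simpa only [smul_eq_mul, Pi.smul_def', Pi.mul_def] using h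

/-- `√(sig2)` as an extended nonnegative real. -/
noncomputable def sdev (H s t a b : ℝ) : ℝ≥0∞ := ENNReal.ofReal (Real.sqrt (sig2 H s t a b))

lemma IsFBM.measurable_regMat_coord (hB : IsFBM H B P) {s t : ℝ} (hs : 0 ≤ s) (ht : 0 ≤ t)
    (K a b c e : ℝ) (ij : Fin d × Fin d) :
    Measurable fun ω => regMat H B s t K a b c e ω ij := by
  have h1 := hB.measurable_coord hs ij.1
  have h2 := hB.measurable_coord hs ij.2
  have h3 := hB.measurable_coord ht ij.1
  have h4 := hB.measurable_coord ht ij.2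
  have h : (fun ω => regMat H B s t K a b c e ω ij) = fun ω =>
      (a * B s ω ij.1 + b * B t ω ij.1) * (c * B s ω ij.2 + e * B t ω ij.2) +
      if ij.1 = ij.2 then K - crossCov H s t a b c e else 0 := rfl
  rw [h]
  exact (((h1.const_mul a).add (h3.const_mul b)).mul
    ((h2.const_mul c).add (h4.const_mul e))).add_const _

lemma IsFBM.measurable_regMat (hB : IsFBM H B P) {s t : ℝ} (hs : 0 ≤ s) (ht : 0 ≤ t)
    (K a b c e : ℝ) : Measurable (regMat H B s t K a b c e) :=
  (WithLp.measurable_toLp 2 _).comp (measurable_pi_iff.2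
    (hB.measurable_regMat_coord hs ht K a b c e))

variable [IsProbabilityMeasure P]

lemma enorm_integral_le_eLpNorm_two {X : Ω → ℝ} (hX : AEStronglyMeasurable X P) :
    ‖∫ ω, X ω ∂P‖ₑ ≤ eLpNorm X 2 P :=
  (enorm_integral_le_lintegral_enorm X).trans
    (eLpNorm_one_eq_lintegral_enorm.symm.le.trans
      (eLpNorm_le_eLpNorm_of_exponent_le (by norm_num) hX))

/-- The difference of products telescopes, A A' - C C' = (A - C) A' + C (A' - C'), and each product
is bounded in L² by two L⁴ norms of Gaussians. The same estimate serves for the convergence, for the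
domination, and for the size of a single matrix. -/
lemma IsFBM.eLpNorm_regMat_coord_sub_le (hB : IsFBM H B P) {s t : ℝ} (hs : 0 ≤ s) (ht : 0 ≤ t)
    (K a b c e K' a' b' c' e' : ℝ) (ij : Fin d × Fin d) :
    eLpNorm (fun ω => regMat H B s t K a b c e ω ij - regMat H B s t K' a' b' c' e' ω ij) 2 P ≤
      ‖K - K'‖ₑ + 2 * gaussNorm 4 ^ 2 * (sdev H s t (a - a') (b - b') * sdev H s t c e +
        sdev H s t a' b' * sdev H s t (c - c') (e - e')) := by
  obtain ⟨i, j⟩ := ij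
  have m : ∀ (x y : ℝ) (k : Fin d),
      AEStronglyMeasurable (fun ω => x * B s ω k + y * B t ω k) P := fun x y k =>
    (hB.memLp_comb hs ht x y k (p := 2) (by norm_num)).aestronglyMeasurable
  have m2 : ∀ (x y x' y' : ℝ), Integrable (fun ω =>
      (x * B s ω i + y * B t ω i) * (x' * B s ω j + y' * B t ω j)) P := fun x y x' y' =>
    (hB.memLp_comb hs ht x y i (p := 2) (by norm_num)).integrable_mul
      (hB.memLp_comb hs ht x' y' j (p := 2) (by norm_num))
  set X : Ω → ℝ := fun ω => (a * B s ω i + b * B t ω i) * (c * B s ω j + e * B t ω j) -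
    (a' * B s ω i + b' * B t ω i) * (c' * B s ω j + e' * B t ω j) with hX
  have hXi : Integrable X P := (m2 a b c e).sub (m2 a' b' c' e')
  have hXm : AEStronglyMeasurable X P := hXi.aestronglyMeasurable
  have hE : ∫ ω, X ω ∂P =
      if i = j then crossCov H s t a b c e - crossCov H s t a' b' c' e' else 0 := by
    rw [hX, integral_sub (m2 a b c e) (m2 a' b' c' e'), hB.integral_comb_mul_comb hs ht,
      hB.integral_comb_mul_comb hs ht]
    split_ifs <;> ring
  have hbound : eLpNorm X 2 P ≤ gaussNorm 4 ^ 2 *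
      (sdev H s t (a - a') (b - b') * sdev H s t c e +
        sdev H s t a' b' * sdev H s t (c - c') (e - e')) := by
    have e1 : X = (fun ω => ((a - a') * B s ω i + (b - b') * B t ω i) *
        (c * B s ω j + e * B t ω j)) + fun ω => (a' * B s ω i + b' * B t ω i) *
        ((c - c') * B s ω j + (e - e') * B t ω j) := by
      funext ω
      simp only [hX, Pi.add_apply]
      ring
    rw [e1]
    refine (eLpNorm_add_le (m2 _ _ _ _).aestronglyMeasurable (m2 _ _ _ _).aestronglyMeasurable
      (by norm_num)).trans ?_
    refine (add_le_add (eLpNorm_two_mul_le (m _ _ _) (m _ _ _))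
      (eLpNorm_two_mul_le (m _ _ _) (m _ _ _))).trans (le_of_eq ?_)
    simp only [hB.eLpNorm_comb hs ht, sdev]
    ring
  have e2 : (fun ω => regMat H B s t K a b c e ω (i, j) - regMat H B s t K' a' b' c' e' ω (i, j)) =
      X + ((fun _ => -∫ ω, X ω ∂P) + fun _ => if i = j then K - K' else 0) := by
    funext ω
    rw [Pi.add_apply, Pi.add_apply, hE]
    simp only [regMat, hX]
    split_ifs <;> ring
  -- Centring X costs at most the norm of X once more, which explains the factor 2.
  have h1 : eLpNorm (fun _ : Ω => -∫ ω, X ω ∂P) 2 P ≤ eLpNorm X 2 P := by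
    rw [eLpNorm_const _ (by norm_num) (IsProbabilityMeasure.ne_zero P)]
    simp only [measure_univ, ENNReal.one_rpow, mul_one, enorm_neg]
    exact enorm_integral_le_eLpNorm_two hXm
  have h2 : eLpNorm (fun _ : Ω => if i = j then K - K' else 0) 2 P ≤ ‖K - K'‖ₑ := by
    rw [eLpNorm_const _ (by norm_num) (IsProbabilityMeasure.ne_zero P)]
    simp only [measure_univ, ENNReal.one_rpow, mul_one]
    split_ifs <;> simp
  rw [e2]
  refine (eLpNorm_add_le hXm (by fun_prop) (by norm_num)).trans ?_
  refine (add_le_add hbound ((eLpNorm_add_le (by fun_prop) (by fun_prop) (by norm_num)).trans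
    (add_le_add (h1.trans hbound) h2))).trans (le_of_eq ?_)
  ring

lemma IsFBM.eLpNorm_regMat_sub_le (hB : IsFBM H B P) {s t : ℝ} (hs : 0 ≤ s) (ht : 0 ≤ t)
    (K a b c e K' a' b' c' e' : ℝ) :
    eLpNorm (fun ω => regMat H B s t K a b c e ω - regMat H B s t K' a' b' c' e' ω) 2 P ≤
      (d * d : ℕ) * (‖K - K'‖ₑ + 2 * gaussNorm 4 ^ 2 *
        (sdev H s t (a - a') (b - b') * sdev H s t c e +
          sdev H s t a' b' * sdev H s t (c - c') (e - e'))) := by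
  refine (eLpNorm_le_sum_coord (fun ij => ((hB.measurable_regMat_coord hs ht K a b c e ij).sub
    (hB.measurable_regMat_coord hs ht K' a' b' c' e' ij)).aestronglyMeasurable)
    (by norm_num)).trans ?_
  refine (Finset.sum_le_card_nsmul _ _ _ fun ij _ =>
    hB.eLpNorm_regMat_coord_sub_le hs ht K a b c e K' a' b' c' e' ij).trans (le_of_eq ?_)
  rw [nsmul_eq_mul, Finset.card_univ, Fintype.card_prod, Fintype.card_fin]

end Estimates

/-! ### Deterministic bounds for the coefficients of the limit -/

section Coefficients

variable {H : ℝ}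

/-- Completing the square in a leaves b² Θ / v(s). -/
lemma sig2_nonneg (hH : 1 / 2 < H) (hH' : H < 1) {s t : ℝ} (hs : 0 < s) (ht : 0 < t)
    (hst : s ≠ t) (a b : ℝ) : 0 ≤ sig2 H s t a b := by
  have hΘ := Theta_pos hH hH' hs ht hst
  have hv : 0 < v H s := by rw [v_eq hH]; positivity
  have h : sig2 H s t a b = ((a * v H s + b * R H s t) ^ 2 + b ^ 2 * Theta H s t) / v H s := by
    rw [sig2, Theta_eq]
    field_simp
    ring
  rw [h]
  positivity

/-- Parallelogram identity: the two sides differ by `sig2` of the sum of the coefficients. -/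
lemma sig2_sub_le (hH : 1 / 2 < H) (hH' : H < 1) {s t : ℝ} (hs : 0 < s) (ht : 0 < t)
    (hst : s ≠ t) (a b a' b' : ℝ) :
    sig2 H s t (a - a') (b - b') ≤ 2 * sig2 H s t a b + 2 * sig2 H s t a' b' := by
  have h := sig2_nonneg hH hH' hs ht hst (a + a') (b + b')
  simp only [sig2] at h ⊢
  linarith

/-- The constant in the uniform bound of the regression variances. -/
noncomputable def regConst (H : ℝ) : ℝ := 32 / (1 - 2 ^ (2 * H - 2))

lemma regConst_pos (hH' : H < 1) : 0 < regConst H := by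
  have := two_rpow_lt_one hH'
  exact div_pos (by norm_num) (by linarith)

lemma singBound_nonneg {s t : ℝ} (hs : 0 < s) (ht : 0 < t) : 0 ≤ singBound H s t := by
  rw [singBound]
  positivity

lemma sig2_coef_le' (hH : 1 / 2 < H) (hH' : H < 1) {s t ε : ℝ} (hs : 0 < s) (ht : 0 < t)
    (hst : s ≠ t) (hε : 0 < ε) :
    sig2 H s t (coefOther H t s ε) (coefSelf H t s ε) ≤ regConst H * singBound H s t := by
  rw [sig2_swap, singBound_comm]
  exact sig2_coef_le hH hH' ht hs hst.symm hε

lemma continuous_sig2 (s t : ℝ) : Continuous fun x : ℝ × ℝ => sig2 H s t x.1 x.2 := by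
  unfold sig2
  fun_prop

/-- The bound for the approximating coefficients is uniform in ε, so it survives the limit ε → 0. -/
lemma sig2_lam1_le (hH : 1 / 2 < H) (hH' : H < 1) {s t : ℝ} (hs : 0 < s) (ht : 0 < t)
    (hst : s ≠ t) :
    sig2 H s t (lam11 H s t) (lam12 H s t) ≤ regConst H * singBound H s t := by
  have hp : Tendsto (fun ε => (coefSelf H s t ε, coefOther H s t ε)) (𝓝[>] 0)
      (𝓝 (lam11 H s t, lam12 H s t)) :=
    (tendsto_coefSelf hH hs t).prodMk_nhds (tendsto_coefOther hH hs t)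
  have h := ((continuous_sig2 (H := H) s t).tendsto (lam11 H s t, lam12 H s t)).comp hp
  refine le_of_tendsto h ?_
  filter_upwards [self_mem_nhdsWithin] with ε hε using sig2_coef_le hH hH' hs ht hst hε

lemma sig2_lam2_le (hH : 1 / 2 < H) (hH' : H < 1) {s t : ℝ} (hs : 0 < s) (ht : 0 < t)
    (hst : s ≠ t) :
    sig2 H s t (lam21 H s t) (lam22 H s t) ≤ regConst H * singBound H s t := by
  rw [sig2_swap, singBound_comm, lam21_eq, lam22_eq]
  exact sig2_lam1_le hH hH' ht hs hst.symm

lemma abs_ddR_le (hH : 1 / 2 < H) (hH' : H < 1) {s t : ℝ} (hs : 0 < s) (ht : 0 < t)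
    (hst : s ≠ t) : |ddR H s t| ≤ singBound H s t := by
  have h1 : 0 ≤ |t - s| ^ (2 * H - 2) := by positivity
  have h2 : 0 ≤ s ^ (2 * H - 2) := by positivity
  have h3 : 0 ≤ t ^ (2 * H - 2) := by positivity
  have h4 : H * (2 * H - 1) ≤ 1 := by nlinarith
  have h5 : 0 ≤ H * (2 * H - 1) := mul_nonneg (by linarith) (by linarith)
  rw [ddR_eq hH hs hst, abs_of_nonneg (mul_nonneg h5 h1), singBound]
  nlinarith

lemma abs_incInc_div_le' (hH : 1 / 2 < H) (hH' : H < 1) {s t ε δ : ℝ} (hs : 0 < s) (ht : 0 < t)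
    (hst : s ≠ t) (hε : 0 < ε) (hδ : 0 < δ) :
    |incInc H s t ε δ / (ε * δ)| ≤ 8 * singBound H s t := by
  refine (abs_incInc_div_le hH hH' hst hε hδ).trans ?_
  have h2 : 0 ≤ s ^ (2 * H - 2) := by positivity
  have h3 : 0 ≤ t ^ (2 * H - 2) := by positivity
  rw [singBound]
  linarith

lemma tendsto_sdev_sub {α : Type*} {l : Filter α} {f g : α → ℝ} {a b : ℝ} (s t : ℝ)
    (hf : Tendsto f l (𝓝 a)) (hg : Tendsto g l (𝓝 b)) :
    Tendsto (fun x => sdev H s t (f x - a) (g x - b)) l (𝓝 0) := by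
  have h1 : Tendsto (fun x => (f x - a, g x - b)) l (𝓝 ((0 : ℝ), (0 : ℝ))) := by
    have h2 := hf.sub_const a
    have h3 := hg.sub_const b
    rw [sub_self] at h2 h3
    exact h2.prodMk_nhds h3
  have hc : Continuous fun x : ℝ × ℝ => sdev H s t x.1 x.2 :=
    ENNReal.continuous_ofReal.comp (Real.continuous_sqrt.comp (continuous_sig2 s t))
  have h4 := (hc.tendsto (0, 0)).comp h1
  have h5 : sdev H s t 0 0 = 0 := by simp [sdev, sig2]
  rwa [h5] at h4

end Coefficients
/-! ### Joint measurability -/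

section JointMeasurability

variable {Ω : Type*} [MeasurableSpace Ω] {P : Measure Ω} {d : ℕ} {H T : ℝ}
  {B : ℝ → Ω → Vec d}

instance isFiniteMeasure_prodMeasure [IsFiniteMeasure P] : IsFiniteMeasure (prodMeasure P T) := by
  unfold prodMeasure
  infer_instance

lemma ae_prodMeasure_of_ae_leb2 {p : ℝ × ℝ → Prop} (h : ∀ᵐ z ∂(leb2 T), p z) :
    ∀ᵐ x ∂(prodMeasure P T), p x.2 :=
  Measure.quasiMeasurePreserving_snd.ae h

lemma ae_prodMeasure_of_ae {p : Ω → Prop} (h : ∀ᵐ ω ∂P, p ω) :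
    ∀ᵐ x ∂(prodMeasure P T), p x.1 :=
  Measure.quasiMeasurePreserving_fst.ae h

lemma IsFBM.aemeasurable_comp [SFinite P] (hB : IsFBM H B P) {τ : ℝ × ℝ → ℝ} (hτ : Measurable τ)
    (h0 : ∀ᵐ z ∂(leb2 T), 0 ≤ τ z) :
    AEMeasurable (fun x : Ω × ℝ × ℝ => B (τ x.2) x.1) (prodMeasure P T) := by
  obtain ⟨B', hm, hB'⟩ := hB.exists_measurable_modification
  refine ⟨fun x => B' (x.1, τ x.2), by fun_prop, ?_⟩
  filter_upwards [ae_prodMeasure_of_ae_leb2 h0, ae_prodMeasure_of_ae hB'] with x h1 h2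
  exact h2 _ h1

lemma aemeasurable_comp_snd {f : ℝ × ℝ → ℝ} (hf : AEMeasurable f (leb2 T)) :
    AEMeasurable (fun x : Ω × ℝ × ℝ => f x.2) (prodMeasure P T) :=
  hf.comp_quasiMeasurePreserving Measure.quasiMeasurePreserving_snd

lemma IsFBM.aemeasurable_fst [SFinite P] (hB : IsFBM H B P) :
    AEMeasurable (fun x : Ω × ℝ × ℝ => B x.2.1 x.1) (prodMeasure P T) :=
  hB.aemeasurable_comp measurable_fst (ae_leb2.mono fun _ h => h.1.1.le)

lemma IsFBM.aemeasurable_snd [SFinite P] (hB : IsFBM H B P) :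
    AEMeasurable (fun x : Ω × ℝ × ℝ => B x.2.2 x.1) (prodMeasure P T) :=
  hB.aemeasurable_comp measurable_snd (ae_leb2.mono fun _ h => h.2.1.1.le)

lemma aemeasurable_coord {α : Type*} [MeasurableSpace α] {μ : Measure α} {f : α → Vec d}
    (hf : AEMeasurable f μ) (i : Fin d) : AEMeasurable (fun x => f x i) μ :=
  (by fun_prop : Measurable fun v : Vec d => v i).comp_aemeasurable hf

lemma measurable_R : Measurable fun z : ℝ × ℝ => R H z.1 z.2 := by
  unfold R
  have h : Measurable fun z : ℝ × ℝ => |z.2 - z.1| ^ (2 * H) := by measurability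
  exact (((measurable_fst.pow_const _).add (measurable_snd.pow_const _)).sub h).div_const _

lemma Measurable.R_comp {α : Type*} [MeasurableSpace α] {f g : α → ℝ} (hf : Measurable f)
    (hg : Measurable g) : Measurable fun x => R H (f x) (g x) :=
  measurable_R.comp (hf.prodMk hg)

lemma aemeasurable_crossCov_comp {f : Fin 4 → ℝ × ℝ → ℝ} {μ : Measure (ℝ × ℝ)}
    (hf : ∀ k, AEMeasurable (f k) μ) :
    AEMeasurable (fun z : ℝ × ℝ => crossCov H z.1 z.2 (f 0 z) (f 1 z) (f 2 z) (f 3 z)) μ := by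
  unfold crossCov v
  have h1 : AEMeasurable (fun z : ℝ × ℝ => R H z.1 z.1) μ :=
    (Measurable.R_comp measurable_fst measurable_fst).aemeasurable
  have h2 : AEMeasurable (fun z : ℝ × ℝ => R H z.1 z.2) μ := measurable_R.aemeasurable
  have h3 : AEMeasurable (fun z : ℝ × ℝ => R H z.2 z.2) μ :=
    (Measurable.R_comp measurable_snd measurable_snd).aemeasurable
  have h4 := hf 0
  have h5 := hf 1
  have h6 := hf 2
  have h7 := hf 3
  fun_prop

lemma IsFBM.aemeasurable_regMat [SFinite P] (hB : IsFBM H B P) {K a b c e : ℝ × ℝ → ℝ}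
    (hK : AEMeasurable K (leb2 T)) (ha : AEMeasurable a (leb2 T)) (hb : AEMeasurable b (leb2 T))
    (hc : AEMeasurable c (leb2 T)) (he : AEMeasurable e (leb2 T)) :
    AEMeasurable (fun x : Ω × ℝ × ℝ =>
      regMat H B x.2.1 x.2.2 (K x.2) (a x.2) (b x.2) (c x.2) (e x.2) x.1) (prodMeasure P T) := by
  have hcr : AEMeasurable (fun z : ℝ × ℝ => crossCov H z.1 z.2 (a z) (b z) (c z) (e z))
      (leb2 T) := aemeasurable_crossCov_comp (f := ![a, b, c, e]) (by
        intro k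
        fin_cases k <;> assumption)
  have hK' := aemeasurable_comp_snd (P := P) hK
  have ha' := aemeasurable_comp_snd (P := P) ha
  have hb' := aemeasurable_comp_snd (P := P) hb
  have hc' := aemeasurable_comp_snd (P := P) hc
  have he' := aemeasurable_comp_snd (P := P) he
  have hcr' := aemeasurable_comp_snd (P := P) hcr
  refine (WithLp.measurable_toLp 2 _).comp_aemeasurable (aemeasurable_pi_lambda _ fun ij => ?_)
  have h1 := aemeasurable_coord (hB.aemeasurable_fst (T := T)) ij.1
  have h2 := aemeasurable_coord (hB.aemeasurable_fst (T := T)) ij.2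
  have h3 := aemeasurable_coord (hB.aemeasurable_snd (T := T)) ij.1
  have h4 := aemeasurable_coord (hB.aemeasurable_snd (T := T)) ij.2
  refine (((ha'.mul h1).add (hb'.mul h3)).mul ((hc'.mul h2).add (he'.mul h4))).add ?_
  split_ifs
  · exact hK'.sub hcr'
  · exact aemeasurable_const

lemma measurable_incCov {α : Type*} [MeasurableSpace α] {f g : α → ℝ} (hf : Measurable f)
    (hg : Measurable g) (ε : ℝ) : Measurable fun x => incCov H (f x) ε (g x) :=
  (Measurable.R_comp (hf.add_const ε) hg).sub (Measurable.R_comp hf hg)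

lemma measurable_regCoef {α : Type*} [MeasurableSpace α] {f g c₁ c₂ : α → ℝ} (hf : Measurable f)
    (hg : Measurable g) (h₁ : Measurable c₁) (h₂ : Measurable c₂) :
    Measurable fun x => regCoef H (f x) (g x) (c₁ x) (c₂ x) := by
  simp only [regCoef, Theta_eq, v]
  exact ((h₁.mul (Measurable.R_comp hg hg)).sub (h₂.mul (Measurable.R_comp hf hg))).div
    (((Measurable.R_comp hf hf).mul (Measurable.R_comp hg hg)).sub
      ((Measurable.R_comp hf hg).pow_const 2))

lemma measurable_coefSelf {α : Type*} [MeasurableSpace α] {f g : α → ℝ} (hf : Measurable f)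
    (hg : Measurable g) (ε : ℝ) : Measurable fun x => coefSelf H (f x) (g x) ε :=
  measurable_regCoef hf hg ((measurable_incCov hf hf ε).div_const ε)
    ((measurable_incCov hf hg ε).div_const ε)

lemma measurable_coefOther {α : Type*} [MeasurableSpace α] {f g : α → ℝ} (hf : Measurable f)
    (hg : Measurable g) (ε : ℝ) : Measurable fun x => coefOther H (f x) (g x) ε :=
  measurable_regCoef hg hf ((measurable_incCov hf hg ε).div_const ε)
    ((measurable_incCov hf hf ε).div_const ε)

lemma measurable_incInc (ε δ : ℝ) : Measurable fun z : ℝ × ℝ => incInc H z.1 z.2 ε δ :=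
  (measurable_incCov measurable_fst (measurable_snd.add_const δ) ε).sub
    (measurable_incCov measurable_fst measurable_snd ε)

lemma IsFBM.aemeasurable_kerMat [SFinite P] (hB : IsFBM H B P) (ε δ : ℝ) :
    AEMeasurable (fun x : Ω × ℝ × ℝ => kerMat H B ε δ x.2.1 x.2.2 x.1) (prodMeasure P T) :=
  hB.aemeasurable_regMat ((measurable_incInc ε δ).div_const _).aemeasurable
    (measurable_coefSelf measurable_fst measurable_snd ε).aemeasurable
    (measurable_coefOther measurable_fst measurable_snd ε).aemeasurable
    (measurable_coefOther measurable_snd measurable_fst δ).aemeasurable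
    (measurable_coefSelf measurable_snd measurable_fst δ).aemeasurable

/-- The coefficient is built from derivatives; measurability comes from its being an almost
everywhere limit of the explicit measurable coefficients. -/
lemma aemeasurable_lam11 (hH : 1 / 2 < H) :
    AEMeasurable (fun z : ℝ × ℝ => lam11 H z.1 z.2) (leb2 T) :=
  aemeasurable_of_tendsto_metrizable_ae (𝓝[>] (0 : ℝ))
    (fun ε => (measurable_coefSelf measurable_fst measurable_snd ε).aemeasurable)
    (ae_leb2.mono fun _ h => tendsto_coefSelf hH h.1.1 _)

lemma aemeasurable_lam12 (hH : 1 / 2 < H) :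
    AEMeasurable (fun z : ℝ × ℝ => lam12 H z.1 z.2) (leb2 T) :=
  aemeasurable_of_tendsto_metrizable_ae (𝓝[>] (0 : ℝ))
    (fun ε => (measurable_coefOther measurable_fst measurable_snd ε).aemeasurable)
    (ae_leb2.mono fun _ h => tendsto_coefOther hH h.1.1 _)

lemma quasiMeasurePreserving_swap_leb2 :
    Measure.QuasiMeasurePreserving (Prod.swap : ℝ × ℝ → ℝ × ℝ) (leb2 T) (leb2 T) :=
  (Measure.measurePreserving_swap (μ := leb T) (ν := leb T)).quasiMeasurePreserving

lemma aemeasurable_lam21 (hH : 1 / 2 < H) :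
    AEMeasurable (fun z : ℝ × ℝ => lam21 H z.1 z.2) (leb2 T) := by
  have h := (aemeasurable_lam12 (T := T) hH).comp_quasiMeasurePreserving
    quasiMeasurePreserving_swap_leb2
  exact h.congr (Eventually.of_forall fun z => (lam21_eq z.1 z.2).symm)

lemma aemeasurable_lam22 (hH : 1 / 2 < H) :
    AEMeasurable (fun z : ℝ × ℝ => lam22 H z.1 z.2) (leb2 T) := by
  have h := (aemeasurable_lam11 (T := T) hH).comp_quasiMeasurePreserving
    quasiMeasurePreserving_swap_leb2
  exact h.congr (Eventually.of_forall fun z => (lam22_eq z.1 z.2).symm)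

lemma aemeasurable_ddR (hH : 1 / 2 < H) :
    AEMeasurable (fun z : ℝ × ℝ => ddR H z.1 z.2) (leb2 T) :=
  aemeasurable_of_tendsto_metrizable_ae (𝓝[>] (0 : ℝ) ×ˢ 𝓝[>] (0 : ℝ))
    (fun e => ((measurable_incInc e.1 e.2).div_const (e.1 * e.2)).aemeasurable)
    (ae_leb2.mono fun _ h => tendsto_incInc_div hH h.1.1 h.2.2)

/-- The limit `Λ = ∂²R/∂t∂s · I + 𝒲`. -/
noncomputable def limMat (H : ℝ) (B : ℝ → Ω → Vec d) (s t : ℝ) (ω : Ω) : Mat d :=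
  regMat H B s t (ddR H s t) (lam11 H s t) (lam12 H s t) (lam21 H s t) (lam22 H s t) ω

lemma IsFBM.aemeasurable_limMat [SFinite P] (hB : IsFBM H B P) (hH : 1 / 2 < H) :
    AEMeasurable (fun x : Ω × ℝ × ℝ => limMat H B x.2.1 x.2.2 x.1) (prodMeasure P T) :=
  hB.aemeasurable_regMat (aemeasurable_ddR hH) (aemeasurable_lam11 hH) (aemeasurable_lam12 hH)
    (aemeasurable_lam21 hH) (aemeasurable_lam22 hH)

/-- The part `𝒲` of the limit, with its covariances made explicit. -/
noncomputable def weightMat (H : ℝ) (B : ℝ → Ω → Vec d) (s t : ℝ) (ω : Ω) : Mat d :=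
  regMat H B s t 0 (lam11 H s t) (lam12 H s t) (lam21 H s t) (lam22 H s t) ω

lemma IsFBM.aemeasurable_weightMat [SFinite P] (hB : IsFBM H B P) (hH : 1 / 2 < H) :
    AEMeasurable (fun x : Ω × ℝ × ℝ => weightMat H B x.2.1 x.2.2 x.1) (prodMeasure P T) :=
  hB.aemeasurable_regMat (K := fun _ => 0) aemeasurable_const (aemeasurable_lam11 hH)
    (aemeasurable_lam12 hH) (aemeasurable_lam21 hH) (aemeasurable_lam22 hH)

/-- The four covariances subtracted in 𝒲 add up to `crossCov` on the diagonal and vanish off it. -/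
lemma IsFBM.W_eq_weightMat (hB : IsFBM H B P) {s t : ℝ} (hs : 0 ≤ s) (ht : 0 ≤ t) (ω : Ω) :
    W P H B s t ω = weightMat H B s t ω := by
  ext ij
  simp only [W, weightMat, regMat, hB.covariance s s hs hs, hB.covariance s t hs ht,
    hB.covariance t s ht hs, hB.covariance t t ht ht]
  split_ifs
  · rw [crossCov, R_comm t s, v, v]
    ring
  · ring

end JointMeasurability
/-! ### Convergence of the conditional expectations -/

section Convergence

variable {Ω : Type*} [MeasurableSpace Ω] {P : Measure Ω} [IsProbabilityMeasure P] {d : ℕ}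
  {H T : ℝ} {B : ℝ → Ω → Vec d}

/-- The constant in the uniform `L²` bounds. -/
noncomputable def domConst (d : ℕ) (H : ℝ) : ℝ≥0∞ :=
  (d * d : ℕ) * (ENNReal.ofReal 9 + 2 * gaussNorm 4 ^ 2 * (2 * ENNReal.ofReal (4 * regConst H)))

lemma domConst_ne_top : domConst d H ≠ ∞ := by
  have h := gaussNorm_ne_top (p := 4) (by norm_num)
  unfold domConst
  finiteness

lemma sdev_mul_sdev_le {s t D a b a' b' : ℝ} (h : sig2 H s t a b ≤ D)
    (h' : sig2 H s t a' b' ≤ D) : sdev H s t a b * sdev H s t a' b' ≤ ENNReal.ofReal D := by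
  rcases le_or_gt 0 D with hD | hD
  · calc sdev H s t a b * sdev H s t a' b'
        ≤ ENNReal.ofReal (Real.sqrt D) * ENNReal.ofReal (Real.sqrt D) :=
          mul_le_mul' (ENNReal.ofReal_le_ofReal (Real.sqrt_le_sqrt h))
            (ENNReal.ofReal_le_ofReal (Real.sqrt_le_sqrt h'))
      _ = ENNReal.ofReal D := by
          rw [← ENNReal.ofReal_mul (Real.sqrt_nonneg _), Real.mul_self_sqrt hD]
  · rw [sdev, Real.sqrt_eq_zero_of_nonpos (h.trans hD.le)]
    simp

/-- The 9 is 8 + 1, from the bounds on the increment covariance and on ∂²R/∂t∂s. The 4 is 2 + 2,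
from `sig2_sub_le`. -/
lemma IsFBM.eLpNorm_regMat_sub_le_domConst (hB : IsFBM H B P) (hH' : H < 1) {s t : ℝ}
    (hs : 0 < s) (ht : 0 < t) {K a b c e K' a' b' c' e' : ℝ}
    (hK : |K - K'| ≤ 9 * singBound H s t)
    (h₁ : sig2 H s t (a - a') (b - b') ≤ 4 * regConst H * singBound H s t)
    (h₂ : sig2 H s t c e ≤ 4 * regConst H * singBound H s t)
    (h₃ : sig2 H s t a' b' ≤ 4 * regConst H * singBound H s t)
    (h₄ : sig2 H s t (c - c') (e - e') ≤ 4 * regConst H * singBound H s t) :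
    eLpNorm (fun ω => regMat H B s t K a b c e ω - regMat H B s t K' a' b' c' e' ω) 2 P ≤
      domConst d H * ENNReal.ofReal (singBound H s t) := by
  have hc := regConst_pos hH'
  refine (hB.eLpNorm_regMat_sub_le hs.le ht.le K a b c e K' a' b' c' e').trans ?_
  have e : domConst d H * ENNReal.ofReal (singBound H s t) = (d * d : ℕ) *
      (ENNReal.ofReal (9 * singBound H s t) + 2 * gaussNorm 4 ^ 2 *
        (ENNReal.ofReal (4 * regConst H * singBound H s t) +
          ENNReal.ofReal (4 * regConst H * singBound H s t))) := by
    rw [domConst, ENNReal.ofReal_mul (p := 9) (by norm_num),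
      ENNReal.ofReal_mul (p := 4 * regConst H) (by positivity)]
    ring
  rw [e]
  refine mul_le_mul' le_rfl (add_le_add ?_ (mul_le_mul' le_rfl
    (add_le_add (sdev_mul_sdev_le h₁ h₂) (sdev_mul_sdev_le h₃ h₄))))
  rw [← ofReal_norm]
  exact ENNReal.ofReal_le_ofReal hK

lemma sig2_zero (s t : ℝ) : sig2 H s t 0 0 = 0 := by simp [sig2]

lemma IsFBM.eLpNorm_kerMat_sub_limMat_le (hB : IsFBM H B P) (hH : 1 / 2 < H) (hH' : H < 1)
    {s t ε δ : ℝ} (hs : 0 < s) (ht : 0 < t) (hst : s ≠ t) (hε : 0 < ε) (hδ : 0 < δ) :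
    eLpNorm (fun ω => kerMat H B ε δ s t ω - limMat H B s t ω) 2 P ≤
      domConst d H * ENNReal.ofReal (singBound H s t) := by
  have h1 := sig2_coef_le hH hH' hs ht hst hε
  have h2 := sig2_coef_le' hH hH' hs ht hst hδ
  have h3 := sig2_lam1_le hH hH' hs ht hst
  have h4 := sig2_lam2_le hH hH' hs ht hst
  have hD := mul_nonneg (regConst_pos hH').le (singBound_nonneg (H := H) hs ht)
  rw [← regConst] at h1
  refine hB.eLpNorm_regMat_sub_le_domConst hH' hs ht ?_ ?_ ?_ ?_ ?_
  · have h5 := abs_incInc_div_le' hH hH' hs ht hst hε hδ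
    have h6 := abs_ddR_le hH hH' hs ht hst
    exact (abs_sub _ _).trans (by linarith)
  · exact (sig2_sub_le hH hH' hs ht hst _ _ _ _).trans (by linarith)
  · linarith
  · linarith
  · exact (sig2_sub_le hH hH' hs ht hst _ _ _ _).trans (by linarith)

lemma IsFBM.eLpNorm_regMat_lam_le (hB : IsFBM H B P) (hH : 1 / 2 < H) (hH' : H < 1)
    {s t K : ℝ} (hs : 0 < s) (ht : 0 < t) (hst : s ≠ t) (hK : |K| ≤ 9 * singBound H s t) :
    eLpNorm (regMat H B s t K (lam11 H s t) (lam12 H s t) (lam21 H s t) (lam22 H s t)) 2 P ≤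
      domConst d H * ENNReal.ofReal (singBound H s t) := by
  have h3 := sig2_lam1_le hH hH' hs ht hst
  have h4 := sig2_lam2_le hH hH' hs ht hst
  have hD := mul_nonneg (regConst_pos hH').le (singBound_nonneg (H := H) hs ht)
  -- With all primed parameters 0 the second matrix vanishes, so the difference bound becomes a norm
  -- bound.
  have h := hB.eLpNorm_regMat_sub_le_domConst hH' hs ht (K := K) (K' := 0) (a := lam11 H s t)
    (a' := 0) (b := lam12 H s t) (b' := 0) (c := lam21 H s t) (c' := 0) (e := lam22 H s t)
    (e' := 0) (by rwa [sub_zero]) (by rw [sub_zero, sub_zero]; linarith) (by linarith)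
    (by rw [sig2_zero]; linarith) (by rw [sub_zero, sub_zero]; linarith)
  simpa only [regMat_zero, sub_zero] using h

lemma IsFBM.eLpNorm_limMat_le (hB : IsFBM H B P) (hH : 1 / 2 < H) (hH' : H < 1)
    {s t : ℝ} (hs : 0 < s) (ht : 0 < t) (hst : s ≠ t) :
    eLpNorm (limMat H B s t) 2 P ≤ domConst d H * ENNReal.ofReal (singBound H s t) :=
  hB.eLpNorm_regMat_lam_le hH hH' hs ht hst
    ((abs_ddR_le hH hH' hs ht hst).trans (by linarith [singBound_nonneg (H := H) hs ht]))

lemma IsFBM.eLpNorm_weightMat_le (hB : IsFBM H B P) (hH : 1 / 2 < H) (hH' : H < 1)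
    {s t : ℝ} (hs : 0 < s) (ht : 0 < t) (hst : s ≠ t) :
    eLpNorm (weightMat H B s t) 2 P ≤ domConst d H * ENNReal.ofReal (singBound H s t) :=
  hB.eLpNorm_regMat_lam_le hH hH' hs ht hst
    (by rw [abs_zero]; linarith [singBound_nonneg (H := H) hs ht])

lemma IsFBM.tendsto_eLpNorm_kerMat_sub_limMat (hB : IsFBM H B P) (hH : 1 / 2 < H) (hH' : H < 1)
    {s t : ℝ} (hs : 0 < s) (ht : 0 < t) (hst : s ≠ t) :
    Tendsto (fun e : ℝ × ℝ => eLpNorm (fun ω => kerMat H B e.1 e.2 s t ω - limMat H B s t ω) 2 P)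
      (𝓝[>] 0 ×ˢ 𝓝[>] 0) (𝓝 0) := by
  set D := ENNReal.ofReal (Real.sqrt (regConst H * singBound H s t)) with hD
  have hDtop : D ≠ ∞ := ENNReal.ofReal_ne_top
  have hγ := gaussNorm_ne_top (p := 4) (by norm_num)
  have t1 : Tendsto (fun e : ℝ × ℝ => ‖incInc H s t e.1 e.2 / (e.1 * e.2) - ddR H s t‖ₑ)
      (𝓝[>] 0 ×ˢ 𝓝[>] 0) (𝓝 0) := by
    have h := ((tendsto_incInc_div hH hs hst).sub_const (ddR H s t)).enorm
    rwa [sub_self, enorm_zero] at h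
  have t2 : Tendsto (fun e : ℝ × ℝ => sdev H s t (coefSelf H s t e.1 - lam11 H s t)
      (coefOther H s t e.1 - lam12 H s t)) (𝓝[>] 0 ×ˢ 𝓝[>] 0) (𝓝 0) :=
    tendsto_sdev_sub s t ((tendsto_coefSelf hH hs t).comp tendsto_fst)
      ((tendsto_coefOther hH hs t).comp tendsto_fst)
  have t3 : Tendsto (fun e : ℝ × ℝ => sdev H s t (coefOther H t s e.2 - lam21 H s t)
      (coefSelf H t s e.2 - lam22 H s t)) (𝓝[>] 0 ×ˢ 𝓝[>] 0) (𝓝 0) := by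
    rw [lam21_eq, lam22_eq]
    exact tendsto_sdev_sub s t ((tendsto_coefOther hH ht s).comp tendsto_snd)
      ((tendsto_coefSelf hH ht s).comp tendsto_snd)
  have t4 : Tendsto (fun e : ℝ × ℝ => ((d * d : ℕ) : ℝ≥0∞) *
      (‖incInc H s t e.1 e.2 / (e.1 * e.2) - ddR H s t‖ₑ + 2 * gaussNorm 4 ^ 2 *
        (sdev H s t (coefSelf H s t e.1 - lam11 H s t) (coefOther H s t e.1 - lam12 H s t) * D +
          D * sdev H s t (coefOther H t s e.2 - lam21 H s t) (coefSelf H t s e.2 - lam22 H s t))))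
      (𝓝[>] 0 ×ˢ 𝓝[>] 0) (𝓝 0) := by
    have h5 := (ENNReal.Tendsto.mul_const t2 (Or.inr hDtop)).add
      (ENNReal.Tendsto.const_mul t3 (Or.inr hDtop))
    have h6 : (2 * gaussNorm 4 ^ 2 : ℝ≥0∞) ≠ ∞ := by finiteness
    have h7 := ENNReal.Tendsto.const_mul (a := ((d * d : ℕ) : ℝ≥0∞))
      (t1.add (ENNReal.Tendsto.const_mul h5 (Or.inr h6))) (Or.inr (by finiteness))
    simpa only [zero_mul, mul_zero, add_zero] using h7
  refine tendsto_of_tendsto_of_tendsto_of_le_of_le' tendsto_const_nhds t4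
    (Eventually.of_forall fun _ => zero_le) ?_
  have hpos : ∀ᶠ ε in 𝓝[>] (0 : ℝ), 0 < ε := self_mem_nhdsWithin
  filter_upwards [hpos.prod_mk hpos] with e he
  refine (hB.eLpNorm_regMat_sub_le hs.le ht.le _ _ _ _ _ _ _ _ _ _).trans ?_
  have h2 : sdev H s t (coefOther H t s e.2) (coefSelf H t s e.2) ≤ D :=
    ENNReal.ofReal_le_ofReal (Real.sqrt_le_sqrt (sig2_coef_le' hH hH' hs ht hst he.2))
  have h3 : sdev H s t (lam11 H s t) (lam12 H s t) ≤ D :=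
    ENNReal.ofReal_le_ofReal (Real.sqrt_le_sqrt (sig2_lam1_le hH hH' hs ht hst))
  gcongr

lemma lintegral_enorm_rpow_le {E : Type*} [NormedAddCommGroup E] {f : Ω → E}
    (hf : AEStronglyMeasurable f P) {q : ℝ} (hq : 1 ≤ q) (hq2 : q ≤ 2) :
    ∫⁻ ω, ‖f ω‖ₑ ^ q ∂P ≤ eLpNorm f 2 P ^ q := by
  have hq0 : 0 < q := by linarith
  have h1 : eLpNorm f (ENNReal.ofReal q) P ≤ eLpNorm f 2 P :=
    eLpNorm_le_eLpNorm_of_exponent_le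
      (by rw [← ENNReal.ofReal_ofNat]; exact ENNReal.ofReal_le_ofReal hq2) hf
  rw [eLpNorm_eq_lintegral_rpow_enorm_toReal (by simpa using hq0) ENNReal.ofReal_ne_top,
    ENNReal.toReal_ofReal hq0.le] at h1
  have h2 := ENNReal.rpow_le_rpow h1 hq0.le
  rwa [← ENNReal.rpow_mul, one_div, inv_mul_cancel₀ hq0.ne', ENNReal.rpow_one] at h2

lemma lintegral_dom_lt_top {q : ℝ} (hq : 1 ≤ q) (hqH : q * (2 - 2 * H) < 1) (hT : 0 ≤ T) :
    ∫⁻ z, (domConst d H * ENNReal.ofReal (singBound H z.1 z.2)) ^ q ∂(leb2 T) < ∞ := by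
  have hq0 : 0 < q := by linarith
  have h := memLp_singBound (T := T) hq0 hqH hT
  have h1 := lintegral_rpow_enorm_lt_top_of_eLpNorm_lt_top (by simpa using hq0)
    ENNReal.ofReal_ne_top h.eLpNorm_lt_top
  rw [ENNReal.toReal_ofReal hq0.le] at h1
  simp only [ENNReal.mul_rpow_of_nonneg _ _ hq0.le]
  rw [lintegral_const_mul' _ _ (ENNReal.rpow_ne_top_of_nonneg hq0.le domConst_ne_top)]
  refine ENNReal.mul_lt_top (ENNReal.rpow_lt_top_of_nonneg hq0.le domConst_ne_top)
    (lt_of_le_of_lt (lintegral_mono fun z => ?_) h1)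
  exact ENNReal.rpow_le_rpow (Real.ofReal_le_enorm _) hq0.le

lemma aemeasurable_lintegral_left {f : Ω × ℝ × ℝ → ℝ≥0∞} (hf : AEMeasurable f (prodMeasure P T)) :
    AEMeasurable (fun z => ∫⁻ ω, f (ω, z) ∂P) (leb2 T) :=
  (hf.prod_swap).lintegral_prod_right'

lemma memLp_of_eLpNorm_two_le {E : Type*} [NormedAddCommGroup E] [MeasurableSpace E]
    [BorelSpace E] [SecondCountableTopology E] {F : Ω × ℝ × ℝ → E}
    (hF : AEMeasurable F (prodMeasure P T)) {q : ℝ} (hq : 1 ≤ q) (hq2 : q ≤ 2)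
    {G : ℝ × ℝ → ℝ≥0∞} (hG : ∫⁻ z, G z ^ q ∂(leb2 T) < ∞)
    (hm : ∀ᵐ z ∂(leb2 T), AEStronglyMeasurable (fun ω => F (ω, z)) P)
    (hb : ∀ᵐ z ∂(leb2 T), eLpNorm (fun ω => F (ω, z)) 2 P ≤ G z) :
    MemLp F (ENNReal.ofReal q) (prodMeasure P T) := by
  have hq0 : 0 < q := by linarith
  refine ⟨hF.aestronglyMeasurable, ?_⟩
  refine (eLpNorm_lt_top_iff_lintegral_rpow_enorm_lt_top (by simpa using hq0)
    ENNReal.ofReal_ne_top).2 ?_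
  rw [ENNReal.toReal_ofReal hq0.le, prodMeasure, lintegral_prod_symm _ (hF.enorm.pow_const q)]
  refine lt_of_le_of_lt (lintegral_mono_ae ?_) hG
  filter_upwards [hm, hb] with z h1 h2
  exact (lintegral_enorm_rpow_le h1 hq hq2).trans (ENNReal.rpow_le_rpow h2 hq0.le)

omit [IsProbabilityMeasure P] in
lemma IsFBM.measurable_kerMat (hB : IsFBM H B P) {s t : ℝ} (hs : 0 ≤ s) (ht : 0 ≤ t) (ε δ : ℝ) :
    Measurable (kerMat H B ε δ s t) := hB.measurable_regMat hs ht _ _ _ _ _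

omit [IsProbabilityMeasure P] in
lemma IsFBM.measurable_limMat (hB : IsFBM H B P) {s t : ℝ} (hs : 0 ≤ s) (ht : 0 ≤ t) :
    Measurable (limMat H B s t) := hB.measurable_regMat hs ht _ _ _ _ _

/-- Dominated convergence on [0,T]² with the inner expectation as integrand: since q ≤ 2, L²(P)
norms control it for each (s,t), both for the limit and for the domination. -/
lemma IsFBM.tendsto_lintegral_kerMat_sub_limMat (hB : IsFBM H B P) (hH : 1 / 2 < H)
    (hH' : H < 1) (hT : 0 ≤ T) {q : ℝ} (hq : 1 ≤ q) (hq2 : q ≤ 2) (hqH : q * (2 - 2 * H) < 1) :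
    Tendsto (fun e : ℝ × ℝ => ∫⁻ z, ∫⁻ ω,
      ‖kerMat H B e.1 e.2 z.1 z.2 ω - limMat H B z.1 z.2 ω‖ₑ ^ q ∂P ∂(leb2 T))
      (𝓝[>] 0 ×ˢ 𝓝[>] 0) (𝓝 0) := by
  have hq0 : 0 < q := by linarith
  have hpos : ∀ᶠ ε in 𝓝[>] (0 : ℝ), 0 < ε := self_mem_nhdsWithin
  have hle : ∀ (e : ℝ × ℝ) (z : ℝ × ℝ), 0 < z.1 → 0 < z.2 →
      ∫⁻ ω, ‖kerMat H B e.1 e.2 z.1 z.2 ω - limMat H B z.1 z.2 ω‖ₑ ^ q ∂P ≤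
        eLpNorm (fun ω => kerMat H B e.1 e.2 z.1 z.2 ω - limMat H B z.1 z.2 ω) 2 P ^ q := by
    intro e z h1 h2
    exact lintegral_enorm_rpow_le ((hB.measurable_kerMat h1.le h2.le e.1 e.2).sub
      (hB.measurable_limMat h1.le h2.le)).aestronglyMeasurable hq hq2
  have h := tendsto_lintegral_filter_of_dominated_convergence' (μ := leb2 T)
    (l := 𝓝[>] (0 : ℝ) ×ˢ 𝓝[>] (0 : ℝ))
    (F := fun e z => ∫⁻ ω, ‖kerMat H B e.1 e.2 z.1 z.2 ω - limMat H B z.1 z.2 ω‖ₑ ^ q ∂P)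
    (f := fun _ => 0)
    (fun z => (domConst d H * ENNReal.ofReal (singBound H z.1 z.2)) ^ q)
    (Eventually.of_forall fun e => aemeasurable_lintegral_left
      (((hB.aemeasurable_kerMat e.1 e.2).sub (hB.aemeasurable_limMat hH)).enorm.pow_const q))
    ?_ (lintegral_dom_lt_top hq hqH hT).ne ?_
  · simpa only [lintegral_zero] using h
  · filter_upwards [hpos.prod_mk hpos] with e he
    filter_upwards [ae_leb2] with z hz
    exact (hle e z hz.1.1 hz.2.1.1).trans (ENNReal.rpow_le_rpow
      (hB.eLpNorm_kerMat_sub_limMat_le hH hH' hz.1.1 hz.2.1.1 hz.2.2 he.1 he.2) hq0.le)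
  · filter_upwards [ae_leb2] with z hz
    have h1 := (hB.tendsto_eLpNorm_kerMat_sub_limMat hH hH' hz.1.1 hz.2.1.1 hz.2.2).ennrpow_const q
    rw [ENNReal.zero_rpow_of_pos hq0] at h1
    exact tendsto_of_tendsto_of_tendsto_of_le_of_le tendsto_const_nhds h1
      (fun _ => zero_le) fun e => hle e z hz.1.1 hz.2.1.1

/-- As (2H-1) + (2-2H) = 1, the two inequalities q(2H-1) < 1 and q(2-2H) < 1 add up to q < 2. -/
lemma exponent_bounds (hH : 1 / 2 < H) (hH' : H < 1) {q : ℝ}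
    (hq : q < min (1 / (2 * H - 1)) (1 / (2 - 2 * H))) : q ≤ 2 ∧ q * (2 - 2 * H) < 1 := by
  obtain ⟨h1, h2⟩ := lt_min_iff.1 hq
  rw [lt_div_iff₀ (by linarith)] at h1 h2
  refine ⟨?_, h2⟩
  by_contra h
  nlinarith

/-- `LambdaApprox` may be replaced by its explicit version. -/
lemma IsFBM.lintegral_lambdaApprox_sub (hB : IsFBM H B P) (hH : 1 / 2 < H) (hH' : H < 1)
    (L : ℝ → ℝ → Ω → Mat d) (q : ℝ) {e : ℝ × ℝ} (he : 0 < e.1 ∧ 0 < e.2) :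
    ∫⁻ z, ∫⁻ ω, ‖LambdaApprox P B e.1 e.2 z.1 z.2 ω - L z.1 z.2 ω‖ₑ ^ q ∂P ∂(leb2 T) =
      ∫⁻ z, ∫⁻ ω, ‖kerMat H B e.1 e.2 z.1 z.2 ω - L z.1 z.2 ω‖ₑ ^ q ∂P ∂(leb2 T) := by
  refine lintegral_congr_ae ?_
  filter_upwards [ae_leb2] with z hz
  refine lintegral_congr_ae ?_
  filter_upwards [hB.lambdaApprox_ae_eq hz.1.1.le hz.2.1.1.le he.1 he.2
    (Theta_pos hH hH' hz.1.1 hz.2.1.1 hz.2.2).ne'] with ω hω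
  rw [hω]

lemma IsFBM.memLp_limMat (hB : IsFBM H B P) (hH : 1 / 2 < H) (hH' : H < 1) (hT : 0 ≤ T) {q : ℝ}
    (hq : 1 ≤ q) (hq2 : q ≤ 2) (hqH : q * (2 - 2 * H) < 1) :
    MemLp (fun x : Ω × ℝ × ℝ => limMat H B x.2.1 x.2.2 x.1) (ENNReal.ofReal q)
      (prodMeasure P T) := by
  refine memLp_of_eLpNorm_two_le (hB.aemeasurable_limMat hH) hq hq2
    (lintegral_dom_lt_top (d := d) hq hqH hT) ?_ ?_
  · filter_upwards [ae_leb2] with z hz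
    exact (hB.measurable_regMat hz.1.1.le hz.2.1.1.le _ _ _ _ _).aestronglyMeasurable
  · filter_upwards [ae_leb2] with z hz
    exact hB.eLpNorm_limMat_le hH hH' hz.1.1 hz.2.1.1 hz.2.2

lemma IsFBM.memLp_weightMat (hB : IsFBM H B P) (hH : 1 / 2 < H) (hH' : H < 1) (hT : 0 ≤ T) {q : ℝ}
    (hq : 1 ≤ q) (hq2 : q ≤ 2) (hqH : q * (2 - 2 * H) < 1) :
    MemLp (fun x : Ω × ℝ × ℝ => weightMat H B x.2.1 x.2.2 x.1) (ENNReal.ofReal q)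
      (prodMeasure P T) := by
  refine memLp_of_eLpNorm_two_le (hB.aemeasurable_weightMat hH) hq hq2
    (lintegral_dom_lt_top (d := d) hq hqH hT) ?_ ?_
  · filter_upwards [ae_leb2] with z hz
    exact (hB.measurable_regMat hz.1.1.le hz.2.1.1.le _ _ _ _ _).aestronglyMeasurable
  · filter_upwards [ae_leb2] with z hz
    exact hB.eLpNorm_weightMat_le hH hH' hz.1.1 hz.2.1.1 hz.2.2

lemma IsFBM.memLp_kerMat (hB : IsFBM H B P) (hH : 1 / 2 < H) (hH' : H < 1) (hT : 0 ≤ T) {q : ℝ}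
    (hq : 1 ≤ q) (hq2 : q ≤ 2) (hqH : q * (2 - 2 * H) < 1) {ε δ : ℝ} (hε : 0 < ε) (hδ : 0 < δ) :
    MemLp (fun x : Ω × ℝ × ℝ => kerMat H B ε δ x.2.1 x.2.2 x.1) (ENNReal.ofReal q)
      (prodMeasure P T) := by
  have h : MemLp (fun x : Ω × ℝ × ℝ => kerMat H B ε δ x.2.1 x.2.2 x.1 -
      limMat H B x.2.1 x.2.2 x.1) (ENNReal.ofReal q) (prodMeasure P T) := by
    have hF : AEMeasurable (fun x : Ω × ℝ × ℝ => kerMat H B ε δ x.2.1 x.2.2 x.1 -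
        limMat H B x.2.1 x.2.2 x.1) (prodMeasure P T) :=
      (hB.aemeasurable_kerMat ε δ).sub (hB.aemeasurable_limMat hH)
    have hb : ∀ᵐ z ∂(leb2 T),
        eLpNorm (fun ω => kerMat H B ε δ z.1 z.2 ω - limMat H B z.1 z.2 ω) 2 P ≤
          domConst d H * ENNReal.ofReal (singBound H z.1 z.2) := by
      filter_upwards [ae_leb2] with z hz
      exact hB.eLpNorm_kerMat_sub_limMat_le hH hH' hz.1.1 hz.2.1.1 hz.2.2 hε hδ
    refine memLp_of_eLpNorm_two_le hF hq hq2 (lintegral_dom_lt_top (d := d) hq hqH hT) ?_ hb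
    · filter_upwards [ae_leb2] with z hz
      exact ((hB.measurable_kerMat hz.1.1.le hz.2.1.1.le ε δ).sub
        (hB.measurable_limMat hz.1.1.le hz.2.1.1.le)).aestronglyMeasurable
  refine (h.add (hB.memLp_limMat hH hH' hT hq hq2 hqH)).ae_eq (Eventually.of_forall fun x => ?_)
  exact sub_add_cancel _ _

/-- The limit defining `Λ` exists. -/
lemma IsFBM.isLambda_limMat (hB : IsFBM H B P) (hH : 1 / 2 < H) (hH' : H < 1) (hT : 0 ≤ T) :
    IsLambda P H T B (limMat H B) where
  memLp q hq hq' := by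
    obtain ⟨h1, h2⟩ := exponent_bounds hH hH' hq'
    exact hB.memLp_limMat hH hH' hT hq h1 h2
  tendsto q hq hq' := by
    obtain ⟨h1, h2⟩ := exponent_bounds hH hH' hq'
    refine (hB.tendsto_lintegral_kerMat_sub_limMat hH hH' hT hq h1 h2).congr' ?_
    have hpos : ∀ᶠ ε in 𝓝[>] (0 : ℝ), 0 < ε := self_mem_nhdsWithin
    filter_upwards [hpos.prod_mk hpos] with e he
    exact (hB.lintegral_lambdaApprox_sub hH hH' _ q he).symm

end Convergence
/-! ### Auxiliary facts for the forward integral -/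

lemma inner_tensor {d : ℕ} (a b c e : Vec d) :
    inner ℝ (tensor a b) (tensor c e) = inner ℝ a c * inner ℝ b e := by
  simp only [tensor, PiLp.inner_apply, RCLike.inner_apply, conj_trivial, Fintype.sum_prod_type,
    Finset.sum_mul_sum]
  refine Finset.sum_congr rfl fun i _ => Finset.sum_congr rfl fun j _ => ?_
  ring

lemma norm_tensor {d : ℕ} (a b : Vec d) : ‖tensor a b‖ = ‖a‖ * ‖b‖ := by
  have h := inner_tensor a b a b
  rw [real_inner_self_eq_norm_sq, real_inner_self_eq_norm_sq, real_inner_self_eq_norm_sq,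
    ← mul_pow] at h
  exact (pow_left_inj₀ (norm_nonneg _) (by positivity) two_ne_zero).1 h

/-- If all inner products `⟪F ε, F δ⟫` converge to `c`, then `F` converges, to a vector with squared
norm `c`. -/
lemma exists_tendsto_of_tendsto_inner {E ι : Type*} [NormedAddCommGroup E] [InnerProductSpace ℝ E]
    [CompleteSpace E] {l : Filter ι} [l.NeBot] {F : ι → E} {c : ℝ}
    (h : Tendsto (fun e : ι × ι => inner ℝ (F e.1) (F e.2)) (l ×ˢ l) (𝓝 c)) :
    ∃ J, Tendsto F l (𝓝 J) ∧ ‖J‖ ^ 2 = c := by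
  have hd : Tendsto (fun ε => ‖F ε‖ ^ 2) l (𝓝 c) := by
    refine (h.comp (tendsto_id.prodMk tendsto_id)).congr fun ε => ?_
    exact real_inner_self_eq_norm_sq _
  -- Expanding the square gives the limit c - 2c + c = 0, so F is Cauchy along the filter.
  have hc : Tendsto (fun e : ι × ι => ‖F e.1 - F e.2‖ ^ 2) (l ×ˢ l) (𝓝 0) := by
    have h1 := ((hd.comp tendsto_fst).sub (h.const_mul 2)).add (hd.comp (tendsto_snd (f := l)))
    have e0 : c - 2 * c + c = 0 := by ring
    rw [e0] at h1
    refine h1.congr fun e => ?_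
    exact (norm_sub_sq_real _ _).symm
  have hcauchy : Cauchy (map F l) := by
    refine cauchy_map_iff.2 ⟨inferInstance, ?_⟩
    rw [Metric.uniformity_eq_comap_nhds_zero, tendsto_comap_iff]
    have h2 := (Real.continuous_sqrt.tendsto 0).comp hc
    rw [Real.sqrt_zero] at h2
    refine h2.congr fun e => ?_
    simp [dist_eq_norm]
  obtain ⟨J, hJ⟩ := CompleteSpace.complete hcauchy
  refine ⟨J, hJ, tendsto_nhds_unique ?_ hd⟩
  exact (tendsto_norm.comp hJ).pow 2

/-- Conjugation exchanges the two thresholds: p' > 1/(2-2H) means q < 1/(2H-1), and p' > 1/(2H-1)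
means q < 1/(2-2H), because 1/p' + 1/q = 1. -/
lemma exists_holder_exponents {H : ℝ} (hH : 1 / 2 < H) (hH' : H < 1) {p : ℝ≥0∞}
    (hp : ENNReal.ofReal (max (1 / (2 - 2 * H)) (1 / (2 * H - 1))) < p) {α E : Type*}
    [MeasurableSpace α] [NormedAddCommGroup E] {μ : Measure α} [IsFiniteMeasure μ] {f : α → E}
    (hf : MemLp f p μ) :
    ∃ p' q : ℝ, p'.HolderConjugate q ∧ 1 ≤ q ∧ q < min (1 / (2 * H - 1)) (1 / (2 - 2 * H)) ∧
      MemLp f (ENNReal.ofReal p') μ := by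
  -- A finite exponent is chosen strictly below p, since p may be ∞; the measure is finite, so
  -- integrability passes down.
  obtain ⟨r, hr1, hr2⟩ := ENNReal.lt_iff_exists_real_btwn.1 hp |>.imp fun _ h => h.2
  have hmr : max (1 / (2 - 2 * H)) (1 / (2 * H - 1)) < r :=
    (ENNReal.ofReal_lt_ofReal_iff_of_nonneg (le_max_of_le_left
      (one_div_nonneg.2 (by linarith)))).1 hr1
  obtain ⟨h1, h2⟩ := max_lt_iff.1 hmr
  rw [div_lt_iff₀ (by linarith)] at h1 h2
  have hr : 1 < r := by nlinarith
  have hc : r.HolderConjugate (Real.conjExponent r) := Real.HolderConjugate.conjExponent hr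
  refine ⟨r, Real.conjExponent r, hc, hc.symm.lt.le, ?_, hf.mono_exponent hr2.le⟩
  have hr0 : 0 < r - 1 := by linarith
  rw [lt_min_iff, Real.conjExponent, div_lt_div_iff₀ hr0 (by linarith),
    div_lt_div_iff₀ hr0 (by linarith)]
  constructor <;> nlinarith

lemma integrable_inner_of_memLp {α E : Type*} [MeasurableSpace α] [NormedAddCommGroup E]
    [InnerProductSpace ℝ E] {μ : Measure α} {p q : ℝ} (hpq : p.HolderConjugate q) {f g : α → E}
    (hf : MemLp f (ENNReal.ofReal p) μ) (hg : MemLp g (ENNReal.ofReal q) μ) :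
    Integrable (fun x => inner ℝ (f x) (g x)) μ := by
  have : ENNReal.HolderConjugate (ENNReal.ofReal p) (ENNReal.ofReal q) := hpq.ennrealOfReal
  have h := hf.norm.integrable_mul hg.norm
  refine h.mono (hf.1.inner hg.1) (Eventually.of_forall fun x => ?_)
  simp only [Pi.mul_apply, norm_mul, norm_norm]
  exact norm_inner_le_norm _ _

lemma lintegral_enorm_inner_le {α E : Type*} [MeasurableSpace α] [NormedAddCommGroup E]
    [InnerProductSpace ℝ E] {μ : Measure α} {p q : ℝ} (hpq : p.HolderConjugate q) {f g : α → E}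
    (hf : AEStronglyMeasurable f μ) (hg : AEStronglyMeasurable g μ) :
    ∫⁻ x, ‖(inner ℝ (f x) (g x) : ℝ)‖ₑ ∂μ ≤
      (∫⁻ x, ‖f x‖ₑ ^ p ∂μ) ^ (1 / p) * (∫⁻ x, ‖g x‖ₑ ^ q ∂μ) ^ (1 / q) := by
  refine le_trans (lintegral_mono fun x => ?_)
    (ENNReal.lintegral_mul_le_Lp_mul_Lq μ hpq hf.enorm hg.enorm)
  simp only [Pi.mul_apply]
  rw [← ofReal_norm, ← ofReal_norm, ← ofReal_norm,
    ← ENNReal.ofReal_mul (norm_nonneg _)]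
  exact ENNReal.ofReal_le_ofReal (norm_inner_le_norm _ _)

/-! ### Products of increments -/

section IncrementProducts

variable {Ω : Type*} [MeasurableSpace Ω] {P : Measure Ω} {d : ℕ} {H T : ℝ}
  {B : ℝ → Ω → Vec d}

/-- The product `B_{s,s+ε} ⊗ B_{t,t+δ}`. -/
noncomputable def incrProd (B : ℝ → Ω → Vec d) (ε δ s t : ℝ) (ω : Ω) : Mat d :=
  tensor (B (s + ε) ω - B s ω) (B (t + δ) ω - B t ω)

lemma sig2_increment {s ε : ℝ} (hH : 0 < H) (hε : 0 ≤ ε) :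
    sig2 H (s + ε) s 1 (-1) = ε ^ (2 * H) := by
  have h : (0 : ℝ) ^ (2 * H) = 0 := Real.zero_rpow (by positivity)
  have e1 : s - (s + ε) = -ε := by ring
  simp only [sig2, v, R, sub_self, abs_zero, h, e1, abs_neg, abs_of_nonneg hε]
  ring

/-- The `L⁴` norm of an increment of length `ε`. -/
noncomputable def incrNorm (H ε : ℝ) : ℝ≥0∞ :=
  ENNReal.ofReal (Real.sqrt (ε ^ (2 * H))) * gaussNorm 4

lemma incrNorm_ne_top (ε : ℝ) : incrNorm H ε ≠ ∞ := by
  have h := gaussNorm_ne_top (p := 4) (by norm_num)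
  unfold incrNorm
  finiteness

lemma measurable_tensor : Measurable fun x : Vec d × Vec d => tensor x.1 x.2 := by
  refine (WithLp.measurable_toLp 2 _).comp (measurable_pi_lambda _ fun ij => ?_)
  fun_prop

lemma IsFBM.measurable_incrProd (hB : IsFBM H B P) {s t ε δ : ℝ} (hs : 0 ≤ s) (ht : 0 ≤ t)
    (hε : 0 ≤ ε) (hδ : 0 ≤ δ) : Measurable (incrProd B ε δ s t) :=
  measurable_tensor.comp
    (((hB.measurable _ (add_nonneg hs hε)).sub (hB.measurable s hs)).prodMk
      ((hB.measurable _ (add_nonneg ht hδ)).sub (hB.measurable t ht)))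

variable [IsProbabilityMeasure P]

lemma IsFBM.eLpNorm_incr (hB : IsFBM H B P) (hH : 0 < H) {s ε : ℝ} (hs : 0 ≤ s) (hε : 0 ≤ ε)
    (i : Fin d) : eLpNorm (incr B s ε i) 4 P = incrNorm H ε := by
  have h := hB.eLpNorm_comb (add_nonneg hs hε) hs 1 (-1) i 4
  rw [sig2_increment hH hε] at h
  rw [incrNorm, ← h]
  congr 1 with ω
  rw [incr]
  ring

lemma IsFBM.eLpNorm_incrProd_le (hB : IsFBM H B P) (hH : 0 < H) {s t ε δ : ℝ} (hs : 0 ≤ s)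
    (ht : 0 ≤ t) (hε : 0 ≤ ε) (hδ : 0 ≤ δ) :
    eLpNorm (incrProd B ε δ s t) 2 P ≤ ∑ _ij : Fin d × Fin d, incrNorm H ε * incrNorm H δ := by
  refine (eLpNorm_le_sum_coord (fun ij => ?_) (by norm_num)).trans
    (Finset.sum_le_sum fun ij _ => ?_)
  · exact ((hB.measurable_incr hs hε ij.1).mul (hB.measurable_incr ht hδ ij.2)).aestronglyMeasurable
  · rw [← hB.eLpNorm_incr hH hs hε ij.1, ← hB.eLpNorm_incr hH ht hδ ij.2]
    exact eLpNorm_two_mul_le (hB.measurable_incr hs hε ij.1).aestronglyMeasurable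
      (hB.measurable_incr ht hδ ij.2).aestronglyMeasurable

omit [IsProbabilityMeasure P] in
lemma IsFBM.aemeasurable_incrProd [SFinite P] (hB : IsFBM H B P) {ε δ : ℝ} (hε : 0 ≤ ε)
    (hδ : 0 ≤ δ) : AEMeasurable (fun x : Ω × ℝ × ℝ => incrProd B ε δ x.2.1 x.2.2 x.1)
      (prodMeasure P T) := by
  have h1 : AEMeasurable (fun x : Ω × ℝ × ℝ => B (x.2.1 + ε) x.1) (prodMeasure P T) :=
    hB.aemeasurable_comp (τ := fun z => z.1 + ε) (by fun_prop)
      (ae_leb2.mono fun _ h => add_nonneg h.1.1.le hε)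
  have h2 : AEMeasurable (fun x : Ω × ℝ × ℝ => B (x.2.2 + δ) x.1) (prodMeasure P T) :=
    hB.aemeasurable_comp (τ := fun z => z.2 + δ) (by fun_prop)
      (ae_leb2.mono fun _ h => add_nonneg h.2.1.1.le hδ)
  exact measurable_tensor.comp_aemeasurable
    ((h1.sub hB.aemeasurable_fst).prodMk (h2.sub hB.aemeasurable_snd))

lemma IsFBM.memLp_incrProd (hB : IsFBM H B P) (hH : 0 < H) {q : ℝ} (hq : 1 ≤ q) (hq2 : q ≤ 2)
    {ε δ : ℝ} (hε : 0 ≤ ε) (hδ : 0 ≤ δ) :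
    MemLp (fun x : Ω × ℝ × ℝ => incrProd B ε δ x.2.1 x.2.2 x.1) (ENNReal.ofReal q)
      (prodMeasure P T) := by
  have h0 := incrNorm_ne_top (H := H) ε
  have h1 := incrNorm_ne_top (H := H) δ
  have hG : (∑ _ij : Fin d × Fin d, incrNorm H ε * incrNorm H δ) ≠ ∞ :=
    ENNReal.sum_ne_top.2 fun _ _ => ENNReal.mul_ne_top h0 h1
  refine memLp_of_eLpNorm_two_le (hB.aemeasurable_incrProd hε hδ) hq hq2
    (G := fun _ => ∑ _ij : Fin d × Fin d, incrNorm H ε * incrNorm H δ) ?_ ?_ ?_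
  · rw [lintegral_const]
    exact ENNReal.mul_lt_top
      (ENNReal.rpow_lt_top_of_nonneg (by linarith) hG) (measure_lt_top _ _)
  · filter_upwards [ae_leb2] with z hz
    exact (hB.measurable_incrProd hz.1.1.le hz.2.1.1.le hε hδ).aestronglyMeasurable
  · filter_upwards [ae_leb2] with z hz
    exact hB.eLpNorm_incrProd_le hH hz.1.1.le hz.2.1.1.le hε hδ

/-- The kernel represents the product of increments against functions of `(B_s, B_t)`. -/
lemma IsFBM.integral_inner_incrProd (hB : IsFBM H B P) {s t ε δ : ℝ} (hs : 0 ≤ s) (ht : 0 ≤ t)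
    (hε : 0 < ε) (hδ : 0 < δ) (hΘ : Theta H s t ≠ 0) {A : Ω → Mat d}
    (hA : Measurable[sigmaPair B s t] A)
    (hint : ∀ ij, Integrable (fun ω => A ω ij * incrProd B ε δ s t ω ij) P) :
    ∫ ω, inner ℝ (A ω) (incrProd B ε δ s t ω) ∂P =
      ε * δ * ∫ ω, inner ℝ (A ω) (kerMat H B ε δ s t ω) ∂P := by
  have hm : sigmaPair B s t ≤ (inferInstance : MeasurableSpace Ω) :=
    ((hB.measurable s hs).prodMk (hB.measurable t ht)).comap_le
  have hcond : ∀ ij, P[fun ω => A ω ij * incrProd B ε δ s t ω ij | sigmaPair B s t] =ᵐ[P]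
      fun ω => ε * δ * (A ω ij * kerMat H B ε δ s t ω ij) := by
    intro ij
    have hAij : Measurable[sigmaPair B s t] fun ω => A ω ij :=
      (by fun_prop : Measurable fun v : Mat d => v ij).comp hA
    have h1 := condExp_mul_of_stronglyMeasurable_left (μ := P) hAij.stronglyMeasurable (hint ij)
      ((hB.memLp_incr hs hε.le ij.1 (p := 2) (by norm_num)).integrable_mul
        (hB.memLp_incr ht hδ.le ij.2 (p := 2) (by norm_num)))
    refine h1.trans ?_
    filter_upwards [hB.condExp_incr_mul_incr hs ht hε hδ hΘ ij.1 ij.2] with ω hω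
    have h2 : (P[fun ω => incrProd B ε δ s t ω ij | sigmaPair B s t]) ω =
      ε * δ * kerMat H B ε δ s t ω (ij.1, ij.2) := hω
    rw [Pi.mul_apply, h2]
    ring
  -- Up to the factor εδ this product is a version of a conditional expectation, so it is integrable
  -- without further moment assumptions.
  have hint' : ∀ ij, Integrable (fun ω => A ω ij * kerMat H B ε δ s t ω ij) P := by
    intro ij
    have h1 := (integrable_condExp.congr (hcond ij)).const_mul (ε * δ)⁻¹
    refine h1.congr (Eventually.of_forall fun ω => ?_)
    field_simp
  have hin : ∀ M N : Mat d, inner ℝ M N = ∑ ij, M ij * N ij := by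
    intro M N
    simp only [PiLp.inner_apply, RCLike.inner_apply, conj_trivial]
    exact Finset.sum_congr rfl fun _ _ => mul_comm _ _
  simp only [hin]
  rw [integral_finsetSum _ fun ij _ => hint ij, integral_finsetSum _ fun ij _ => hint' ij,
    Finset.mul_sum]
  refine Finset.sum_congr rfl fun ij _ => ?_
  rw [← integral_condExp hm, integral_congr_ae (hcond ij), integral_const_mul]

end IncrementProducts
/-! ### The forward integral -/

section ForwardIntegral

variable {Ω : Type*} [MeasurableSpace Ω] {P : Measure Ω} [IsProbabilityMeasure P] {d : ℕ}
  {H T : ℝ} {B Y : ℝ → Ω → Vec d} {g : ℝ × Vec d → Vec d}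

/-- By Tonelli the double integral of |f(x) f(y)| is the square of the integral of |f|. This
recovers the absolute convergence of the time integral from a hypothesis that only concerns Y_s ⊗
Y_t. -/
lemma integrable_of_integrable_mul_self {α : Type*} [MeasurableSpace α] {μ : Measure α}
    [SFinite μ] {f : α → ℝ} (hf : AEStronglyMeasurable f μ)
    (h : Integrable (fun z : α × α => f z.1 * f z.2) (μ.prod μ)) : Integrable f μ := by
  refine ⟨hf, ?_⟩
  have h1 := h.2
  rw [HasFiniteIntegral] at h1 ⊢
  simp only [enorm_mul] at h1
  rw [lintegral_prod_mul hf.enorm hf.enorm] at h1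
  by_contra h2
  rw [not_lt, top_le_iff] at h2
  simp [h2] at h1

omit [IsProbabilityMeasure P] in
lemma IsFBM.exists_measurable_integrand (hB : IsFBM H B P) (hg : Measurable g)
    (hY : ∀ s ω, Y s ω = g (s, B s ω)) :
    ∃ f : ℝ → Ω × ℝ → ℝ, (∀ ε, Measurable (f ε)) ∧
      ∀ᵐ ω ∂P, ∀ ε s, 0 ≤ ε → 0 ≤ s → inner ℝ (Y s ω) (B (s + ε) ω - B s ω) = f ε (ω, s) := by
  obtain ⟨B', hm, hB'⟩ := hB.exists_measurable_modification
  refine ⟨fun ε x => inner ℝ (g (x.2, B' x)) (B' (x.1, x.2 + ε) - B' x), fun ε => ?_, ?_⟩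
  · have h1 : Measurable fun x : Ω × ℝ => g (x.2, B' x) := hg.comp (measurable_snd.prodMk hm)
    have h2 : Measurable fun x : Ω × ℝ => B' (x.1, x.2 + ε) - B' x :=
      (hm.comp (by fun_prop)).sub hm
    exact h1.inner h2
  · filter_upwards [hB'] with ω hω ε s hε hs
    rw [hY, hω s hs, hω (s + ε) (add_nonneg hs hε)]

lemma ae_leb_nonneg : ∀ᵐ s ∂(leb T), 0 ≤ s := ae_leb_pos.mono fun _ h => h.1.le

omit [IsProbabilityMeasure P] in
lemma IsFBM.ae_aestronglyMeasurable_integrand (hB : IsFBM H B P) (hg : Measurable g)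
    (hY : ∀ s ω, Y s ω = g (s, B s ω)) {ε : ℝ} (hε : 0 ≤ ε) :
    ∀ᵐ ω ∂P, AEStronglyMeasurable
      (fun s => (inner ℝ (Y s ω) (B (s + ε) ω - B s ω) : ℝ)) (leb T) := by
  obtain ⟨f, hf, h⟩ := hB.exists_measurable_integrand hg hY
  filter_upwards [h] with ω hω
  refine ⟨fun s => f ε (ω, s), ((hf ε).comp measurable_prodMk_left).stronglyMeasurable, ?_⟩
  filter_upwards [ae_leb_nonneg] with s hs
  exact hω ε s hε hs

omit [IsProbabilityMeasure P] in
lemma IsFBM.aestronglyMeasurable_fwdApprox (hB : IsFBM H B P) (hg : Measurable g)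
    (hY : ∀ s ω, Y s ω = g (s, B s ω)) {ε : ℝ} (hε : 0 ≤ ε) :
    AEStronglyMeasurable (fwdApprox T Y B ε) P := by
  obtain ⟨f, hf, h⟩ := hB.exists_measurable_integrand hg hY
  refine ⟨fun ω => 1 / ε * ∫ s, f ε (ω, s) ∂(leb T),
    (hf ε).stronglyMeasurable.integral_prod_right'.const_mul _, ?_⟩
  filter_upwards [h] with ω hω
  rw [fwdApprox]
  congr 1
  refine integral_congr_ae ?_
  filter_upwards [ae_leb_nonneg] with s hs
  exact hω ε s hε hs

variable {p q : ℝ}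

lemma IsFBM.integrable_inner_incrProd (hB : IsFBM H B P) (hH : 0 < H) (hpq : p.HolderConjugate q)
    (hq : q ≤ 2) (hYp : MemLp (fun x : Ω × ℝ × ℝ => tensor (Y x.2.1 x.1) (Y x.2.2 x.1))
      (ENNReal.ofReal p) (prodMeasure P T)) {ε δ : ℝ} (hε : 0 ≤ ε) (hδ : 0 ≤ δ) :
    Integrable (fun x : Ω × ℝ × ℝ => inner ℝ (Y x.2.1 x.1) (B (x.2.1 + ε) x.1 - B x.2.1 x.1) *
      inner ℝ (Y x.2.2 x.1) (B (x.2.2 + δ) x.1 - B x.2.2 x.1)) (prodMeasure P T) := by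
  have h := integrable_inner_of_memLp hpq hYp
    (hB.memLp_incrProd hH hpq.symm.lt.le hq hε hδ)
  refine h.congr (Eventually.of_forall fun x => ?_)
  exact inner_tensor _ _ _ _

lemma IsFBM.integral_inner_incrProd_prodMeasure (hB : IsFBM H B P) (hH : 1 / 2 < H) (hH' : H < 1)
    (hT : 0 ≤ T) (hpq : p.HolderConjugate q) (hq : q ≤ 2) (hqH : q * (2 - 2 * H) < 1)
    (hg : Measurable g) (hY : ∀ s ω, Y s ω = g (s, B s ω))
    (hYp : MemLp (fun x : Ω × ℝ × ℝ => tensor (Y x.2.1 x.1) (Y x.2.2 x.1))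
      (ENNReal.ofReal p) (prodMeasure P T)) {ε δ : ℝ} (hε : 0 < ε) (hδ : 0 < δ) :
    ∫ x, inner ℝ (tensor (Y x.2.1 x.1) (Y x.2.2 x.1)) (incrProd B ε δ x.2.1 x.2.2 x.1)
        ∂(prodMeasure P T) =
      ε * δ * ∫ x, inner ℝ (tensor (Y x.2.1 x.1) (Y x.2.2 x.1))
        (kerMat H B ε δ x.2.1 x.2.2 x.1) ∂(prodMeasure P T) := by
  have hX := hB.memLp_incrProd (T := T) (by linarith) hpq.symm.lt.le hq hε.le hδ.le
  have hK := hB.memLp_kerMat (T := T) hH hH' hT hpq.symm.lt.le hq hqH hε hδ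
  have hcoord : ∀ ij : Fin d × Fin d, Integrable (fun x : Ω × ℝ × ℝ =>
      tensor (Y x.2.1 x.1) (Y x.2.2 x.1) ij * incrProd B ε δ x.2.1 x.2.2 x.1 ij)
      (prodMeasure P T) := by
    intro ij
    have : ENNReal.HolderConjugate (ENNReal.ofReal p) (ENNReal.ofReal q) := hpq.ennrealOfReal
    exact ((EuclideanSpace.proj (𝕜 := ℝ) ij).comp_memLp' hYp).integrable_mul
      ((EuclideanSpace.proj (𝕜 := ℝ) ij).comp_memLp' hX)
  -- Conditioning takes place at fixed (s,t), where Fubini supplies integrability in ω for almost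
  -- every pair.
  have hcoord' : ∀ᵐ z ∂(leb2 T), ∀ ij : Fin d × Fin d, Integrable (fun ω =>
      tensor (Y z.1 ω) (Y z.2 ω) ij * incrProd B ε δ z.1 z.2 ω ij) P :=
    ae_all_iff.2 fun ij => (hcoord ij).prod_left_ae
  rw [prodMeasure, integral_prod_symm _ (integrable_inner_of_memLp hpq hYp hX),
    integral_prod_symm _ (integrable_inner_of_memLp hpq hYp hK), ← integral_const_mul]
  refine integral_congr_ae ?_
  filter_upwards [ae_leb2, hcoord'] with z hz hi
  refine hB.integral_inner_incrProd hz.1.1.le hz.2.1.1.le hε hδ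
    (Theta_pos hH hH' hz.1.1 hz.2.1.1 hz.2.2).ne' ?_ hi
  simp only [hY]
  have h1 : Measurable fun b : Vec d × Vec d => tensor (g (z.1, b.1)) (g (z.2, b.2)) :=
    measurable_tensor.comp ((hg.comp (by fun_prop)).prodMk (hg.comp (by fun_prop)))
  exact h1.comp (comap_measurable fun ω => (B z.1 ω, B z.2 ω))

omit [MeasurableSpace Ω] in
-- The product formula for integrals needs no integrability, so this holds for every ω.
lemma fwdApprox_mul_fwdApprox (ε δ : ℝ) (ω : Ω) :
    fwdApprox T Y B ε ω * fwdApprox T Y B δ ω =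
      1 / (ε * δ) * ∫ z, inner ℝ (Y z.1 ω) (B (z.1 + ε) ω - B z.1 ω) *
        inner ℝ (Y z.2 ω) (B (z.2 + δ) ω - B z.2 ω) ∂(leb2 T) := by
  rw [leb2, integral_prod_mul (fun s => inner ℝ (Y s ω) (B (s + ε) ω - B s ω))
    (fun t => inner ℝ (Y t ω) (B (t + δ) ω - B t ω)), fwdApprox, fwdApprox]
  ring

lemma IsFBM.ae_integrable_integrand (hB : IsFBM H B P) (hH : 0 < H) (hpq : p.HolderConjugate q)
    (hq : q ≤ 2) (hg : Measurable g) (hY : ∀ s ω, Y s ω = g (s, B s ω))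
    (hYp : MemLp (fun x : Ω × ℝ × ℝ => tensor (Y x.2.1 x.1) (Y x.2.2 x.1))
      (ENNReal.ofReal p) (prodMeasure P T)) {ε : ℝ} (hε : 0 ≤ ε) :
    ∀ᵐ ω ∂P, Integrable (fun s => inner ℝ (Y s ω) (B (s + ε) ω - B s ω)) (leb T) := by
  filter_upwards [(hB.integrable_inner_incrProd hH hpq hq hYp hε hε).prod_right_ae,
    hB.ae_aestronglyMeasurable_integrand hg hY hε] with ω h1 h2
  exact integrable_of_integrable_mul_self h2 h1

lemma IsFBM.memLp_fwdApprox (hB : IsFBM H B P) (hH : 0 < H) (hpq : p.HolderConjugate q)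
    (hq : q ≤ 2) (hg : Measurable g) (hY : ∀ s ω, Y s ω = g (s, B s ω))
    (hYp : MemLp (fun x : Ω × ℝ × ℝ => tensor (Y x.2.1 x.1) (Y x.2.2 x.1))
      (ENNReal.ofReal p) (prodMeasure P T)) {ε : ℝ} (hε : 0 ≤ ε) :
    MemLp (fwdApprox T Y B ε) 2 P := by
  rw [memLp_two_iff_integrable_sq (hB.aestronglyMeasurable_fwdApprox hg hY hε)]
  have h := (hB.integrable_inner_incrProd hH hpq hq hYp hε hε).integral_prod_left.const_mul
    (1 / (ε * ε))
  refine h.congr (Eventually.of_forall fun ω => ?_)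
  exact ((sq _).trans (fwdApprox_mul_fwdApprox ε ε ω)).symm

lemma IsFBM.integral_fwdApprox_mul (hB : IsFBM H B P) (hH : 1 / 2 < H) (hH' : H < 1)
    (hT : 0 ≤ T) (hpq : p.HolderConjugate q) (hq : q ≤ 2) (hqH : q * (2 - 2 * H) < 1)
    (hg : Measurable g) (hY : ∀ s ω, Y s ω = g (s, B s ω))
    (hYp : MemLp (fun x : Ω × ℝ × ℝ => tensor (Y x.2.1 x.1) (Y x.2.2 x.1))
      (ENNReal.ofReal p) (prodMeasure P T)) {ε δ : ℝ} (hε : 0 < ε) (hδ : 0 < δ) :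
    ∫ ω, fwdApprox T Y B ε ω * fwdApprox T Y B δ ω ∂P =
      ∫ x, inner ℝ (tensor (Y x.2.1 x.1) (Y x.2.2 x.1))
        (kerMat H B ε δ x.2.1 x.2.2 x.1) ∂(prodMeasure P T) := by
  have h1 := hB.integral_inner_incrProd_prodMeasure hH hH' hT hpq hq hqH hg hY hYp hε hδ
  have h2 := hB.integrable_inner_incrProd (by linarith) hpq hq hYp hε.le hδ.le
  simp only [incrProd, inner_tensor] at h1
  have h3 := integral_prod _ h2
  simp only [fwdApprox_mul_fwdApprox]
  rw [integral_const_mul]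
  rw [prodMeasure] at h1 ⊢
  rw [← h3, h1]
  field_simp

/-- Hölder's inequality against the L^q convergence. An arbitrary version L is allowed, so that the
final identity does not depend on the explicit one. -/
lemma IsFBM.tendsto_integral_inner_kerMat (hB : IsFBM H B P) (hH : 1 / 2 < H) (hH' : H < 1)
    (hT : 0 ≤ T) (hpq : p.HolderConjugate q)
    (hq : q < min (1 / (2 * H - 1)) (1 / (2 - 2 * H)))
    {A : Ω × ℝ × ℝ → Mat d} (hA : MemLp A (ENNReal.ofReal p) (prodMeasure P T))
    {L : ℝ → ℝ → Ω → Mat d} (hL : IsLambda P H T B L) :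
    Tendsto (fun e : ℝ × ℝ => ∫ x, inner ℝ (A x) (kerMat H B e.1 e.2 x.2.1 x.2.2 x.1)
        ∂(prodMeasure P T)) (𝓝[>] 0 ×ˢ 𝓝[>] 0)
      (𝓝 (∫ x, inner ℝ (A x) (L x.2.1 x.2.2 x.1) ∂(prodMeasure P T))) := by
  have hq1 : 1 ≤ q := hpq.symm.lt.le
  have hq0 : 0 < q := hpq.symm.pos
  have hp0 : 0 < p := hpq.pos
  obtain ⟨hq2, hqH⟩ := exponent_bounds hH hH' hq
  have hLm := hL.memLp q hq1 hq
  have hpos : ∀ᶠ ε in 𝓝[>] (0 : ℝ), 0 < ε := self_mem_nhdsWithin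
  have hpos2 := hpos.prod_mk hpos
  have hdiff : ∀ e : ℝ × ℝ, AEStronglyMeasurable (fun x : Ω × ℝ × ℝ =>
      kerMat H B e.1 e.2 x.2.1 x.2.2 x.1 - L x.2.1 x.2.2 x.1) (prodMeasure P T) := fun e =>
    (hB.aemeasurable_kerMat e.1 e.2).aestronglyMeasurable.sub hLm.1
  have hconv : Tendsto (fun e : ℝ × ℝ => ∫⁻ x : Ω × ℝ × ℝ,
      ‖kerMat H B e.1 e.2 x.2.1 x.2.2 x.1 - L x.2.1 x.2.2 x.1‖ₑ ^ q ∂(prodMeasure P T))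
      (𝓝[>] 0 ×ˢ 𝓝[>] 0) (𝓝 0) := by
    refine (hL.tendsto q hq1 hq).congr' ?_
    filter_upwards [hpos2] with e he
    rw [hB.lintegral_lambdaApprox_sub hH hH' L q he, prodMeasure,
      lintegral_prod_symm _ ((hdiff e).enorm.pow_const q)]
  have hAfin : (∫⁻ x, ‖A x‖ₑ ^ p ∂(prodMeasure P T)) ^ (1 / p) ≠ ∞ := by
    have h1 := lintegral_rpow_enorm_lt_top_of_eLpNorm_lt_top (by simpa using hp0)
      ENNReal.ofReal_ne_top hA.eLpNorm_lt_top
    rw [ENNReal.toReal_ofReal hp0.le] at h1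
    exact ENNReal.rpow_ne_top_of_nonneg (by positivity) h1.ne
  refine tendsto_integral_of_L1 _ (hA.1.inner hLm.1) ?_ ?_
  · filter_upwards [hpos2] with e he
    exact integrable_inner_of_memLp hpq hA (hB.memLp_kerMat hH hH' hT hq1 hq2 hqH he.1 he.2)
  · have h1 := ENNReal.Tendsto.const_mul (hconv.ennrpow_const (1 / q)) (Or.inr hAfin)
    rw [ENNReal.zero_rpow_of_pos (by positivity), mul_zero] at h1
    refine tendsto_of_tendsto_of_tendsto_of_le_of_le tendsto_const_nhds h1
      (fun _ => zero_le) fun e => ?_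
    simp only [← inner_sub_right]
    exact lintegral_enorm_inner_le hpq hA.1 (hdiff e)

/-- The forward integral exists, and its second moment is the integral against any version of
`Λ`. -/
lemma IsFBM.exists_isForwardIntegral (hB : IsFBM H B P) (hH : 1 / 2 < H) (hH' : H < 1)
    (hT : 0 ≤ T) (hpq : p.HolderConjugate q)
    (hq : q < min (1 / (2 * H - 1)) (1 / (2 - 2 * H)))
    (hg : Measurable g) (hY : ∀ s ω, Y s ω = g (s, B s ω))
    (hYp : MemLp (fun x : Ω × ℝ × ℝ => tensor (Y x.2.1 x.1) (Y x.2.2 x.1))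
      (ENNReal.ofReal p) (prodMeasure P T)) :
    ∃ J : Ω → ℝ, IsForwardIntegral P T Y B J ∧ ∀ L, IsLambda P H T B L →
      ∫ ω, J ω ^ 2 ∂P = ∫ x, inner ℝ (tensor (Y x.2.1 x.1) (Y x.2.2 x.1)) (L x.2.1 x.2.2 x.1)
        ∂(prodMeasure P T) := by
  obtain ⟨hq2, hqH⟩ := exponent_bounds hH hH' hq
  have hpos : ∀ᶠ ε in 𝓝[>] (0 : ℝ), 0 < ε := self_mem_nhdsWithin
  -- The absolute value only serves to define F on all of ℝ; along 𝓝[>] 0 it disappears.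
  have hmem : ∀ ε : ℝ, MemLp (fwdApprox T Y B |ε|) 2 P := fun ε =>
    hB.memLp_fwdApprox (by linarith) hpq hq2 hg hY hYp (abs_nonneg ε)
  let F : ℝ → Lp ℝ 2 P := fun ε => (hmem ε).toLp _
  have hlim : ∀ L, IsLambda P H T B L → Tendsto (fun e : ℝ × ℝ => inner ℝ (F e.1) (F e.2))
      (𝓝[>] 0 ×ˢ 𝓝[>] 0) (𝓝 (∫ x, inner ℝ (tensor (Y x.2.1 x.1) (Y x.2.2 x.1))
        (L x.2.1 x.2.2 x.1) ∂(prodMeasure P T))) := by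
    intro L hL
    refine (hB.tendsto_integral_inner_kerMat hH hH' hT hpq hq hYp hL).congr' ?_
    filter_upwards [hpos.prod_mk hpos] with e he
    rw [← hB.integral_fwdApprox_mul hH hH' hT hpq hq2 hqH hg hY hYp he.1 he.2, L2.inner_def]
    refine integral_congr_ae ?_
    filter_upwards [(hmem e.1).coeFn_toLp, (hmem e.2).coeFn_toLp] with ω h1 h2
    rw [h1, h2, abs_of_pos he.1, abs_of_pos he.2]
    simp [mul_comm]
  obtain ⟨J, hJ, hJn⟩ := exists_tendsto_of_tendsto_inner (hlim _ (hB.isLambda_limMat hH hH' hT))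
  have hJ2 : ∫ ω, J ω ^ 2 ∂P = ‖J‖ ^ 2 := by
    rw [← real_inner_self_eq_norm_sq, L2.inner_def]
    congr 1 with ω
    simp [sq]
  refine ⟨J, ⟨fun ε hε => hB.ae_integrable_integrand (by linarith) hpq hq2 hg hY hYp hε.le,
    fun ε hε => hB.memLp_fwdApprox (by linarith) hpq hq2 hg hY hYp hε.le, Lp.memLp J, ?_⟩, ?_⟩
  · refine ((Lp.tendsto_Lp_iff_tendsto_eLpNorm' F J).1 hJ).congr' ?_
    filter_upwards [hpos] with ε hε
    refine eLpNorm_congr_ae ?_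
    filter_upwards [(hmem ε).coeFn_toLp] with ω hω
    rw [Pi.sub_apply, hω, abs_of_pos hε]
  · intro L hL
    rw [hJ2, hJn]
    exact tendsto_nhds_unique (hlim _ (hB.isLambda_limMat hH hH' hT)) (hlim L hL)

/-! ### The decomposition of the limit -/

omit [MeasurableSpace Ω] in
-- The two matrices differ by ∂²R/∂t∂s times the identity, and the identity paired with a ⊗ b is ⟨a,
-- b⟩.
lemma inner_limMat (s t : ℝ) (ω : Ω) (a b : Vec d) :
    inner ℝ (tensor a b) (limMat H B s t ω) =
      inner ℝ a b * ddR H s t + inner ℝ (tensor a b) (weightMat H B s t ω) := by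
  have h : limMat H B s t ω = weightMat H B s t ω +
      WithLp.toLp 2 fun ij : Fin d × Fin d => if ij.1 = ij.2 then ddR H s t else 0 := by
    ext ij
    simp only [limMat, weightMat, regMat, PiLp.add_apply]
    split_ifs <;> ring
  rw [h, inner_add_right, add_comm]
  congr 1
  simp only [tensor, PiLp.inner_apply, RCLike.inner_apply, conj_trivial, Fintype.sum_prod_type,
    ite_mul, zero_mul, Finset.sum_ite_eq, Finset.mem_univ, if_true, Finset.sum_mul]
  exact Finset.sum_congr rfl fun i _ => by ring

lemma memLp_ddR (hH : 1 / 2 < H) (hH' : H < 1) (hT : 0 ≤ T) {q : ℝ} (hq : 0 < q)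
    (hqH : q * (2 - 2 * H) < 1) :
    MemLp (fun z : ℝ × ℝ => ddR H z.1 z.2) (ENNReal.ofReal q) (leb2 T) := by
  refine (memLp_singBound hq hqH hT).mono (aemeasurable_ddR hH).aestronglyMeasurable ?_
  filter_upwards [ae_leb2] with z hz
  rw [Real.norm_eq_abs, Real.norm_eq_abs]
  exact (abs_ddR_le hH hH' hz.1.1 hz.2.1.1 hz.2.2).trans (le_abs_self _)

end ForwardIntegral
end ForwardFBM

/-! ### The isometry formula -/

theorem theorem2 {Ω : Type*} [MeasurableSpace Ω] (P : Measure Ω) [IsProbabilityMeasure P]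
    (d : ℕ) (H T : ℝ) (hH : 1 / 2 < H) (hH' : H < 1) (hT : 0 < T)
    (B : ℝ → Ω → ForwardFBM.Vec d) (hB : ForwardFBM.IsFBM H B P)
    (g : ℝ × ForwardFBM.Vec d → ForwardFBM.Vec d) (hg : Measurable g)
    (Y : ℝ → Ω → ForwardFBM.Vec d) (hY : ∀ s ω, Y s ω = g (s, B s ω))
    (p : ℝ≥0∞) (hp : ENNReal.ofReal (max (1 / (2 - 2 * H)) (1 / (2 * H - 1))) < p)
    (hYp : MemLp (fun x : Ω × ℝ × ℝ => ForwardFBM.tensor (Y x.2.1 x.1) (Y x.2.2 x.1)) p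
      (ForwardFBM.prodMeasure P T)) :
    (∃ L : ℝ → ℝ → Ω → ForwardFBM.Mat d, ForwardFBM.IsLambda P H T B L) ∧
    ∃ J : Ω → ℝ, ForwardFBM.IsForwardIntegral P T Y B J ∧
      Integrable (fun x : Ω × ℝ × ℝ =>
        inner ℝ (Y x.2.1 x.1) (Y x.2.2 x.1) * ForwardFBM.ddR H x.2.1 x.2.2)
        (ForwardFBM.prodMeasure P T) ∧
      Integrable (fun x : Ω × ℝ × ℝ =>
        inner ℝ (ForwardFBM.tensor (Y x.2.1 x.1) (Y x.2.2 x.1))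
          (ForwardFBM.W P H B x.2.1 x.2.2 x.1)) (ForwardFBM.prodMeasure P T) ∧
      (∫ ω, J ω ^ 2 ∂P =
        (∫ ω, ForwardFBM.rkhsInner H T (fun s => Y s ω) (fun s => Y s ω) ∂P) +
          ForwardFBM.expInt P T (fun ω s t =>
            inner ℝ (ForwardFBM.tensor (Y s ω) (Y t ω)) (ForwardFBM.W P H B s t ω))) ∧
      ∀ L : ℝ → ℝ → Ω → ForwardFBM.Mat d, ForwardFBM.IsLambda P H T B L →
        Integrable (fun x : Ω × ℝ × ℝ =>
          inner ℝ (ForwardFBM.tensor (Y x.2.1 x.1) (Y x.2.2 x.1)) (L x.2.1 x.2.2 x.1))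
          (ForwardFBM.prodMeasure P T) ∧
        ∫ ω, J ω ^ 2 ∂P =
          ForwardFBM.expInt P T (fun ω s t =>
            inner ℝ (ForwardFBM.tensor (Y s ω) (Y t ω)) (L s t ω)) := by
  obtain ⟨p', q, hpq, hq1, hq, hYq⟩ := ForwardFBM.exists_holder_exponents hH hH' hp hYp
  obtain ⟨hq2, hqH⟩ := ForwardFBM.exponent_bounds hH hH' hq
  have hΛ := hB.isLambda_limMat hH hH' hT.le
  obtain ⟨J, hJ, hJL⟩ := hB.exists_isForwardIntegral hH hH' hT.le hpq hq hg hY hYq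
  have hY1 : AEStronglyMeasurable (fun x : Ω × ℝ × ℝ => Y x.2.1 x.1)
      (ForwardFBM.prodMeasure P T) := by
    simp only [hY]
    exact (hg.comp_aemeasurable
      ((by fun_prop : Measurable fun x : Ω × ℝ × ℝ => x.2.1).aemeasurable.prodMk
        hB.aemeasurable_fst)).aestronglyMeasurable
  have hY2 : AEStronglyMeasurable (fun x : Ω × ℝ × ℝ => Y x.2.2 x.1)
      (ForwardFBM.prodMeasure P T) := by
    simp only [hY]
    exact (hg.comp_aemeasurable
      ((by fun_prop : Measurable fun x : Ω × ℝ × ℝ => x.2.2).aemeasurable.prodMk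
        hB.aemeasurable_snd)).aestronglyMeasurable
  have hR : MemLp (fun x : Ω × ℝ × ℝ => ForwardFBM.ddR H x.2.1 x.2.2) (ENNReal.ofReal q)
      (ForwardFBM.prodMeasure P T) :=
    (ForwardFBM.memLp_ddR hH hH' hT.le (by linarith) hqH).comp_snd P
  have hint1 : Integrable (fun x : Ω × ℝ × ℝ =>
      inner ℝ (Y x.2.1 x.1) (Y x.2.2 x.1) * ForwardFBM.ddR H x.2.1 x.2.2)
      (ForwardFBM.prodMeasure P T) := by
    have : ENNReal.HolderConjugate (ENNReal.ofReal p') (ENNReal.ofReal q) := hpq.ennrealOfReal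
    -- |⟨Y_s, Y_t⟩| ≤ |Y_s| |Y_t| = |Y_s ⊗ Y_t|, so the Hölder pairing with ∂²R/∂t∂s dominates.
    refine (hYq.norm.integrable_mul hR.norm).mono ((hY1.inner hY2).mul hR.1)
      (Eventually.of_forall fun x => ?_)
    rw [Pi.mul_apply, norm_mul, norm_mul, norm_norm, norm_norm, ForwardFBM.norm_tensor]
    exact mul_le_mul_of_nonneg_right (norm_inner_le_norm _ _) (norm_nonneg _)
  have hW : ∀ᵐ x ∂(ForwardFBM.prodMeasure P T),
      ForwardFBM.weightMat H B x.2.1 x.2.2 x.1 = ForwardFBM.W P H B x.2.1 x.2.2 x.1 :=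
    ForwardFBM.ae_prodMeasure_of_ae_leb2 ForwardFBM.ae_leb2 |>.mono fun x hx =>
      (hB.W_eq_weightMat hx.1.1.le hx.2.1.1.le x.1).symm
  have hint2 : Integrable (fun x : Ω × ℝ × ℝ =>
      inner ℝ (ForwardFBM.tensor (Y x.2.1 x.1) (Y x.2.2 x.1))
        (ForwardFBM.W P H B x.2.1 x.2.2 x.1)) (ForwardFBM.prodMeasure P T) :=
    (ForwardFBM.integrable_inner_of_memLp hpq hYq
      (hB.memLp_weightMat hH hH' hT.le hq1 hq2 hqH)).congr (hW.mono fun x hx => by simp only [hx])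
  refine ⟨⟨_, hΛ⟩, J, hJ, hint1, hint2, ?_, fun L hL => ?_⟩
  · have h1 : ∫ ω, J ω ^ 2 ∂P = ∫ x : Ω × ℝ × ℝ,
        (inner ℝ (Y x.2.1 x.1) (Y x.2.2 x.1) * ForwardFBM.ddR H x.2.1 x.2.2 +
          inner ℝ (ForwardFBM.tensor (Y x.2.1 x.1) (Y x.2.2 x.1))
            (ForwardFBM.W P H B x.2.1 x.2.2 x.1)) ∂(ForwardFBM.prodMeasure P T) := by
      rw [hJL _ hΛ]
      refine integral_congr_ae (hW.mono fun x hx => ?_)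
      simp only [ForwardFBM.inner_limMat, hx]
    rw [h1, integral_add hint1 hint2]
    exact congrArg₂ (· + ·) (integral_prod _ hint1) (integral_prod _ hint2)
  · have h2 : Integrable (fun x : Ω × ℝ × ℝ =>
        inner ℝ (ForwardFBM.tensor (Y x.2.1 x.1) (Y x.2.2 x.1)) (L x.2.1 x.2.2 x.1))
        (ForwardFBM.prodMeasure P T) :=
      ForwardFBM.integrable_inner_of_memLp hpq hYq (hL.memLp q hq1 hq)
    exact ⟨h2, (hJL L hL).trans (integral_prod _ h2)⟩
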